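/- Let $(A,\mathfrak m)$ be a Cohen–Macaulay local ring with $d=\dim A>0$, and let $I$ be a canonical ideal of $A$, i.e. an ideal $I\neq A$ that is isomorphic, as an $A$-module, to a canonical module $\mathrm K_A$ of $A$. Let $\mathrm r(A)=\ell_A(\operatorname{Ext}^d_A(A/\mathfrak m,A))$ be the Cohen–Macaulay type of $A$. A parameter ideal is an ideal $Q=(a_1,\dots,a_d)$ generated by a system of parameters of $A$. Given such a $Q$, put $J=I+Q$, let $\mathcal T=A[Qt]$ and $\mathcal R=A[Jt]$ be the Rees algebras of $Q$ and $J$ in $A[t]$, let $\mathrm{gr}_J(A)=\mathcal R/J\mathcal R\cong\bigoplus_{n\ge0}J^n/J^{n+1}$, and let $$\mathcal S_Q(J)=J\mathcal R/J\mathcal T\cong\bigoplus_{i\ge1}J^{i+1}/JQ^i$$ be the Sally module, a graded $\mathcal T$-module whose rank is $\ell_{\mathcal T_{\mathfrak p}}(\mathcal S_Q(J)_{\mathfrak p})$ with $\mathfrak p=\mathfrak m\mathcal T$. The ideal $Q$ is a reduction of $J$ if $J^{r+1}=QJ^r$ for some $r\ge0$. The Hilbert coefficients $\mathrm e_i(J)\in\mathbb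 Z$ are defined by $\ell_A(A/J^{n+1})=\sum_{i=0}^d(-1)^i\mathrm e_i(J)\binom{n+d-i}{d-i}$ for all $n\gg0$. The ring $A$ is called $n$-Goto (with respect to $I$) if there is a parameter ideal $Q=(a_1,\dots,a_d)$ with $a_1\in I$ such that, for $J=I+Q$, $\mathcal S_Q(J)$ has rank $n$ and is generated over $\mathcal T$ by its homogeneous elements of degree one. **Theorem 11.1.** Consider the following conditions, where in each of (3)–(8) $J=I+Q$. 1. $A$ is a $0$-Goto ring. 2. $A$ is a Gorenstein ring. 3. There is a parameter ideal $Q=(a_1,\dots,a_d)$ of $A$ such that $a_1\in I$ and $I+Q=Q$ (that is, $J=Q$). 4. There is a parameter ideal $Q=(a_1,\dots,a_d)$ of $A$ such that $a_1\in I$ and $\mathcal S_Q(J)=(0)$. 5. There is a parameter ideal $Q=(a_1,\dots,a_d)$ of $A$ such that $a_1\in I$, $Q$ is a reduction of $J$, and $\mathrm e_1(J)<\mathrm r(A)$. 6. There is a parameter ideal $Q=(a_1,\dots,a_d)$ of $A$ such that $a_1\in I$, $Q$ is a reduction of $J$, and $\mathrm e_1(J)=\mathrm r(A)-1$. 7.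 There is a parameter ideal $Q=(a_1,\dots,a_d)$ of $A$ such that $a_1\in I$, $Q$ is a reduction of $J$, and $\mathrm e_1(J)=0$. 8. There is a parameter ideal $Q=(a_1,\dots,a_d)$ of $A$ such that $a_1\in I$, $Q$ is a reduction of $J$, and $\mathrm{gr}_J(A)$ is a Cohen–Macaulay ring. Then the conditions (1), (4), (5), (6) are equivalent, and the implications $(3)\Rightarrow(1)\Rightarrow(2)$, $(3)\Rightarrow(8)\Rightarrow(2)$ and $(7)\Rightarrow(5)$ hold. If moreover the residue field $A/\mathfrak m$ is infinite, then $(2)\Rightarrow(3)$ and $(2)\Rightarrow(7)$ hold as well, so that all the conditions (1)–(8) are equivalent. -/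

import Mathlib

/-! ### Cohen–Macaulay and Gorenstein rings, canonical modules -/

section Local

open CategoryTheory

universe u

variable (A : Type u) [CommRing A] [IsLocalRing A]

/-- `M` is a maximal Cohen–Macaulay module over the local ring `A`: there is an `M`-regular
sequence in the maximal ideal of length `dim A`, that is, `depth M = dim A`. -/
def IsMaximalCohenMacaulay (M : Type*) [AddCommGroup M] [Module A M] : Prop :=
  ∃ rs : List A, (∀ r ∈ rs, r ∈ IsLocalRing.maximalIdeal A) ∧
    RingTheory.Sequence.IsRegular M rs ∧ (rs.length : WithBot ℕ∞) = ringKrullDim A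

/-- A Cohen–Macaulay local ring. -/
def IsCohenMacaulayLocalRing : Prop :=
  IsNoetherianRing A ∧ IsMaximalCohenMacaulay A A

/-- A local ring is Gorenstein if it is Noetherian and has finite injective dimension as a module
over itself. -/
def IsGorensteinLocalRing : Prop :=
  IsNoetherianRing A ∧ ∃ n : ℕ, HasInjectiveDimensionLE (ModuleCat.of A A) n

/-- The length of `Ext^i_A(A/𝔪, M)`. For a maximal Cohen–Macaulay module `M` and `i = dim A` this
is the Cohen–Macaulay type `r(M)` of `M`. -/
noncomputable def extLength (M : Type u) [AddCommGroup M] [Module A M] (i : ℕ) : ℕ∞ :=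
  Module.length A
    (Abelian.Ext (ModuleCat.of A (IsLocalRing.ResidueField A)) (ModuleCat.of A M) i)

/-- The Cohen–Macaulay type `r(A) = ℓ_A(Ext^d_A(A/𝔪, A))` of a Cohen–Macaulay local ring `A` of
dimension `d` (this length is finite, since `A` is Noetherian). -/
noncomputable def cmType (d : ℕ) : ℕ := (extLength A A d).toNat

/-- `M` is a canonical module of the Cohen–Macaulay local ring `A` of dimension `d`: a finitely
generated maximal Cohen–Macaulay module of type one and of finite injective dimension. -/
def IsCanonicalModule (d : ℕ) (M : Type u) [AddCommGroup M] [Module A M] : Prop :=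
  Module.Finite A M ∧ IsMaximalCohenMacaulay A M ∧ extLength A M d = 1 ∧
    ∃ n : ℕ, HasInjectiveDimensionLE (ModuleCat.of A M) n

variable {A}

/-- A canonical ideal: a proper ideal which is a canonical module. -/
def IsCanonicalIdeal (d : ℕ) (I : Ideal A) : Prop :=
  I ≠ ⊤ ∧ IsCanonicalModule A d I

/-- `a_1, …, a_d` is a system of parameters, i.e. `d = dim A` and the ideal `(a_1, …, a_d)` is
`𝔪`-primary; the ideal is then called a parameter ideal. -/
def IsSystemOfParameters {d : ℕ} (a : Fin d → A) : Prop :=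
  ringKrullDim A = d ∧ (Ideal.span (Set.range a)).radical = IsLocalRing.maximalIdeal A

end Local

/-- A Cohen–Macaulay ring (not necessarily local): Noetherian, with all localizations at prime
ideals Cohen–Macaulay. -/
def IsCohenMacaulayRing (R : Type*) [CommRing R] : Prop :=
  IsNoetherianRing R ∧
    ∀ (p : Ideal R) [p.IsPrime], IsCohenMacaulayLocalRing (Localization.AtPrime p)

/-! ### Reductions, Hilbert coefficients, the associated graded ring -/

section Ideals

variable {A : Type*} [CommRing A]

/-- `Q` is a reduction of `J`. -/
def IsReduction (Q J : Ideal A) : Prop :=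
  Q ≤ J ∧ ∃ r : ℕ, J ^ (r + 1) = Q * J ^ r

/-- `e 0, …, e d` are the Hilbert coefficients `e_0(J), …, e_d(J)` of the `𝔪`-primary ideal `J` of
a `d`-dimensional Noetherian local ring: for all large `n`,
`ℓ(A/J^(n+1)) = ∑_{i=0}^d (-1)^i e_i(J) (n+d-i choose d-i)`.
(Only the values `e 0, …, e d` matter; they are determined by the equation.) -/
def IsHilbertCoefficients (J : Ideal A) (d : ℕ) (e : ℕ → ℤ) : Prop :=
  ∀ᶠ n : ℕ in Filter.atTop,
    ∃ l : ℕ, Module.length A (A ⧸ J ^ (n + 1)) = (l : ℕ∞) ∧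
      (l : ℤ) = ∑ i ∈ Finset.range (d + 1),
        (-1) ^ i * e i * ((n + d - i).choose (d - i) : ℤ)

/-- The associated graded ring `gr_J(A) = R(J)/J R(J) ≅ ⨁ J^n/J^(n+1)`, where `R(J) = A[Jt]`. -/
abbrev AssociatedGradedRing (J : Ideal A) : Type _ :=
  reesAlgebra J ⧸ J.map (algebraMap A (reesAlgebra J))

end Ideals

/-! ### Quotients of submodules -/

section SubmoduleQuotient

variable {B M : Type*} [Ring B] [AddCommGroup M] [Module B M]

/-- The quotient `N₁/N₂` of a submodule `N₁` by a submodule `N₂ ⊆ N₁` (in general,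
`N₁/(N₁ ∩ N₂)`). -/
def SubmoduleQuotient (N₁ N₂ : Submodule B M) : Type _ := N₁ ⧸ N₂.submoduleOf N₁

instance (N₁ N₂ : Submodule B M) : AddCommGroup (SubmoduleQuotient N₁ N₂) :=
  inferInstanceAs (AddCommGroup (N₁ ⧸ N₂.submoduleOf N₁))

instance (N₁ N₂ : Submodule B M) : Module B (SubmoduleQuotient N₁ N₂) :=
  inferInstanceAs (Module B (N₁ ⧸ N₂.submoduleOf N₁))

/-- The projection `N₁ → N₁/N₂`. -/
def SubmoduleQuotient.mk (N₁ N₂ : Submodule B M) : N₁ →ₗ[B] SubmoduleQuotient N₁ N₂ :=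
  (N₂.submoduleOf N₁).mkQ

end SubmoduleQuotient

/-! ### Sally modules -/

section Sally

open Polynomial

variable {A : Type*} [CommRing A] {J Q : Ideal A}

/-- `J R(J)`, where `R(J) = A[Jt] ⊆ A[t]`, as a module over `T = A[Qt]` for `Q ⊆ J`:
the polynomials whose `i`-th coefficient lies in `J^(i+1)`. -/
def sallyNumerator (h : Q ≤ J) : Submodule (reesAlgebra Q) A[X] where
  carrier := {f | ∀ i, f.coeff i ∈ J ^ (i + 1)}
  add_mem' hf hg i := by
    rw [coeff_add]
    exact Ideal.add_mem _ (hf i) (hg i)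
  zero_mem' _ := by simp
  smul_mem' c f hf i := by
    rw [Subalgebra.smul_def, smul_eq_mul, coeff_mul]
    refine Ideal.sum_mem _ fun x hx => ?_
    rw [← Finset.HasAntidiagonal.mem_antidiagonal.mp hx, add_assoc, pow_add]
    exact Ideal.mul_mem_mul (Ideal.pow_right_mono h _ (c.2 x.1)) (hf x.2)

/-- `J T`, where `T = A[Qt] ⊆ A[t]`, as a `T`-module: the polynomials whose `i`-th coefficient lies
in `J Q^i`. -/
def sallyDenominator (J Q : Ideal A) : Submodule (reesAlgebra Q) A[X] where
  carrier := {f | ∀ i, f.coeff i ∈ J * Q ^ i}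
  add_mem' hf hg i := by
    rw [coeff_add]
    exact Ideal.add_mem _ (hf i) (hg i)
  zero_mem' _ := by simp
  smul_mem' c f hf i := by
    rw [Subalgebra.smul_def, smul_eq_mul, coeff_mul]
    refine Ideal.sum_mem _ fun x hx => ?_
    rw [← Finset.HasAntidiagonal.mem_antidiagonal.mp hx, pow_add, mul_left_comm]
    exact Ideal.mul_mem_mul (c.2 x.1) (hf x.2)

/-- The Sally module `S_Q(J) = J R(J)/J T ≅ ⨁_{i ≥ 1} J^(i+1)/J Q^i` over `T = A[Qt]`. -/
abbrev SallyModule (h : Q ≤ J) : Type _ :=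
  SubmoduleQuotient (sallyNumerator h) (sallyDenominator J Q)

/-- The homogeneous elements of degree one of the Sally module, i.e. the classes of the
monomials `a t` with `a ∈ J²`. -/
def sallyDegreeOne (h : Q ≤ J) : Set (SallyModule h) :=
  {s | ∃ f : sallyNumerator h, (∃ a : A, (f : A[X]) = monomial 1 a) ∧
    SubmoduleQuotient.mk (sallyNumerator h) (sallyDenominator J Q) f = s}

/-- The Sally module is generated over `T` by its homogeneous elements of degree one. -/
def SallyGeneratedInDegreeOne (h : Q ≤ J) : Prop :=
  Submodule.span (reesAlgebra Q) (sallyDegreeOne h) = ⊤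

/-- The rank of the Sally module: the length over `T_𝔭` of its localization at `𝔭 = 𝔪T`.
(When `Q` is a parameter ideal of a Cohen–Macaulay local ring, the ideal `𝔪T` is prime; the value
is `⊤` if it is not.) -/
noncomputable def sallyRank [IsLocalRing A] (h : Q ≤ J) : ℕ∞ :=
  ⨅ _ : ((IsLocalRing.maximalIdeal A).map (algebraMap A (reesAlgebra Q))).IsPrime,
    Module.length
      (Localization.AtPrime ((IsLocalRing.maximalIdeal A).map (algebraMap A (reesAlgebra Q))))
      (LocalizedModule.AtPrime ((IsLocalRing.maximalIdeal A).map (algebraMap A (reesAlgebra Q)))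
        (SallyModule h))

end Sally

/-! ### Conditions on parameter ideals -/

section Conditions

variable {A : Type*} [CommRing A] [IsLocalRing A]

/-- There is a parameter ideal `Q = (a_1, …, a_d)` of `A` (of dimension `d > 0`) with `a_1 ∈ I`
such that `P Q J` holds, where `J = I + Q`. -/
def ExistsParameterIdeal (I : Ideal A) {d : ℕ} (hd : 0 < d)
    (P : ∀ Q J : Ideal A, Q ≤ J → Prop) : Prop :=
  ∃ a : Fin d → A, IsSystemOfParameters a ∧ a ⟨0, hd⟩ ∈ I ∧
    P (Ideal.span (Set.range a)) (I ⊔ Ideal.span (Set.range a)) le_sup_right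

/-- `A` is an `n`-Goto ring (with canonical ideal `I`): for some `Q` as above, the Sally module
`S_Q(J)` has rank `n` and is generated by its homogeneous elements of degree one. -/
def IsGoto (n : ℕ) (I : Ideal A) {d : ℕ} (hd : 0 < d) : Prop :=
  ExistsParameterIdeal I hd fun _ _ h => sallyRank h = n ∧ SallyGeneratedInDegreeOne h

/-- For some `Q` as above, `I + Q = Q`. -/
def ExistsSumEqParameterIdeal (I : Ideal A) {d : ℕ} (hd : 0 < d) : Prop :=
  ExistsParameterIdeal I hd fun Q J _ => J = Q

/-- For some `Q` as above, `S_Q(J) = 0`. -/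
def ExistsSallyModuleZero (I : Ideal A) {d : ℕ} (hd : 0 < d) : Prop :=
  ExistsParameterIdeal I hd fun _ _ h => Subsingleton (SallyModule h)

/-- For some `Q` as above, `Q` is a reduction of `J` and the first Hilbert coefficient `e_1(J)`
satisfies the condition `p`. -/
def ExistsReductionWithE1 (I : Ideal A) {d : ℕ} (hd : 0 < d) (p : ℤ → Prop) : Prop :=
  ExistsParameterIdeal I hd fun Q J _ => IsReduction Q J ∧
    ∃ e : ℕ → ℤ, IsHilbertCoefficients J d e ∧ p (e 1)

/-- For some `Q` as above, `Q` is a reduction of `J` and `gr_J(A)` is a Cohen–Macaulay ring. -/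
def ExistsReductionGrCohenMacaulay (I : Ideal A) {d : ℕ} (hd : 0 < d) : Prop :=
  ExistsParameterIdeal I hd fun Q J _ => IsReduction Q J ∧
    IsCohenMacaulayRing (AssociatedGradedRing J)

end Conditions

/-! Each of the eight conditions amounts to one statement: I is generated by the first member a_1 of
a system of parameters (`IsGeneratedByParameter`). If I = (a_1), then J = Q, so the Sally module S
vanishes, gr_Q(A) is a polynomial ring over the Artinian ring A/Q, e_1(Q) = 0, r(A) = 1, and A ≅ I
has finite injective dimension. The work lies in recovering I = (a_1) from each condition.

Write Q' = (a_2, …, a_d). Three facts carry the argument. (i) a_1 is regular on I/Q'I. Since a_1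
also lies in I, this gives I ∩ Q' ⊆ Q'I, hence I ∩ Q ⊆ (a_1) + Q'I and I ∩ QJ ⊆ QI. (ii) E = I/QI is
a dualizing module for A/Q: Hom(-, E) is exact on finite length modules killed by Q, and the socle
of E is simple. Counting lengths gives End(E) = A/Q and identifies r(A) with the minimal number of
generators of I. (iii) Systems of parameters are quasi-regular: Q^n/LQ^n is free over A/L on the
monomials of degree n whenever L ⊇ Q. So T/𝔪T is a polynomial ring over the residue field, and no
element of T outside 𝔪T kills a nonzero homogeneous element of S.

If J = Q, fact (i) and Nakayama give I = (a_1). If S = 0, then J² ⊆ QJ, so I² ⊆ QI by (i).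
Multiplication by y ∈ I therefore maps I/Q'I into a_1(I/Q'I), and y/a_1 is an endomorphism of I/Q'I.
It induces a scalar b on E by (ii), whence y ≡ b a_1 modulo QI, and Nakayama applies again
(`IsCanonicalIdeal.eq_span_singleton_of_sq_le`).

Other conditions reduce to these. Rank 0 forces S = 0 by (iii). If S ≠ 0 and Q is a reduction of J,
a socle element of a graded piece of S generates a shifted copy of T/𝔪T, and Hilbert polynomials
give e_1(J) ≥ ℓ(A/Q) - ℓ(A/J) + 1. This is at least r(A), because J/Q maps onto I/((a_1) + 𝔪I); so
e_1(J) < r(A) forces S = 0. If gr_J(A) is Cohen–Macaulay, then a_1 z ∈ J² implies z ∈ J, and the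
simple socle of E yields I² ⊆ QJ. If A is Gorenstein, then r(A) = 1, so I is cyclic; it is faithful,
so its generator is a regular element and extends to a system of parameters. -/

section

open IsLocalRing RingTheory.Sequence CategoryTheory Abelian Pointwise

/-! ### Depth, associated primes, and systems of parameters as regular sequences -/

section SystemsOfParameters

universe u

variable {R : Type u} [CommRing R] [IsLocalRing R] [IsNoetherianRing R]

/-- Associated primes of `M` specialize to associated primes of `M / xM`. -/
theorem exists_mem_associatedPrimes_quotSMulTop {M : Type*} [AddCommGroup M] [Module R M]
    [Module.Finite R M] {x : R} (hx : IsSMulRegular M x) (hxm : x ∈ maximalIdeal R)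
    {p : Ideal R} (hp : p ∈ associatedPrimes R M) :
    ∃ p' ∈ associatedPrimes R (QuotSMulTop x M), p ≤ p' ∧ x ∈ p' := by
  obtain ⟨hpp, m, hm⟩ := isAssociatedPrime_iff.mp hp
  let N : Submodule R M := Submodule.torsionBySet R M p
  have hmN : m ∈ N := by
    rw [Submodule.mem_torsionBySet_iff]
    rintro ⟨a, ha⟩
    simpa [hm, Submodule.mem_colon_singleton] using ha
  have hm0 : m ≠ 0 := by
    rintro rfl
    apply hpp.ne_top
    simp [hm]
  -- The submodule N killed by p cannot lie in xM: by regularity of x that would give N ⊆ xN, and N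
  -- = 0 by Nakayama. An element of N outside xM has a class killed by both p and x.
  obtain ⟨n, hnN, hn⟩ : ∃ n ∈ N, n ∉ x • (⊤ : Submodule R M) := by
    by_contra! h
    have hle : N ≤ Ideal.span {x} • N := by
      intro n hn
      obtain ⟨m', -, rfl⟩ := (Submodule.mem_smul_pointwise_iff_exists _ _ _).mp (h n hn)
      refine Submodule.smul_mem_smul (Ideal.mem_span_singleton_self x) ?_
      rw [Submodule.mem_torsionBySet_iff] at hn ⊢
      intro a
      apply hx
      simpa [smul_comm x] using hn a
    have := Submodule.eq_bot_of_le_smul_of_le_jacobson_bot (Ideal.span {x}) N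
      (IsNoetherian.noetherian N) hle
      ((Ideal.span_singleton_le_iff_mem _).mpr (maximalIdeal_le_jacobson _ hxm))
    exact hm0 (by simpa [this] using hmN)
  obtain ⟨p', hp', hle⟩ := exists_le_isAssociatedPrime_of_isNoetherianRing R
    (Submodule.Quotient.mk n : QuotSMulTop x M)
    (by rwa [Ne, Submodule.Quotient.mk_eq_zero])
  refine ⟨p', hp', fun a ha => hle ?_, hle ?_⟩
  · rw [Submodule.mem_colon_singleton, ← Submodule.Quotient.mk_smul]
    have : a • n = 0 := (Submodule.mem_torsionBySet_iff _ _).mp hnN ⟨a, ha⟩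
    simp [this]
  · rw [Submodule.mem_colon_singleton, ← Submodule.Quotient.mk_smul, Submodule.mem_bot,
      Submodule.Quotient.mk_eq_zero]
    exact Submodule.smul_mem_pointwise_smul _ _ _ trivial

theorem ringKrullDim_quotient_add_one_le_of_lt {R : Type*} [CommRing R] {p p' : Ideal R} [p.IsPrime]
    (h : p < p') : ringKrullDim (R ⧸ p') + 1 ≤ ringKrullDim (R ⧸ p) := by
  obtain ⟨x, hx', hx⟩ := SetLike.exists_of_lt h
  refine ringKrullDim_succ_le_of_surjective (Ideal.Quotient.factor h.le)
    (Ideal.Quotient.factor_surjective h.le) (r := Ideal.Quotient.mk p x) ?_ ?_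
  · exact mem_nonZeroDivisors_of_ne_zero (by rwa [Ne, Ideal.Quotient.eq_zero_iff_mem])
  · simpa [Ideal.Quotient.eq_zero_iff_mem] using hx'

/-- The length of a regular sequence is at most the dimension of any associated prime. -/
theorem length_le_ringKrullDim_quotient_of_mem_associatedPrimes {M : Type*} [AddCommGroup M]
    [Module R M] [Module.Finite R M] {rs : List R} (hrs : IsRegular M rs)
    (hmem : ∀ r ∈ rs, r ∈ maximalIdeal R) {p : Ideal R} (hp : p ∈ associatedPrimes R M) :
    (rs.length : WithBot ℕ∞) ≤ ringKrullDim (R ⧸ p) := by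
  induction rs generalizing M p with
  | nil =>
    have : p.IsPrime := hp.isPrime
    simpa using ringKrullDim_nonneg_of_nontrivial
  | cons x rs ih =>
    rw [isRegular_cons_iff] at hrs
    have : p.IsPrime := hp.isPrime
    have hxm := hmem x List.mem_cons_self
    obtain ⟨p', hp', hle, hxp'⟩ := exists_mem_associatedPrimes_quotSMulTop hrs.1 hxm hp
    have hxp : x ∉ p := fun h => by
      have := Set.mem_biUnion hp h
      rw [biUnion_associatedPrimes_eq_compl_regular] at this
      exact this hrs.1
    refine le_trans ?_ (ringKrullDim_quotient_add_one_le_of_lt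
      (lt_of_le_of_ne hle (by rintro rfl; exact hxp hxp')))
    rw [List.length_cons, Nat.cast_succ]
    gcongr
    exact ih hrs.2 (fun r hr => hmem r (List.mem_cons_of_mem x hr)) hp'

/-- The maximal ideal is a minimal prime of the ideal generated by the list, so Krull's height
theorem bounds its height. -/
theorem ringKrullDim_le_length_of_maximalIdeal_le_radical (as : List R)
    (hmem : ∀ a ∈ as, a ∈ maximalIdeal R)
    (h : maximalIdeal R ≤ (Ideal.ofList as).radical) : ringKrullDim R ≤ as.length := by
  have hmin : maximalIdeal R ∈ (Ideal.ofList as).minimalPrimes := by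
    refine ⟨⟨inferInstance, Ideal.span_le.mpr hmem⟩, fun q hq _ => h.trans ?_⟩
    exact hq.1.radical_le_iff.mpr hq.2
  rw [← maximalIdeal_height_eq_ringKrullDim]
  have hfin : ({r | r ∈ as} : Set R).Finite := List.finite_toSet as
  have := Ideal.height_le_card_of_mem_minimalPrimes_span hfin hmin
  refine WithBot.coe_le_coe.mpr (this.trans ?_)
  classical
  have h2 : ({r | r ∈ as} : Set R).ncard ≤ as.length := by
    rw [← List.coe_toFinset as, Set.ncard_coe_finset]
    exact List.toFinset_card_le as
  exact_mod_cast h2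

theorem ringKrullDim_quotient_le_length (p : Ideal R) [p.IsPrime] (as : List R)
    (hmem : ∀ a ∈ as, a ∈ maximalIdeal R)
    (h : maximalIdeal R ≤ (p ⊔ Ideal.ofList as).radical) :
    ringKrullDim (R ⧸ p) ≤ as.length := by
  have := IsLocalRing.of_surjective' (Ideal.Quotient.mk p) Ideal.Quotient.mk_surjective
  have hmap := IsLocalRing.map_maximalIdeal_of_surjective (Ideal.Quotient.mk p)
    Ideal.Quotient.mk_surjective
  rw [← List.length_map (Ideal.Quotient.mk p)]
  refine ringKrullDim_le_length_of_maximalIdeal_le_radical _ ?_ ?_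
  · intro a ha
    obtain ⟨b, hb, rfl⟩ := List.mem_map.mp ha
    exact hmap ▸ Ideal.mem_map_of_mem _ (hmem b hb)
  · rw [← hmap, ← Ideal.map_ofList, Ideal.map_le_iff_le_comap, Ideal.comap_radical,
      Ideal.comap_map_of_surjective _ Ideal.Quotient.mk_surjective, sup_comm]
    rwa [← RingHom.ker_eq_comap_bot, Ideal.mk_ker]

theorem maximalIdeal_smul_top_lt_top {R M : Type*} [CommRing R] [IsLocalRing R] [AddCommGroup M]
    [Module R M] [Module.Finite R M] [Nontrivial M] : maximalIdeal R • (⊤ : Submodule R M) < ⊤ :=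
  lt_top_iff_ne_top.mpr
    (Submodule.top_ne_ideal_smul_of_le_jacobson_annihilator (maximalIdeal_le_jacobson _)).symm

/-- Dividing out a regular element lowers the depth by at most one. -/
theorem exists_isRegular_quotSMulTop {M : Type u} [AddCommGroup M]
    [Module R M] [Module.Finite R M] {rs : List R} (hrs : IsRegular M rs)
    (hmem : ∀ r ∈ rs, r ∈ maximalIdeal R) {n : ℕ} (hn : rs.length = n + 1)
    {b : R} (hb : IsSMulRegular M b) (hbm : b ∈ maximalIdeal R) :
    ∃ rs' : List R, rs'.length = n ∧ (∀ r ∈ rs', r ∈ maximalIdeal R) ∧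
      IsRegular (QuotSMulTop b M) rs' := by
  have := hrs.nontrivial
  have := nontrivial_quotSMulTop_of_mem_maximalIdeal M hbm
  have hsupp : Module.support R (ResidueField R) =
      PrimeSpectrum.zeroLocus (maximalIdeal R) := by
    rw [Module.support_eq_zeroLocus, ← Ideal.annihilator_quotient (I := maximalIdeal R)]
    rfl
  -- Depth is detected by vanishing of Ext^i(k, -). The sequence 0 → M → M → M/bM → 0 costs one
  -- degree, leaving vanishing for i < n.
  have hext := ModuleCat.subsingleton_ext_of_exists_isRegular (maximalIdeal R)
    (ModuleCat.of R (ResidueField R)) hsupp.subset (ModuleCat.of R M)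
    maximalIdeal_smul_top_lt_top rs hmem hrs
  obtain ⟨rs', h1, h2, h3⟩ := ModuleCat.exists_isRegular_of_exists_subsingleton_ext
    (maximalIdeal R) n (ModuleCat.of R (QuotSMulTop b M)) maximalIdeal_smul_top_lt_top
    (ModuleCat.of R (ResidueField R)) hsupp (fun i hi => by
      have z1 := AddCommGrpCat.isZero_of_iff_subsingleton.mpr (hext i (by omega))
      have z2 := AddCommGrpCat.isZero_of_iff_subsingleton.mpr (hext (i + 1) (by omega))
      have hb' : IsSMulRegular (ModuleCat.of R M) b := hb
      exact AddCommGrpCat.subsingleton_of_isZero <| ShortComplex.Exact.isZero_of_both_zeros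
        ((Ext.covariant_sequence_exact₃' _ hb'.smulShortComplex_shortExact) i (i + 1) rfl)
        (z1.eq_zero_of_src _) (z2.eq_zero_of_tgt _))
  exact ⟨rs', h1, h2, h3⟩

/-- If a finite module has a regular sequence of length `n`, then any `n` elements of the maximal
ideal generating an ideal which is primary to the maximal ideal modulo the annihilator form a
regular sequence. -/
theorem isRegular_of_maximalIdeal_le_radical {M : Type u} [AddCommGroup M]
    [Module R M] [Module.Finite R M] {rs : List R} (hrs : IsRegular M rs)
    (hmem : ∀ r ∈ rs, r ∈ maximalIdeal R) (as : List R) (has : as.length = rs.length)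
    (hasm : ∀ a ∈ as, a ∈ maximalIdeal R)
    (h : maximalIdeal R ≤ (Module.annihilator R M ⊔ Ideal.ofList as).radical) :
    IsRegular M as := by
  induction as generalizing M rs with
  | nil =>
    have := hrs.nontrivial
    exact IsRegular.nil R M
  | cons b as ih =>
    have hbm := hasm b List.mem_cons_self
    have hasm' : ∀ a ∈ as, a ∈ maximalIdeal R := fun a ha => hasm a (List.mem_cons_of_mem b ha)
    -- Otherwise b lies in an associated prime p of M. Then dim R/p is at least the length of `rs`,
    -- but modulo p the shorter list `as` already generates a primary ideal, so dim R/p is smaller.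
    have hb : IsSMulRegular M b := by
      by_contra hb
      have hb' : b ∈ ⋃ p ∈ associatedPrimes R M, (p : Set R) := by
        rw [biUnion_associatedPrimes_eq_compl_regular]
        exact hb
      obtain ⟨p, hp, hbp⟩ := Set.mem_iUnion₂.mp hb'
      have hpp : p.IsPrime := hp.isPrime
      have h1 := length_le_ringKrullDim_quotient_of_mem_associatedPrimes hrs hmem hp
      have h2 := ringKrullDim_quotient_le_length p as hasm' (h.trans (Ideal.radical_mono ?_))
      · have h3 := h1.trans h2
        rw [← has, List.length_cons] at h3
        have h4 : as.length + 1 ≤ as.length := by exact_mod_cast h3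
        omega
      · refine sup_le (le_sup_of_le_left ?_) ?_
        · simpa [Submodule.annihilator_top] using hp.annihilator_le
        · rw [Ideal.ofList_cons]
          exact sup_le_sup_right ((Ideal.span_singleton_le_iff_mem _).mpr hbp) _
    obtain ⟨rs', hl, hm', hr'⟩ := exists_isRegular_quotSMulTop hrs hmem
      (n := as.length) (by simpa using has.symm) hb hbm
    refine IsRegular.cons hb (ih hr' hm' hl.symm hasm' (h.trans (Ideal.radical_mono ?_)))
    refine sup_le (le_sup_of_le_left ?_) ?_
    · exact LinearMap.annihilator_le_of_surjective (Submodule.mkQ _) (Submodule.mkQ_surjective _)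
    · rw [Ideal.ofList_cons]
      refine sup_le_sup_right ((Ideal.span_singleton_le_iff_mem _).mpr ?_) _
      exact QuotSMulTop.mem_annihilator M b

end SystemsOfParameters

end

section

open IsLocalRing

/-! ### Forms evaluated at a regular sequence -/

section QuasiRegular

open MvPolynomial

variable {R σ : Type*} [CommRing R]

/-- `F` is homogeneous of degree `n` with coefficients in `L`, and involves only the variables
in `S`. -/
def IsFormOver (L : Ideal R) (S : Finset σ) (n : ℕ) (F : MvPolynomial σ R) : Prop :=
  ∀ m, F.coeff m ∈ L ∧ (F.coeff m ≠ 0 → m.degree = n ∧ m.support ⊆ S)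

namespace IsFormOver

variable {L L' : Ideal R} {S : Finset σ} {n : ℕ} {F G : MvPolynomial σ R}

theorem add (hF : IsFormOver L S n F) (hG : IsFormOver L S n G) : IsFormOver L S n (F + G) := by
  intro m
  rw [coeff_add]
  refine ⟨L.add_mem (hF m).1 (hG m).1, fun h => ?_⟩
  by_cases h0 : F.coeff m = 0
  · exact (hG m).2 (by simpa [h0] using h)
  · exact (hF m).2 h0

theorem zero : IsFormOver L S n 0 := fun m => by simp

theorem C_mul (r : R) (hF : IsFormOver L S n F) : IsFormOver L S n (C r * F) := by
  intro m
  rw [coeff_C_mul]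
  exact ⟨L.mul_mem_left _ (hF m).1, fun h => (hF m).2 (right_ne_zero_of_mul h)⟩

theorem sub (hF : IsFormOver L S n F) (hG : IsFormOver L S n G) : IsFormOver L S n (F - G) := by
  have := hF.add (hG.C_mul (-1))
  simpa [sub_eq_add_neg] using this

theorem mono (h : L ≤ L') (hF : IsFormOver L S n F) : IsFormOver L' S n F :=
  fun m => ⟨h (hF m).1, (hF m).2⟩

theorem mul_X {i : σ} (hi : i ∈ S) (hF : IsFormOver L S n F) : IsFormOver L S (n + 1) (F * X i) := by
  classical
  intro m
  rw [coeff_mul_X']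
  split_ifs with hm
  · refine ⟨(hF _).1, fun h => ?_⟩
    obtain ⟨h1, h2⟩ := (hF _).2 h
    have hle : Finsupp.single i 1 ≤ m := by
      rw [Finsupp.single_le_iff]
      exact Nat.one_le_iff_ne_zero.mpr (Finsupp.mem_support_iff.mp hm)
    have hm' : m - Finsupp.single i 1 + Finsupp.single i 1 = m := tsub_add_cancel_of_le hle
    constructor
    · rw [← hm', map_add, h1, Finsupp.degree_single]
    · rw [← hm']
      refine Finsupp.support_add.trans (Finset.union_subset h2 ?_)
      exact Finsupp.support_single_subset.trans (by simpa using hi)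
  · simp

theorem isHomogeneous (hF : IsFormOver L S n F) : F.IsHomogeneous n := by
  intro m hm
  rw [← (hF m).2 hm |>.1, Finsupp.degree_eq_weight_one]
  rfl

theorem of_isHomogeneous [Fintype σ] (hF : F.IsHomogeneous n) (h : ∀ m, F.coeff m ∈ L) :
    IsFormOver L Finset.univ n F := fun m => ⟨h m, fun hm => ⟨by
  rw [← hF hm, Finsupp.degree_eq_weight_one]; rfl, Finset.subset_univ _⟩⟩

end IsFormOver

theorem exists_isFormOver_of_mem_mul_pow (a : σ → R) (S : Finset σ) (L : Ideal R) (n : ℕ) {y : R}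
    (hy : y ∈ L * Ideal.span (a '' S) ^ n) : ∃ F, IsFormOver L S n F ∧ eval a F = y := by
  classical
  induction n generalizing y with
  | zero =>
    refine ⟨C y, fun m => ?_, by simp⟩
    rw [coeff_C]
    split_ifs with h
    · subst h
      exact ⟨by simpa using hy, fun _ => by simp⟩
    · simp
  | succ n ih =>
    rw [pow_succ, ← mul_assoc] at hy
    induction hy using Submodule.mul_induction_on' with
    | mem_mul_mem u hu v hv =>
      obtain ⟨G, hG, rfl⟩ := ih hu
      clear hu
      induction hv using Submodule.span_induction with
      | mem v hv =>
        obtain ⟨i, hi, rfl⟩ := hv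
        exact ⟨G * X i, hG.mul_X hi, by simp⟩
      | zero => exact ⟨0, .zero, by simp⟩
      | add v w _ _ hv hw =>
        obtain ⟨F₁, h₁, e₁⟩ := hv
        obtain ⟨F₂, h₂, e₂⟩ := hw
        exact ⟨F₁ + F₂, h₁.add h₂, by simp [e₁, e₂, mul_add]⟩
      | smul r v _ hv =>
        obtain ⟨F₁, h₁, e₁⟩ := hv
        exact ⟨C r * F₁, h₁.C_mul r, by simp [e₁, mul_left_comm]⟩
    | add v _ w _ hv hw =>
      obtain ⟨F₁, h₁, e₁⟩ := hv
      obtain ⟨F₂, h₂, e₂⟩ := hw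
      exact ⟨F₁ + F₂, h₁.add h₂, by simp [e₁, e₂]⟩

theorem IsFormOver.eval_mem (a : σ → R) {S : Finset σ} {L : Ideal R} {n : ℕ}
    {F : MvPolynomial σ R} (hF : IsFormOver L S n F) :
    eval a F ∈ L * Ideal.span (a '' S) ^ n := by
  rw [eval_eq]
  refine Ideal.sum_mem _ fun m hm => ?_
  obtain ⟨h1, h2⟩ := (hF m).2 (by simpa using hm)
  refine Ideal.mul_mem_mul (hF m).1 ?_
  rw [← h1, Finsupp.degree_apply, ← Finset.prod_pow_eq_pow_sum]
  exact Ideal.prod_mem_prod fun i hi =>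
    Ideal.pow_mem_pow (Ideal.subset_span (Set.mem_image_of_mem a (h2 hi))) _

/-- Forms vanishing at a (permutable) regular sequence have coefficients in the ideal generated by
the sequence. -/
theorem IsFormOver.of_eval_eq_zero [DecidableEq σ] (a : σ → R) (S : Finset σ)
    (hreg : ∀ T ⊆ S, ∀ i ∈ S, i ∉ T → ∀ y, a i * y ∈ Ideal.span (a '' T) → y ∈ Ideal.span (a '' T))
    {n : ℕ} {F : MvPolynomial σ R} (hF : IsFormOver ⊤ S n F) (h0 : eval a F = 0) :
    IsFormOver (Ideal.span (a '' S)) S n F := by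
  -- Outer induction on the set of variables, inner induction on the degree, with F written as X_i H
  -- + G and G free of X_i.
  induction S using Finset.induction_on generalizing n F with
  | empty =>
    suffices F = 0 by rw [this]; exact .zero
    ext m
    rw [coeff_zero]
    by_contra hm
    obtain ⟨h1, h2⟩ := (hF m).2 hm
    have hm0 : m = 0 := by simpa using h2
    have hFC : F = C (F.coeff 0) := by
      ext m'
      rw [coeff_C]
      split_ifs with h
      · rw [h]
      · by_contra h3
        exact h (by simpa using ((hF m').2 h3).2 : m' = 0).symm
    rw [hFC] at h0
    apply hm
    rw [hm0]
    simpa using h0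
  | insert i S hi ihS =>
    have ihS' := fun n F => @ihS (fun T hT j hj => hreg T (hT.trans (Finset.subset_insert i S)) j
      (Finset.mem_insert_of_mem hj)) n F
    clear ihS
    set Q' := Ideal.span (a '' S) with hQ'
    set Q := Ideal.span (a '' (insert i S : Finset σ)) with hQ
    have hQ'Q : Q' ≤ Q := Ideal.span_mono (Set.image_mono (by simp))
    have hiQ : a i ∈ Q := Ideal.subset_span ⟨i, by simp, rfl⟩
    have hib : ∀ y, a i * y ∈ Q' → y ∈ Q' :=
      hreg S (Finset.subset_insert i S) i (Finset.mem_insert_self i S) hi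
    have reduce' : ∀ n G, IsFormOver ⊤ S n G → eval a G ∈ Q' ^ (n + 1) → IsFormOver Q' S n G := by
      intro n G hG hGQ
      rw [pow_succ'] at hGQ
      obtain ⟨H, hH, he⟩ := exists_isFormOver_of_mem_mul_pow a S Q' n hGQ
      have := (ihS' n (G - H) (hG.sub (hH.mono le_top)) (by simp [he])).add hH
      simpa using this
    -- The element a_i stays regular modulo every power of Q': y is the value of a form of degree j,
    -- and a_i times its coefficients lie in Q', hence so do the coefficients.
    have hpow : ∀ j y, a i * y ∈ Q' ^ j → y ∈ Q' ^ j := by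
      intro j
      induction j with
      | zero => simp
      | succ j ihj =>
        intro y hy
        obtain ⟨G, hG, rfl⟩ := exists_isFormOver_of_mem_mul_pow a S ⊤ j
          (by simpa [Ideal.top_mul] using ihj y (Ideal.pow_le_pow_right j.le_succ hy))
        have h1 := reduce' j (C (a i) * G) (hG.C_mul _) (by simpa using hy)
        have h2 : IsFormOver Q' S j G := fun m => ⟨hib _ (by simpa using (h1 m).1), (hG m).2⟩
        rw [pow_succ']
        exact h2.eval_mem a
    induction n generalizing F with
    | zero =>
      have hFC : F = C (F.coeff 0) := by
        ext m'
        rw [coeff_C]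
        split_ifs with h
        · rw [h]
        · by_contra h3
          exact h ((Finsupp.degree_eq_zero_iff m').mp ((hF m').2 h3).1).symm
      have : F = 0 := by rw [hFC] at h0 ⊢; simpa using h0
      rw [this]; exact .zero
    | succ n ihn =>
      let H := F.divMonomial (Finsupp.single i 1)
      let G := F.modMonomial (Finsupp.single i 1)
      have hdec : X i * H + G = F := divMonomial_add_modMonomial_single F i
      have hH : IsFormOver ⊤ (insert i S) n H := by
        intro m
        refine ⟨trivial, fun hm => ?_⟩
        rw [coeff_divMonomial] at hm
        obtain ⟨h1, h2⟩ := (hF _).2 hm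
        constructor
        · simp only [map_add, Finsupp.degree_single] at h1
          omega
        · refine fun j hj => h2 ?_
          simp only [Finsupp.mem_support_iff, Finsupp.add_apply] at hj ⊢
          omega
      have hG : IsFormOver ⊤ S (n + 1) G := by
        intro m
        refine ⟨trivial, fun hm => ?_⟩
        have hle : ¬ Finsupp.single i 1 ≤ m := fun hle => hm (coeff_modMonomial_of_le F hle)
        rw [coeff_modMonomial_of_not_le F hle] at hm
        obtain ⟨h1, h2⟩ := (hF _).2 hm
        refine ⟨h1, fun j hj => ?_⟩
        have := h2 hj
        rw [Finset.mem_insert] at this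
        refine this.resolve_left ?_
        rintro rfl
        apply hle
        rw [Finsupp.single_le_iff]
        exact Nat.one_le_iff_ne_zero.mpr (Finsupp.mem_support_iff.mp hj)
      have hval : a i * eval a H + eval a G = 0 := by
        rw [← h0, ← hdec]; simp
      have hGmem : eval a G ∈ Q' ^ (n + 1) := by simpa [Ideal.top_mul] using hG.eval_mem a
      have hHmem : eval a H ∈ Q' ^ (n + 1) := by
        apply hpow
        rw [eq_neg_of_add_eq_zero_left hval]
        exact neg_mem hGmem
      have hHQ : IsFormOver Q (insert i S) n H := by
        have h1 : eval a H ∈ Q * Q ^ n := by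
          rw [← pow_succ']
          exact Ideal.pow_right_mono hQ'Q _ hHmem
        obtain ⟨K, hK, he⟩ := exists_isFormOver_of_mem_mul_pow a (insert i S) Q n h1
        have := (ihn (hH.sub (hK.mono le_top)) (by simp [he])).add hK
        simpa using this
      -- H has degree n but its value lies in Q'^(n+1), so it is also the value of a form h of
      -- degree n + 1 without X_i. Then a_i h + G vanishes at a and involves only S; since a_i ∈ Q,
      -- the coefficients of G lie in Q.
      obtain ⟨h, hh, he⟩ := exists_isFormOver_of_mem_mul_pow a S ⊤ (n + 1)
        (by simpa [Ideal.top_mul] using hHmem)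
      have hGh := ihS' (n + 1) (C (a i) * h + G) ((hh.C_mul _).add hG) (by simpa [he] using hval)
      intro m
      refine ⟨?_, (hF m).2⟩
      rw [← hdec, coeff_add]
      refine Q.add_mem ?_ ?_
      · rw [coeff_X_mul']
        split_ifs
        · exact (hHQ _).1
        · exact Q.zero_mem
      · have h1 := hQ'Q (hGh m).1
        rw [coeff_add, coeff_C_mul] at h1
        exact (Submodule.add_mem_iff_right _ (Q.mul_mem_right _ hiQ)).mp h1

end QuasiRegular

end

section

open IsLocalRing

/-! ### Lengths of quotients -/

section Length

variable {R V M : Type*} [CommRing R] [AddCommGroup V] [Module R V] [AddCommGroup M] [Module R M]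

/-- Additivity of length along 0 → V/W → M/N → M/(f(V) + N) → 0. -/
theorem Module.length_quotient_eq_add_of_comap_eq (f : V →ₗ[R] M) {N : Submodule R M}
    {W : Submodule R V} (hW : N.comap f = W) :
    Module.length R (M ⧸ N) = Module.length R (V ⧸ W) +
      Module.length R (M ⧸ (LinearMap.range f ⊔ N)) := by
  refine Module.length_eq_add_of_exact (W.mapQ N f hW.ge)
    (Submodule.factor (le_sup_right : N ≤ LinearMap.range f ⊔ N)) ?_
    (Submodule.factor_surjective _) ?_
  · rw [← LinearMap.ker_eq_bot, eq_bot_iff]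
    intro v hv
    obtain ⟨v, rfl⟩ := Submodule.Quotient.mk_surjective _ v
    rw [LinearMap.mem_ker, Submodule.mapQ_apply, Submodule.Quotient.mk_eq_zero] at hv
    rwa [Submodule.mem_bot, Submodule.Quotient.mk_eq_zero, ← hW]
  · intro m
    obtain ⟨m, rfl⟩ := Submodule.Quotient.mk_surjective _ m
    change Submodule.Quotient.mk m = (0 : M ⧸ (LinearMap.range f ⊔ N)) ↔ _
    rw [Submodule.Quotient.mk_eq_zero]
    constructor
    · intro this
      obtain ⟨_, ⟨v, rfl⟩, n, hn, rfl⟩ := Submodule.mem_sup.mp this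
      refine ⟨Submodule.Quotient.mk v, ?_⟩
      rw [Submodule.mapQ_apply, Submodule.Quotient.eq]
      simpa using hn
    · rintro ⟨v, hv⟩
      obtain ⟨v, rfl⟩ := Submodule.Quotient.mk_surjective _ v
      rw [Submodule.mapQ_apply, Submodule.Quotient.eq] at hv
      have h1 : f v ∈ LinearMap.range f ⊔ N := Submodule.mem_sup_left ⟨v, rfl⟩
      exact (Submodule.sub_mem_iff_right _ h1).mp (Submodule.mem_sup_right hv)

theorem Module.length_pi_quotient {ι : Type*} [Finite ι] (L : Ideal R) :
    Module.length R ((ι → R) ⧸ Submodule.pi Set.univ fun _ : ι => L) =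
      Nat.card ι * Module.length R (R ⧸ L) := by
  classical
  have := Fintype.ofFinite ι
  rw [(Submodule.quotientPi fun _ : ι => L).length_eq]
  simp

theorem Module.length_quotient_mono {N N' : Submodule R M} (h : N ≤ N') :
    Module.length R (M ⧸ N') ≤ Module.length R (M ⧸ N) :=
  Module.length_le_of_surjective (Submodule.factor h) (Submodule.factor_surjective _)

end Length

/-! ### Quasi-regularity and the lengths of A/LQⁿ -/

section QuasiRegular

open MvPolynomial

variable {R : Type*} [CommRing R] {d : ℕ}

/-- Each element of the family is regular modulo any set of other elements of the family. -/
def IsPermutablyRegular {σ : Type*} (a : σ → R) : Prop :=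
  ∀ (T : Finset σ), ∀ i ∉ T, ∀ y, a i * y ∈ Ideal.span (a '' T) → y ∈ Ideal.span (a '' T)

/-- Subtract a form with coefficients in L and the same value; the difference vanishes at a, so its
coefficients lie in Q ⊆ L. This makes Q^n/LQ^n free over A/L on the monomials of degree n. -/
theorem IsPermutablyRegular.isFormOver_of_eval_mem {a : Fin d → R} (ha : IsPermutablyRegular a)
    {L : Ideal R} (hL : Ideal.span (Set.range a) ≤ L) {n : ℕ} {F : MvPolynomial (Fin d) R}
    (hF : IsFormOver ⊤ Finset.univ n F)
    (h : eval a F ∈ L * Ideal.span (Set.range a) ^ n) : IsFormOver L Finset.univ n F := by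
  have hr : Set.range a = a '' (Finset.univ : Finset (Fin d)) := by simp
  rw [hr] at h hL
  obtain ⟨G, hG, he⟩ := exists_isFormOver_of_mem_mul_pow a Finset.univ L n h
  have h1 := IsFormOver.of_eval_eq_zero a Finset.univ (fun T _ i _ hi => ha T i hi)
    (hF.sub (hG.mono le_top)) (by simp [he])
  simpa using (h1.mono hL).add hG

theorem IsFormOver.eval_mem_univ (a : Fin d → R) {L : Ideal R} {n : ℕ}
    {F : MvPolynomial (Fin d) R} (hF : IsFormOver L Finset.univ n F) :
    eval a F ∈ L * Ideal.span (Set.range a) ^ n := by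
  simpa using hF.eval_mem a

theorem exists_isFormOver_univ (a : Fin d → R) {L : Ideal R} {n : ℕ} {y : R}
    (hy : y ∈ L * Ideal.span (Set.range a) ^ n) :
    ∃ F, IsFormOver L Finset.univ n F ∧ eval a F = y :=
  exists_isFormOver_of_mem_mul_pow a Finset.univ L n (by simpa using hy)

theorem IsFormOver.mul {F G : MvPolynomial (Fin d) R} {n m : ℕ}
    (hF : IsFormOver ⊤ Finset.univ n F) (hG : IsFormOver ⊤ Finset.univ m G) :
    IsFormOver ⊤ Finset.univ (n + m) (F * G) :=
  .of_isHomogeneous (hF.isHomogeneous.mul hG.isHomogeneous) fun _ => trivial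

/-- A polynomial over a local ring with some unit coefficient is a nonzerodivisor modulo any ideal
primary to the maximal ideal. -/
theorem MvPolynomial.coeff_mem_of_mul_coeff_mem [IsLocalRing R] {L : Ideal R} {N : ℕ}
    (hN : maximalIdeal R ^ N ≤ L) {F G : MvPolynomial (Fin d) R}
    (hF : ∃ m, F.coeff m ∉ maximalIdeal R) (hFG : ∀ m, (F * G).coeff m ∈ L) (m : Fin d →₀ ℕ) :
    G.coeff m ∈ L := by
  classical
  by_contra hm
  -- Take the least k such that 𝔪^k multiplies all coefficients of G into L. Some t in the preceding
  -- power keeps tG nonzero modulo L, while 𝔪 tG is zero there.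
  have hex : ∃ k, ∀ t ∈ maximalIdeal R ^ k, ∀ m, t * G.coeff m ∈ L :=
    ⟨N, fun t ht m => L.mul_mem_right _ (hN ht)⟩
  have hk := Nat.find_spec hex
  have hk0 : Nat.find hex ≠ 0 := fun h0 => hm (by simpa using hk 1 (by simp [h0]) m)
  obtain ⟨k, hk1⟩ := Nat.exists_eq_succ_of_ne_zero hk0
  have hlt := Nat.find_min hex (m := k) (by omega)
  push Not at hlt
  obtain ⟨t, ht, m₀, hm₀⟩ := hlt
  rw [hk1] at hk
  -- Since 𝔪 kills tG modulo L, the non-unit coefficients of F can be dropped. The lexicographic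
  -- leading coefficient of what remains is a unit modulo L, so multiplication by it is injective.
  let F₁ : MvPolynomial (Fin d) R :=
    ∑ m ∈ F.support with F.coeff m ∉ maximalIdeal R, monomial m (F.coeff m)
  have hF₁ (m) : F₁.coeff m = if F.coeff m ∉ maximalIdeal R then F.coeff m else 0 := by
    simp only [F₁, coeff_sum, coeff_monomial]
    rw [Finset.sum_ite_eq']
    by_cases h : F.coeff m ∈ maximalIdeal R
    · rw [if_neg (not_not_intro h), if_neg]
      intro hm
      exact (Finset.mem_filter.mp hm).2 h
    · have h0 : m ∈ F.support := by
        rw [mem_support_iff]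
        intro h0
        exact h (h0 ▸ zero_mem _)
      have h1 : m ∈ F.support.filter fun m => F.coeff m ∉ maximalIdeal R :=
        Finset.mem_filter.mpr ⟨h0, h⟩
      rw [if_pos h, if_pos h1]
  have hF₂ (m) : (F - F₁).coeff m ∈ maximalIdeal R := by
    rw [coeff_sub, hF₁]
    split_ifs with h <;> simp_all
  have hprod (m) : (F₁ * (C t * G)).coeff m ∈ L := by
    have h1 : F₁ * (C t * G) = C t * (F * G) - (F - F₁) * (C t * G) := by ring
    rw [h1, coeff_sub, coeff_C_mul, coeff_mul (F - F₁)]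
    refine L.sub_mem (L.mul_mem_left _ (hFG m)) (L.sum_mem fun x _ => ?_)
    rw [coeff_C_mul, ← mul_assoc, mul_comm _ t]
    exact hk _ (by rw [pow_succ]; exact Ideal.mul_mem_mul ht (hF₂ _)) _
  let φ := MvPolynomial.map (σ := Fin d) (Ideal.Quotient.mk L)
  have hzero : φ F₁ * φ (C t * G) = 0 := by
    rw [← map_mul]
    ext m
    rw [coeff_map, coeff_zero, Ideal.Quotient.eq_zero_iff_mem]
    exact hprod m
  have hlc : IsRegular (MonomialOrder.lex.leadingCoeff (φ F₁)) := by
    have hL1 : (1 : R) ∉ L := fun h => hm (by simpa using L.mul_mem_left (G.coeff m) h)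
    have : Nontrivial (R ⧸ L) := Ideal.Quotient.nontrivial_iff.mpr (by rwa [Ne, Ideal.eq_top_iff_one])
    have hu : ∀ m, F.coeff m ∉ maximalIdeal R → IsUnit ((φ F₁).coeff m) := by
      intro m h
      rw [coeff_map, hF₁, if_pos h]
      exact (by simpa using h : IsUnit (F.coeff m)).map _
    have hne : φ F₁ ≠ 0 := by
      obtain ⟨m₁, h₁⟩ := hF
      intro h0
      have := hu m₁ h₁
      rw [h0, coeff_zero] at this
      exact not_isUnit_zero this
    have hlne := (MonomialOrder.lex.leadingCoeff_ne_zero_iff (f := φ F₁)).mpr hne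
    rw [MonomialOrder.leadingCoeff] at hlne ⊢
    refine (hu _ fun h => hlne ?_).isRegular
    rw [coeff_map, hF₁, if_neg (not_not_intro h), map_zero]
  have h2 := MonomialOrder.lex.leadingCoeff_mul_of_isRegular_left (g := φ (C t * G)) hlc
  rw [hzero, MonomialOrder.leadingCoeff_zero, eq_comm, hlc.left.mul_left_eq_zero_iff,
    MonomialOrder.leadingCoeff_eq_zero_iff] at h2
  apply hm₀
  have := congrArg (coeff m₀) h2
  simpa [φ, coeff_map, ← map_mul, Ideal.Quotient.eq_zero_iff_mem] using this

/-- A form with a unit coefficient is a nonzerodivisor on Q^j/LQ^j, by the previous lemma on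
coefficients. Using L = Q, membership x ∈ Q^j climbs from j = 0 to j = i; a last application with L
= J finishes. It is what prevents elements of T outside 𝔪T from killing homogeneous elements of the
Sally module. -/
theorem IsPermutablyRegular.mem_mul_pow_of_eval_mul_mem [IsLocalRing R] {a : Fin d → R}
    (ha : IsPermutablyRegular a) {N : ℕ} (hN : maximalIdeal R ^ N ≤ Ideal.span (Set.range a))
    {J : Ideal R} (hQJ : Ideal.span (Set.range a) ≤ J) {n i : ℕ} {F : MvPolynomial (Fin d) R}
    (hF : IsFormOver ⊤ Finset.univ n F) (hFu : ∃ m, F.coeff m ∉ maximalIdeal R) {x : R}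
    (h : eval a F * x ∈ J * Ideal.span (Set.range a) ^ (n + i)) :
    x ∈ J * Ideal.span (Set.range a) ^ i := by
  have step : ∀ L, Ideal.span (Set.range a) ≤ L → ∀ j, x ∈ Ideal.span (Set.range a) ^ j →
      eval a F * x ∈ L * Ideal.span (Set.range a) ^ (n + j) →
      x ∈ L * Ideal.span (Set.range a) ^ j := by
    intro L hL j hxj hj
    obtain ⟨G, hG, rfl⟩ := exists_isFormOver_univ a (L := ⊤) (by simpa [Ideal.top_mul] using hxj)
    rw [← map_mul] at hj
    have h1 := ha.isFormOver_of_eval_mem hL (hF.mul hG) hj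
    have h2 : IsFormOver L Finset.univ j G := fun m =>
      ⟨MvPolynomial.coeff_mem_of_mul_coeff_mem (hN.trans hL) hFu (fun m => (h1 m).1) m, (hG m).2⟩
    exact h2.eval_mem_univ a
  have hpow : ∀ j ≤ i, x ∈ Ideal.span (Set.range a) ^ j := by
    intro j hj
    induction j with
    | zero => simp
    | succ j ih =>
      rw [pow_succ']
      refine step _ le_rfl j (ih (by omega)) ?_
      rw [← pow_succ']
      have h1 : eval a F * x ∈ Ideal.span (Set.range a) ^ (n + i) := Ideal.mul_le_right h
      exact Ideal.pow_le_pow_right (show n + j + 1 ≤ n + i by omega) h1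
  exact step J hQJ i (hpow i le_rfl) h

/-- The linear map evaluating at `a` the form of degree `n` with given coefficients, followed by
multiplication by `x`. -/
noncomputable def evalFormMul (a : Fin d → R) (n : ℕ) (x : R) :
    ((Finset.univ : Finset (Fin d)).finsuppAntidiag n → R) →ₗ[R] R :=
  Fintype.linearCombination R fun m => (∏ i, a i ^ m.1 i) * x

/-- The form with given coefficients. -/
noncomputable def formOfCoeffs {n : ℕ}
    (c : (Finset.univ : Finset (Fin d)).finsuppAntidiag n → R) : MvPolynomial (Fin d) R :=
  ∑ m, monomial m.1 (c m)

theorem evalFormMul_apply (a : Fin d → R) (n : ℕ) (x : R)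
    (c : (Finset.univ : Finset (Fin d)).finsuppAntidiag n → R) :
    evalFormMul a n x c = eval a (formOfCoeffs c) * x := by
  simp only [evalFormMul, Fintype.linearCombination_apply, formOfCoeffs, map_sum, eval_monomial,
    Finset.sum_mul, smul_eq_mul]
  refine Finset.sum_congr rfl fun m _ => ?_
  rw [Finsupp.prod_fintype _ _ (by simp), mul_assoc]

theorem coeff_formOfCoeffs {n : ℕ} (c : (Finset.univ : Finset (Fin d)).finsuppAntidiag n → R)
    (m : (Finset.univ : Finset (Fin d)).finsuppAntidiag n) :
    (formOfCoeffs c).coeff m.1 = c m := by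
  classical
  rw [formOfCoeffs, coeff_sum, Finset.sum_eq_single m]
  · simp
  · intro b _ hb
    rw [coeff_monomial, if_neg fun h => hb (Subtype.ext h)]
  · simp

theorem mem_finsuppAntidiag_univ_iff {n : ℕ} {m : Fin d →₀ ℕ} :
    m ∈ (Finset.univ : Finset (Fin d)).finsuppAntidiag n ↔ m.degree = n := by
  simp [Finsupp.degree_eq_sum]

theorem isFormOver_formOfCoeffs {n : ℕ} {L : Ideal R}
    {c : (Finset.univ : Finset (Fin d)).finsuppAntidiag n → R} (hc : ∀ m, c m ∈ L) :
    IsFormOver L Finset.univ n (formOfCoeffs c) := by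
  classical
  intro m
  by_cases hm : m ∈ (Finset.univ : Finset (Fin d)).finsuppAntidiag n
  · have := coeff_formOfCoeffs c ⟨m, hm⟩
    exact ⟨this ▸ hc _, fun _ => ⟨mem_finsuppAntidiag_univ_iff.mp hm, Finset.subset_univ _⟩⟩
  · have : (formOfCoeffs c).coeff m = 0 := by
      rw [formOfCoeffs, coeff_sum]
      refine Finset.sum_eq_zero fun b _ => ?_
      rw [coeff_monomial, if_neg]
      rintro rfl
      exact hm b.2
    simp [this]

theorem formOfCoeffs_coeff {n : ℕ} {F : MvPolynomial (Fin d) R}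
    (hF : IsFormOver ⊤ Finset.univ n F) :
    formOfCoeffs (n := n) (fun m => F.coeff m.1) = F := by
  ext m
  by_cases hm : m ∈ (Finset.univ : Finset (Fin d)).finsuppAntidiag n
  · exact coeff_formOfCoeffs (fun m => F.coeff m.1) ⟨m, hm⟩
  · have h1 : F.coeff m = 0 := by
      by_contra h
      exact hm (mem_finsuppAntidiag_univ_iff.mpr ((hF m).2 h).1)
    rw [h1]
    by_contra h
    exact hm (mem_finsuppAntidiag_univ_iff.mpr
      ((isFormOver_formOfCoeffs (L := ⊤) (fun _ => trivial) m).2 h).1)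

theorem natCard_finsuppAntidiag_univ (n : ℕ) :
    Nat.card ((Finset.univ : Finset (Fin d)).finsuppAntidiag n) = (d + n - 1).choose n := by
  rw [Nat.card_eq_fintype_card, Fintype.card_coe, Finset.card_finsuppAntidiag_nat_eq_choose,
    Finset.card_univ, Fintype.card_fin]

theorem range_evalFormMul (a : Fin d → R) (n : ℕ) (x : R) :
    LinearMap.range (evalFormMul a n x) = Ideal.span {x} * Ideal.span (Set.range a) ^ n := by
  apply le_antisymm
  · rintro _ ⟨c, rfl⟩
    rw [evalFormMul_apply, mul_comm (Ideal.span {x})]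
    refine Ideal.mul_mem_mul ?_ (Ideal.mem_span_singleton_self x)
    simpa [Ideal.top_mul] using
      (isFormOver_formOfCoeffs (L := ⊤) (c := c) fun _ => trivial).eval_mem_univ a
  · intro y hy
    obtain ⟨z, hz, rfl⟩ := Ideal.mem_span_singleton_mul.mp hy
    obtain ⟨F, hF, rfl⟩ := exists_isFormOver_univ a (L := ⊤) (by simpa [Ideal.top_mul] using hz)
    exact ⟨fun m => F.coeff m.1, by rw [evalFormMul_apply, formOfCoeffs_coeff hF, mul_comm]⟩

/-- The layer Q^n/LQ^n is a free A/L-module, with one basis element for each monomial of degree n.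
-/
theorem IsPermutablyRegular.length_quotient_mul_pow {a : Fin d → R} (ha : IsPermutablyRegular a)
    {L : Ideal R} (hL : Ideal.span (Set.range a) ≤ L) (n : ℕ) :
    Module.length R (R ⧸ L * Ideal.span (Set.range a) ^ n) =
      (d + n - 1).choose n * Module.length R (R ⧸ L) +
        Module.length R (R ⧸ Ideal.span (Set.range a) ^ n) := by
  rw [Module.length_quotient_eq_add_of_comap_eq (evalFormMul a n 1)
    (W := Submodule.pi Set.univ fun _ => L), Module.length_pi_quotient,
    natCard_finsuppAntidiag_univ, range_evalFormMul, Ideal.span_singleton_one, Ideal.top_mul,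
    sup_eq_left.mpr Ideal.mul_le_right]
  ext c
  rw [Submodule.mem_comap, evalFormMul_apply, mul_one, Submodule.mem_pi]
  constructor
  · intro h m _
    have := ha.isFormOver_of_eval_mem hL (isFormOver_formOfCoeffs fun _ => trivial) h m.1
    rw [coeff_formOfCoeffs] at this
    exact this.1
  · intro h
    exact (isFormOver_formOfCoeffs fun m => h m trivial).eval_mem_univ a

theorem IsPermutablyRegular.length_quotient_pow {a : Fin d → R} (ha : IsPermutablyRegular a)
    (hd : 0 < d) (n : ℕ) :
    Module.length R (R ⧸ Ideal.span (Set.range a) ^ (n + 1)) =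
      (n + d).choose d * Module.length R (R ⧸ Ideal.span (Set.range a)) := by
  induction n with
  | zero => rw [zero_add, pow_one, zero_add, Nat.choose_self, Nat.cast_one, one_mul]
  | succ n ih =>
    rw [pow_succ', ha.length_quotient_mul_pow le_rfl, ih, ← add_mul]
    congr 1
    obtain ⟨e, rfl⟩ := Nat.exists_eq_succ_of_ne_zero hd.ne'
    have h1 : e.succ + (n + 1) - 1 = e + n + 1 := by omega
    have h2 : n + 1 + e.succ = e + n + 1 + 1 := by omega
    have h3 : n + e.succ = e + n + 1 := by omega
    rw [h1, h2, h3, Nat.succ_eq_add_one, Nat.choose_succ_succ (e + n + 1) e,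
      Nat.choose_symm_of_eq_add (show e + n + 1 = n + 1 + e by omega)]
    norm_cast

/-- The socle element x spans a copy of the residue field in J^(i+1)/JQ^i. Multiplying by forms of
degree n gives, inside J^(n+i+1)/JQ^(n+i), a vector space whose dimension is the number of
monomials: a form sends x to zero exactly when all its coefficients lie in 𝔪. -/
theorem IsPermutablyRegular.choose_add_length_le [IsLocalRing R] {a : Fin d → R}
    (ha : IsPermutablyRegular a)
    {N : ℕ} (hN : maximalIdeal R ^ N ≤ Ideal.span (Set.range a))
    {J : Ideal R} (hQJ : Ideal.span (Set.range a) ≤ J) {i : ℕ} {x : R}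
    (hxJ : x ∈ J ^ (i + 1)) (hx : x ∉ J * Ideal.span (Set.range a) ^ i)
    (hmx : ∀ t ∈ maximalIdeal R, t * x ∈ J * Ideal.span (Set.range a) ^ i) (n : ℕ) :
    (d + n - 1).choose n + Module.length R (R ⧸ J ^ (n + i + 1)) ≤
      Module.length R (R ⧸ J * Ideal.span (Set.range a) ^ (n + i)) := by
  rw [Module.length_quotient_eq_add_of_comap_eq (evalFormMul a n x)
    (N := J * Ideal.span (Set.range a) ^ (n + i))
    (W := Submodule.pi Set.univ fun _ => maximalIdeal R), Module.length_pi_quotient,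
    natCard_finsuppAntidiag_univ]
  · have : Module.length R (R ⧸ maximalIdeal R) = 1 := by
      rw [Module.length_eq_one_iff, isSimpleModule_iff_isCoatom]
      exact (maximalIdeal.isMaximal R).out
    rw [this, mul_one]
    gcongr
    apply Module.length_quotient_mono
    rw [range_evalFormMul]
    refine sup_le ?_ ?_
    · rw [show n + i + 1 = (i + 1) + n by omega, pow_add]
      exact Ideal.mul_mono ((Ideal.span_singleton_le_iff_mem _).mpr hxJ) (Ideal.pow_right_mono hQJ n)
    · rw [pow_succ' J]
      exact Ideal.mul_mono_right (Ideal.pow_right_mono hQJ _)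
  · ext c
    rw [Submodule.mem_comap, evalFormMul_apply, Submodule.mem_pi]
    constructor
    · intro h m _
      by_contra hm
      exact hx (ha.mem_mul_pow_of_eval_mul_mem hN hQJ (isFormOver_formOfCoeffs fun _ => trivial)
        ⟨m.1, by rwa [coeff_formOfCoeffs]⟩ h)
    · intro h
      have h1 := (isFormOver_formOfCoeffs fun m => h m trivial).eval_mem_univ a
      rw [mul_comm (maximalIdeal R)] at h1
      generalize eval a (formOfCoeffs c) = y at h1 ⊢
      induction h1 using Submodule.mul_induction_on' with
      | mem_mul_mem u hu t ht =>
        rw [mul_assoc, pow_add, mul_left_comm]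
        exact Ideal.mul_mem_mul hu (hmx t ht)
      | add u _ v _ hu hv =>
        rw [add_mul]
        exact Ideal.add_mem _ hu hv

end QuasiRegular

end

section

open IsLocalRing RingTheory.Sequence CategoryTheory Abelian Pointwise

/-! ### Reduction of Ext modulo a regular sequence -/

section ExtDuality

universe u

variable {A : Type u} [CommRing A]

theorem ModuleCat.subsingleton_ext_of_linearEquiv {N N' M : ModuleCat.{u} A} (e : N ≃ₗ[A] N') {n : ℕ}
    (h : Subsingleton (Ext N' M n)) : Subsingleton (Ext N M n) := by
  refine subsingleton_of_forall_eq 0 fun x => ?_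
  have h1 : x = (Ext.mk₀ e.toModuleIso.hom).comp
      ((Ext.mk₀ e.toModuleIso.inv).comp x (zero_add n)) (zero_add n) := by
    rw [← Ext.comp_assoc_of_second_deg_zero, Ext.mk₀_comp_mk₀, Iso.hom_inv_id, Ext.mk₀_id_comp]
  rw [h1, Subsingleton.elim ((Ext.mk₀ e.toModuleIso.inv).comp x (zero_add n)) 0, Ext.comp_zero]

/-- The short exact sequence given by an injective linear map. -/
theorem ModuleCat.exists_shortExact_of_injective {N N' : ModuleCat.{u} A} (i : N →ₗ[A] N')
    (hi : Function.Injective i) :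
    (ModuleCat.shortComplexOfCompEqZero i (LinearMap.range i).mkQ
      i.exact_map_mkQ_range.linearMap_comp_eq_zero).ShortExact :=
  ModuleCat.shortComplex_shortExact _ i.exact_map_mkQ_range hi (Submodule.mkQ_surjective _)

variable [IsNoetherianRing A]

/-- If `rs` is `M`-regular, then `Ext^n(-, M)` with `n` the length of `rs` is represented by
`M/(rs)M` on the modules killed by `rs`. -/
theorem exists_ext_bijective (rs : List A) (M : ModuleCat.{u} A) [Module.Finite A M]
    (hrs : IsRegular M rs) :
    ∃ (E : ModuleCat.{u} A) (_ : E ≃ₗ[A] M ⧸ (Ideal.ofList rs • ⊤ : Submodule A M))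
      (ε : Ext E M rs.length), ∀ (N : ModuleCat.{u} A), Module.Finite A N →
        (∀ r ∈ rs, r ∈ Module.annihilator A N) →
        Function.Bijective fun f : N ⟶ E => (Ext.mk₀ f).comp ε (zero_add _) := by
  induction rs generalizing M with
  | nil =>
    refine ⟨M, (Submodule.quotEquivOfEqBot _ (by simp)).symm, Ext.mk₀ (𝟙 M), fun N _ _ => ?_⟩
    simp only [Ext.comp_mk₀_id]
    exact Ext.homEquiv₀.symm.bijective
  | cons x rs ih =>
    have hrs' := hrs
    rw [isRegular_cons_iff] at hrs
    obtain ⟨E, e, ε, hε⟩ := ih (ModuleCat.of A (QuotSMulTop x M)) hrs.2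
    have hS := hrs.1.smulShortComplex_shortExact
    refine ⟨E, e.trans (Submodule.quotOfListConsSMulTopEquivQuotSMulTopInner M x rs).symm,
      ε.comp hS.extClass rfl, fun N hN hNann => ?_⟩
    -- The universal class is the one for M/xM followed by the connecting map of 0 → M → M → M/xM →
    -- 0. It remains to see that the connecting map is bijective.
    have h1 : (fun f : N ⟶ E => (Ext.mk₀ f).comp (ε.comp hS.extClass rfl) (zero_add _)) =
        (fun y : Ext N (ModuleCat.of A (QuotSMulTop x M)) rs.length =>
          (y.comp hS.extClass rfl : Ext N M (rs.length + 1))) ∘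
          fun f : N ⟶ E => (Ext.mk₀ f).comp ε (zero_add _) := by
      ext f
      simp only [Function.comp_apply]
      exact (Ext.comp_assoc (Ext.mk₀ f) ε hS.extClass (zero_add _) rfl (by omega)).symm
    change Function.Bijective (fun f : N ⟶ E => (Ext.mk₀ f).comp (ε.comp hS.extClass rfl) (zero_add _))
    rw [h1]
    refine Function.Bijective.comp ⟨?_, ?_⟩
      (hε N hN fun r hr => hNann r (List.mem_cons_of_mem x hr))
    -- Injectivity: the preceding Ext vanishes, since N is killed by an M-regular sequence longer
    -- than that degree.
    · have hsub : Subsingleton (Ext N M rs.length) := by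
        refine ModuleCat.subsingleton_ext_of_exists_isRegular (Ideal.ofList (x :: rs)) N ?_ M
          (lt_top_iff_ne_top.mpr hrs'.top_ne_smul.symm) (x :: rs)
          (fun r hr => Ideal.subset_span hr) hrs' rs.length (by simp)
        rw [Module.support_eq_zeroLocus]
        exact PrimeSpectrum.zeroLocus_anti_mono (Ideal.span_le.mpr hNann)
      refine (injective_iff_map_eq_zero (hS.extClass.postcomp N rfl)).mpr fun y hy => ?_
      obtain ⟨w, hw⟩ := Ext.covariant_sequence_exact₃ N hS y rfl hy
      rw [← hw, Subsingleton.elim (α := Ext N M rs.length) w 0]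
      exact Ext.zero_comp ..
    -- Surjectivity: x annihilates N, so multiplication by x is zero on the next Ext.
    · intro w
      have h2 : w.comp (Ext.mk₀ (ModuleCat.smulShortComplex M x).f) (add_zero _) = 0 := by
        have := Ext.postcomp_smul_id_eq_zero_of_mem_annihilator (M := M)
          (hNann x List.mem_cons_self) (rs.length + 1)
        rw [ModuleCat.smulShortComplex_f_eq_smul_id]
        exact congrArg (fun f => f.hom w) this
      obtain ⟨y, hy⟩ := Ext.covariant_sequence_exact₁ N hS w h2 rfl
      exact ⟨y, hy⟩

variable [IsLocalRing A]

theorem isFiniteLength_quotient_of_pow_le {L : Ideal A} {N : ℕ}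
    (hN : maximalIdeal A ^ N ≤ L) : IsFiniteLength A (A ⧸ L) := by
  rcases eq_or_ne L ⊤ with rfl | hL
  · have : Subsingleton (A ⧸ (⊤ : Ideal A)) := Submodule.Quotient.subsingleton_iff.mpr rfl
    exact .of_subsingleton
  have : Nontrivial (A ⧸ L) := Ideal.Quotient.nontrivial_iff.mpr hL
  have := IsLocalRing.of_surjective' (Ideal.Quotient.mk L) Ideal.Quotient.mk_surjective
  have : IsArtinianRing (A ⧸ L) := by
    rw [isArtinianRing_iff_isNilpotent_maximalIdeal]
    refine ⟨N, ?_⟩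
    rw [← IsLocalRing.map_maximalIdeal_of_surjective (Ideal.Quotient.mk L)
      Ideal.Quotient.mk_surjective, ← Ideal.map_pow, Ideal.zero_eq_bot, Ideal.map_eq_bot_iff_le_ker,
      Ideal.mk_ker]
    exact hN
  rw [isFiniteLength_iff_isNoetherian_isArtinian]
  exact ⟨inferInstance, isArtinian_of_surjective_algebraMap (S := A) (R := A ⧸ L)
    Ideal.Quotient.mk_surjective⟩

theorem IsSimpleModule.nonempty_linearEquiv_residueField (A : Type*) [CommRing A] [IsLocalRing A]
    (N : Type*) [AddCommGroup N] [Module A N] [IsSimpleModule A N] : Nonempty (N ≃ₗ[A] ResidueField A) := by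
  obtain ⟨I, hI, ⟨e⟩⟩ := isSimpleModule_iff_quot_maximal.mp ‹IsSimpleModule A N›
  obtain rfl := IsLocalRing.eq_maximalIdeal hI
  exact ⟨e⟩

/-- Induction along a composition series, all of whose factors are the residue field. -/
theorem ModuleCat.subsingleton_ext_of_isFiniteLength {M : ModuleCat.{u} A} {n : ℕ}
    (h : Subsingleton (Ext (ModuleCat.of A (ResidueField A)) M n)) {N : Type u} [AddCommGroup N]
    [Module A N] (hN : IsFiniteLength A N) : Subsingleton (Ext (ModuleCat.of A N) M n) := by
  induction hN with
  | @of_subsingleton N _ _ _ =>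
    refine subsingleton_of_forall_eq 0 fun x => ?_
    have h0 : (𝟙 (ModuleCat.of A N)) = 0 := by
      ext y
      exact Subsingleton.elim (α := N) _ _
    rw [← x.mk₀_id_comp, h0, Ext.mk₀_zero, Ext.zero_comp]
  | @of_simple_quotient N _ _ N' _ _ ih =>
    obtain ⟨e⟩ := IsSimpleModule.nonempty_linearEquiv_residueField A (N ⧸ N')
    have hS := ModuleCat.exists_shortExact_of_injective
      (N := ModuleCat.of A N') (N' := ModuleCat.of A N) N'.subtype N'.injective_subtype
    have h3 : Subsingleton (Ext (ModuleCat.of A (N ⧸ LinearMap.range N'.subtype)) M n) :=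
      ModuleCat.subsingleton_ext_of_linearEquiv (N' := ModuleCat.of A (ResidueField A))
        ((Submodule.quotEquivOfEq _ _ N'.range_subtype).trans e) h
    refine subsingleton_of_forall_eq 0 fun x => ?_
    obtain ⟨y, hy⟩ := Ext.contravariant_sequence_exact₂ hS M x (Subsingleton.elim _ _)
    rw [← hy, Subsingleton.elim y 0, Ext.comp_zero]

theorem maximalIdeal_mem_associatedPrimes {N : Type*} [AddCommGroup N] [Module A N] [Nontrivial N]
    {k : ℕ} (hk : maximalIdeal A ^ k ≤ Module.annihilator A N) :
    maximalIdeal A ∈ associatedPrimes A N := by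
  obtain ⟨p, hp⟩ := associatedPrimes.nonempty A N
  have hpp : p.IsPrime := hp.isPrime
  have h1 : maximalIdeal A ≤ p := hpp.le_of_pow_le
    (hk.trans (by simpa [Submodule.annihilator_top] using hp.annihilator_le))
  rwa [le_antisymm h1 (le_maximalIdeal hpp.ne_top)]

/-- If `M` has finite injective dimension, then `Ext^n(N, M) = 0` for all modules `N` of finite
length and all `n` greater than the length of a regular sequence generating a primary ideal. -/
theorem ModuleCat.subsingleton_ext_of_hasInjectiveDimensionLE {rs : List A} (hrs : IsRegular A rs)
    {k : ℕ} (hk : maximalIdeal A ^ k ≤ Ideal.ofList rs) (M : ModuleCat.{u} A) {m : ℕ}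
    (hM : HasInjectiveDimensionLE M m) {n : ℕ} (hn : rs.length < n) {N : Type u} [AddCommGroup N]
    [Module A N] (hN : IsFiniteLength A N) : Subsingleton (Ext (ModuleCat.of A N) M n) := by
  -- Descending induction on n: j bounds the distance to the degrees where Ext vanishes by the
  -- injective dimension.
  obtain ⟨j, hj⟩ : ∃ j, m + 1 ≤ n + j := ⟨m + 1, by omega⟩
  induction j generalizing n N with
  | zero => exact HasInjectiveDimensionLT.subsingleton M (m + 1) n hj _
  | succ j ih =>
    refine ModuleCat.subsingleton_ext_of_isFiniteLength ?_ hN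
    have hfl := isFiniteLength_quotient_of_pow_le hk
    -- The residue field embeds in A/(rs), whose projective dimension is the length of `rs`, so
    -- Ext^n(A/(rs), M) = 0. The cokernel has finite length, and its Ext^(n+1) vanishes by
    -- induction; together these kill Ext^n of the residue field.
    have hass : maximalIdeal A ∈ associatedPrimes A (A ⧸ Ideal.ofList rs) := by
      have : Nontrivial (A ⧸ Ideal.ofList rs) := Ideal.Quotient.nontrivial_iff.mpr
        fun h => hrs.top_ne_smul (by simp [h])
      exact maximalIdeal_mem_associatedPrimes (by rwa [Ideal.annihilator_quotient])
    obtain ⟨-, f, hf⟩ := isAssociatedPrime_iff_exists_injective_linearMap _ _ |>.mp hass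
    have hS := ModuleCat.exists_shortExact_of_injective
      (N := ModuleCat.of A (ResidueField A)) (N' := ModuleCat.of A (A ⧸ Ideal.ofList rs)) f hf
    have h2 : Subsingleton (Ext (ModuleCat.of A (A ⧸ Ideal.ofList rs)) M n) := by
      refine ModuleCat.subsingleton_ext_of_linearEquiv
        (N' := ModuleCat.of A (Shrink.{u} (A ⧸ Ideal.ofList rs))) (Shrink.linearEquiv A _).symm ?_
      have := ModuleCat.projectiveDimension_quotient_eq_length rs hrs
      have h4 : HasProjectiveDimensionLT
          (ModuleCat.of A (Shrink.{u} (A ⧸ Ideal.ofList rs))) (rs.length + 1) :=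
        (projectiveDimension_le_iff _ _).mp this.le
      exact HasProjectiveDimensionLT.subsingleton _ (rs.length + 1) n hn M
    have h3 := ih (n := 1 + n) (N := (A ⧸ Ideal.ofList rs) ⧸ LinearMap.range f) (by omega)
      (hfl.of_surjective (Submodule.mkQ_surjective _)) (by omega)
    refine subsingleton_of_forall_eq 0 fun x => ?_
    obtain ⟨y, hy⟩ := Ext.contravariant_sequence_exact₁ hS M x rfl (@Subsingleton.elim _ h3 _ _)
    rw [← hy, Subsingleton.elim y 0, Ext.comp_zero]

variable {M : Type u} [AddCommGroup M] [Module A M] [Module.Finite A M]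

/-- Homomorphisms into `M/(rs)M` extend, if `rs` is regular on `A` and on `M` and `M` has finite
injective dimension. -/
theorem exists_extension_of_hasInjectiveDimensionLE {rs : List A} (hrs : IsRegular A rs)
    (hrsM : IsRegular M rs) {k : ℕ} (hk : maximalIdeal A ^ k ≤ Ideal.ofList rs) {m : ℕ}
    (hM : HasInjectiveDimensionLE (ModuleCat.of A M) m) {N N' : Type u} [AddCommGroup N]
    [Module A N] [AddCommGroup N'] [Module A N'] (hN' : IsFiniteLength A N')
    (hann : Ideal.ofList rs ≤ Module.annihilator A N') (i : N →ₗ[A] N')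
    (hi : Function.Injective i) (f : N →ₗ[A] M ⧸ (Ideal.ofList rs • ⊤ : Submodule A M)) :
    ∃ g : N' →ₗ[A] M ⧸ (Ideal.ofList rs • ⊤ : Submodule A M), g ∘ₗ i = f := by
  obtain ⟨E, e, ε, hε⟩ := exists_ext_bijective rs (ModuleCat.of A M) hrsM
  have hS := ModuleCat.exists_shortExact_of_injective
    (N := ModuleCat.of A N) (N' := ModuleCat.of A N') i hi
  have hN := hN'.of_injective hi
  have fN' : Module.Finite A N' :=
    have := (isFiniteLength_iff_isNoetherian_isArtinian.mp hN').1; inferInstance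
  have fN : Module.Finite A N :=
    have := (isFiniteLength_iff_isNoetherian_isArtinian.mp hN).1; inferInstance
  have hannN : Ideal.ofList rs ≤ Module.annihilator A N :=
    hann.trans (LinearMap.annihilator_le_of_injective i hi)
  let f' : ModuleCat.of A N ⟶ E := ModuleCat.ofHom (e.symm.toLinearMap ∘ₗ f)
  -- The obstruction to extending f lies in Ext of N'/N one degree above the length of `rs`, which
  -- is zero. The lift of the Ext class then comes from a homomorphism because N' is killed by `rs`.
  have h3 := ModuleCat.subsingleton_ext_of_hasInjectiveDimensionLE hrs hk (ModuleCat.of A M) hM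
    (n := 1 + rs.length) (by omega) (hN'.of_surjective (LinearMap.range i).mkQ_surjective)
  obtain ⟨y, hy⟩ := Ext.contravariant_sequence_exact₁ hS (ModuleCat.of A M)
    ((Ext.mk₀ f').comp ε (zero_add _)) rfl (Subsingleton.elim _ _)
  obtain ⟨g, rfl⟩ := (hε (ModuleCat.of A N') fN' fun r hr => hann (Ideal.subset_span hr)).2 y
  have h4 : ModuleCat.ofHom i ≫ g = f' := by
    refine (hε (ModuleCat.of A N) fN fun r hr => hannN (Ideal.subset_span hr)).1 ?_
    dsimp only
    rw [← hy, ← Ext.mk₀_comp_mk₀, Ext.comp_assoc_of_second_deg_zero]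
  refine ⟨e.toLinearMap ∘ₗ g.hom, ?_⟩
  ext x
  have h5 : g.hom (i x) = e.symm (f x) := congrArg (fun h => h.hom x) h4
  simp [h5]

/-- The residue field is killed by `rs`, so the representability statement applies to it. The type
thus becomes the length of the socle of M/(rs)M. -/
theorem extLength_eq_length_linearMap {rs : List A} (hrsM : IsRegular M rs)
    (hmem : ∀ r ∈ rs, r ∈ maximalIdeal A) :
    extLength A M rs.length = Module.length A
      (ResidueField A →ₗ[A] M ⧸ (Ideal.ofList rs • ⊤ : Submodule A M)) := by
  obtain ⟨E, e, ε, hε⟩ := exists_ext_bijective rs (ModuleCat.of A M) hrsM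
  have h := hε (ModuleCat.of A (ResidueField A)) inferInstance fun r hr => by
    have : Module.annihilator A (ResidueField A) = maximalIdeal A :=
      Ideal.annihilator_quotient (I := maximalIdeal A)
    rw [this]
    exact hmem r hr
  let φ : (ModuleCat.of A (ResidueField A) ⟶ E) →ₗ[A]
      Ext (ModuleCat.of A (ResidueField A)) (ModuleCat.of A M) rs.length :=
    (Ext.postcompOfLinear ε A (ModuleCat.of A (ResidueField A)) (zero_add _)) ∘ₗ
      (Ext.linearEquiv₀ (R := A)).symm.toLinearMap
  have hφ : Function.Bijective φ := h
  rw [extLength, ← (LinearEquiv.ofBijective φ hφ).length_eq,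
    (ModuleCat.homLinearEquiv (S := A)).length_eq]
  exact (LinearEquiv.congrRight e).length_eq

end ExtDuality

end

section

open IsLocalRing RingTheory.Sequence CategoryTheory Abelian Pointwise

/-! ### Matlis duality over A/Q by counting lengths -/

section ArtinianDuality

universe u

variable {A : Type u} [CommRing A]

theorem LinearMap.surjective_of_injective_of_length_eq {M N : Type*} [AddCommGroup M] [Module A M]
    [AddCommGroup N] [Module A N] (f : M →ₗ[A] N) (hf : Function.Injective f)
    (h : Module.length A M = Module.length A N) (hM : Module.length A M ≠ ⊤) :
    Function.Surjective f := by
  have h1 := Module.length_eq_add_of_exact f (LinearMap.range f).mkQ hf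
    (Submodule.mkQ_surjective _) (LinearMap.exact_map_mkQ_range f)
  rw [← h] at h1
  have h2 : Module.length A (N ⧸ LinearMap.range f) = 0 := by
    have : Module.length A M + 0 = Module.length A M +
        Module.length A (N ⧸ LinearMap.range f) := by rw [add_zero, ← h1]
    exact (ENat.add_right_injective_of_ne_top hM this).symm
  rw [Module.length_eq_zero_iff, Submodule.Quotient.subsingleton_iff] at h2
  exact LinearMap.range_eq_top.mp h2

theorem LinearMap.injective_of_surjective_of_length_eq {M N : Type*} [AddCommGroup M] [Module A M]
    [AddCommGroup N] [Module A N] (f : M →ₗ[A] N) (hf : Function.Surjective f)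
    (h : Module.length A M = Module.length A N) (hN : Module.length A N ≠ ⊤) :
    Function.Injective f := by
  have h1 := Module.length_eq_add_of_exact (LinearMap.ker f).subtype f
    (Submodule.subtype_injective _) hf (LinearMap.exact_subtype_ker_map f)
  have h2 : Module.length A (LinearMap.ker f) = 0 := by
    rw [h, add_comm] at h1
    have : Module.length A N + 0 = Module.length A N +
        Module.length A (LinearMap.ker f) := by rw [add_zero, ← h1]
    exact (ENat.add_right_injective_of_ne_top hN this).symm
  rw [Module.length_eq_zero_iff, Submodule.subsingleton_iff_eq_bot] at h2
  exact LinearMap.ker_eq_bot.mp h2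

/-- Homomorphisms into `M` extend along injective maps into modules of finite length killed
by `Q`. -/
def IsInjectiveModulo (Q : Ideal A) (M : Type u) [AddCommGroup M] [Module A M] : Prop :=
  ∀ (N N' : Type u) [AddCommGroup N] [Module A N] [AddCommGroup N'] [Module A N'],
    IsFiniteLength A N' → Q ≤ Module.annihilator A N' → ∀ i : N →ₗ[A] N', Function.Injective i →
      ∀ f : N →ₗ[A] M, ∃ g : N' →ₗ[A] M, g ∘ₗ i = f

variable {E : Type u} [AddCommGroup E] [Module A E] {Q : Ideal A}

theorem LinearMap.bijective_apply_one_of_le_annihilator {L : Ideal A}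
    (hL : L ≤ Module.annihilator A E) :
    Function.Bijective (LinearMap.applyₗ (R := A) (M₂ := E) (1 : A ⧸ L)) := by
  constructor
  · rw [injective_iff_map_eq_zero]
    intro f hf
    ext
    simpa using hf
  · intro e
    refine ⟨Submodule.liftQ L (LinearMap.toSpanSingleton A E e) fun a ha => ?_, ?_⟩
    · simpa using Module.mem_annihilator.mp (hL ha) e
    · exact one_smul A e

theorem le_ker_lsmul (hQ : Q ≤ Module.annihilator A E) : Q ≤ LinearMap.ker (LinearMap.lsmul A E) :=
  fun _ ha => LinearMap.mem_ker.mpr (LinearMap.ext fun e => Module.mem_annihilator.mp (hQ ha) e)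

variable [IsLocalRing A]

/-- Hom(-, E) is exact on these modules, so lengths add along a composition series, each simple
factor contributing the length of the socle of E. -/
theorem IsInjectiveModulo.length_linearMap (hE : IsInjectiveModulo Q E) {N : Type u}
    [AddCommGroup N] [Module A N] (hN : IsFiniteLength A N) (hann : Q ≤ Module.annihilator A N) :
    Module.length A (N →ₗ[A] E) = Module.length A N * Module.length A (ResidueField A →ₗ[A] E) := by
  induction hN with
  | @of_subsingleton N _ _ _ =>
    have : Subsingleton (N →ₗ[A] E) :=
      ⟨fun f g => LinearMap.ext fun x => by simp [Subsingleton.elim x 0]⟩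
    simp [Module.length_eq_zero]
  | @of_simple_quotient N _ _ N' _ hN' ih =>
    obtain ⟨e⟩ := IsSimpleModule.nonempty_linearEquiv_residueField A (N ⧸ N')
    have hN : IsFiniteLength A N := .of_simple_quotient hN'
    have h1 := Module.length_eq_add_of_exact N'.subtype N'.mkQ N'.injective_subtype
      N'.mkQ_surjective (LinearMap.exact_subtype_mkQ N')
    have h2 := Module.length_eq_add_of_exact (LinearMap.lcomp A E N'.mkQ)
      (LinearMap.lcomp A E N'.subtype) ?_ ?_ ?_
    · rw [h2, h1, ih (hann.trans (LinearMap.annihilator_le_of_injective _ N'.injective_subtype)),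
        Module.length_eq_one A (N ⧸ N'), (LinearEquiv.congrLeft E A e).length_eq]
      ring
    · intro f g hfg
      ext x
      exact LinearMap.congr_fun hfg x
    · intro f
      obtain ⟨g, hg⟩ := hE N' N hN hann N'.subtype N'.injective_subtype f
      exact ⟨g, hg⟩
    · intro f
      constructor
      · intro hf
        refine ⟨N'.liftQ f fun x hx => LinearMap.congr_fun hf ⟨x, hx⟩, ?_⟩
        ext x
        rfl
      · rintro ⟨g, rfl⟩
        ext x
        simp only [LinearMap.lcomp_apply, Submodule.subtype_apply, Submodule.mkQ_apply,
          (Submodule.Quotient.mk_eq_zero N').mpr x.2, map_zero, LinearMap.zero_apply]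

variable [IsNoetherianRing A] {k : ℕ}

theorem isFiniteLength_of_pow_le_annihilator {N : Type*} [AddCommGroup N] [Module A N]
    [Module.Finite A N] (hk : maximalIdeal A ^ k ≤ Module.annihilator A N) :
    IsFiniteLength A N := by
  obtain ⟨n, f, hf⟩ := Module.Finite.exists_fin' A N
  have h1 : IsFiniteLength A (Fin n → A ⧸ Module.annihilator A N) := by
    rw [← Module.length_ne_top_iff, Module.length_pi]
    have := Module.length_ne_top_iff.mpr (isFiniteLength_quotient_of_pow_le hk)
    rw [ENat.card_eq_coe_natCard]
    exact WithTop.mul_ne_top (ENat.natCast_ne_top _) this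
  let L := Module.annihilator A N
  let g : (Fin n → A ⧸ L) →ₗ[A] N :=
    (Submodule.liftQ (Submodule.pi Set.univ fun _ : Fin n => L) f fun x hx => by
      rw [LinearMap.mem_ker, LinearMap.pi_apply_eq_sum_univ f x]
      refine Finset.sum_eq_zero fun i _ => ?_
      exact Module.mem_annihilator.mp (hx i trivial) _) ∘ₗ
      (Submodule.quotientPi fun _ : Fin n => L).symm.toLinearMap
  refine h1.of_surjective (f := g) ?_
  intro y
  obtain ⟨x, rfl⟩ := hf y
  refine ⟨Submodule.quotientPi _ (Submodule.Quotient.mk x), ?_⟩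
  simp only [g, LinearMap.comp_apply, LinearEquiv.coe_coe, LinearEquiv.symm_apply_apply]
  exact Submodule.liftQ_apply _ _ _

namespace IsInjectiveModulo

/-- E ≅ Hom(A/L, E) has the length of A/L. The freedom in L is the point: L = Q and L = Ann(E)
together show that E is faithful over A/Q. -/
theorem length_eq (hE : IsInjectiveModulo Q E) (hk : maximalIdeal A ^ k ≤ Q)
    (hsoc : Module.length A (ResidueField A →ₗ[A] E) = 1) {L : Ideal A} (hQL : Q ≤ L) (hL : L ≤ Module.annihilator A E) :
    Module.length A (A ⧸ L) = Module.length A E := by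
  have := hE.length_linearMap (N := A ⧸ L) (isFiniteLength_quotient_of_pow_le (hk.trans hQL))
    (by rwa [Ideal.annihilator_quotient])
  rw [hsoc, mul_one] at this
  rw [← this]
  exact (LinearEquiv.ofBijective _ (LinearMap.bijective_apply_one_of_le_annihilator hL)).length_eq

theorem annihilator_eq (hE : IsInjectiveModulo Q E) (hk : maximalIdeal A ^ k ≤ Q)
    (hQ : Q ≤ Module.annihilator A E)
    (hsoc : Module.length A (ResidueField A →ₗ[A] E) = 1) : Module.annihilator A E = Q := by
  refine le_antisymm (fun a ha => ?_) hQ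
  have hinj := LinearMap.injective_of_surjective_of_length_eq (Submodule.factor hQ)
    (Submodule.factor_surjective hQ)
    ((hE.length_eq hk hsoc le_rfl hQ).trans (hE.length_eq hk hsoc hQ le_rfl).symm)
    (Module.length_ne_top_iff.mpr (isFiniteLength_quotient_of_pow_le (hk.trans hQ)))
  have : (Submodule.Quotient.mk a : A ⧸ Q) = 0 := hinj (by
    rw [map_zero]
    exact (Submodule.Quotient.mk_eq_zero _).mpr ha)
  exact (Submodule.Quotient.mk_eq_zero _).mp this

/-- The map A/Q → End(E) is injective by faithfulness, and both sides have the length of E. -/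
theorem bijective_lsmul [Module.Finite A E] (hE : IsInjectiveModulo Q E) (hk : maximalIdeal A ^ k ≤ Q)
    (hQ : Q ≤ Module.annihilator A E)
    (hsoc : Module.length A (ResidueField A →ₗ[A] E) = 1) :
    Function.Bijective (Submodule.liftQ Q (LinearMap.lsmul A E) (le_ker_lsmul hQ)) := by
  have hfl := isFiniteLength_of_pow_le_annihilator (hk.trans hQ)
  have hinj : Function.Injective (Submodule.liftQ Q (LinearMap.lsmul A E) (le_ker_lsmul hQ)) := by
    rw [← LinearMap.ker_eq_bot, eq_bot_iff]
    intro x hx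
    obtain ⟨a, rfl⟩ := Submodule.Quotient.mk_surjective _ x
    rw [LinearMap.mem_ker, Submodule.liftQ_apply] at hx
    rw [Submodule.mem_bot, Submodule.Quotient.mk_eq_zero, ← hE.annihilator_eq hk hQ hsoc,
      Module.mem_annihilator]
    exact fun e => LinearMap.congr_fun hx e
  refine ⟨hinj, LinearMap.surjective_of_injective_of_length_eq _ hinj ?_
    (Module.length_ne_top_iff.mpr (isFiniteLength_quotient_of_pow_le hk))⟩
  rw [hE.length_linearMap hfl hQ, hsoc, mul_one, hE.length_eq hk hsoc le_rfl hQ]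

theorem exists_smul_eq [Module.Finite A E] (hE : IsInjectiveModulo Q E) (hk : maximalIdeal A ^ k ≤ Q)
    (hQ : Q ≤ Module.annihilator A E)
    (hsoc : Module.length A (ResidueField A →ₗ[A] E) = 1) (φ : E →ₗ[A] E) : ∃ b : A, ∀ e, φ e = b • e := by
  obtain ⟨x, hx⟩ := (hE.bijective_lsmul hk hQ hsoc).2 φ
  obtain ⟨b, rfl⟩ := Submodule.Quotient.mk_surjective _ x
  refine ⟨b, fun e => ?_⟩
  rw [← hx, Submodule.liftQ_apply]
  rfl

/-- The length of the socle of `A/Q` is the minimal number of generators of `E`. -/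
theorem length_socle_eq [Module.Finite A E] (hE : IsInjectiveModulo Q E) (hk : maximalIdeal A ^ k ≤ Q)
    (hQ : Q ≤ Module.annihilator A E)
    (hsoc : Module.length A (ResidueField A →ₗ[A] E) = 1) :
    Module.length A (ResidueField A →ₗ[A] A ⧸ Q) =
    Module.length A (E ⧸ (maximalIdeal A • ⊤ : Submodule A E)) := by
  have hfl := isFiniteLength_of_pow_le_annihilator (hk.trans hQ)
  -- With k the residue field, Hom(k, A/Q) = Hom(k, End E) = Hom(k ⊗ E, E), and the last is the dual
  -- of E/𝔪E, of the same length.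
  let e := LinearEquiv.ofBijective _ (hE.bijective_lsmul hk hQ hsoc)
  rw [(LinearEquiv.congrRight (M := ResidueField A) e).length_eq,
    (TensorProduct.lift.equiv (RingHom.id A) (ResidueField A) E E).length_eq]
  have e' : TensorProduct A (ResidueField A) E ≃ₗ[A]
    (E ⧸ (maximalIdeal A • ⊤ : Submodule A E)) :=
    TensorProduct.quotTensorEquivQuotSMul E (maximalIdeal A)
  rw [← e'.length_eq, hE.length_linearMap, hsoc, mul_one]
  · exact e'.symm.isFiniteLength (hfl.of_surjective (Submodule.mkQ_surjective _))
  · rw [e'.annihilator_eq]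
    exact hQ.trans (LinearMap.annihilator_le_of_surjective _ (Submodule.mkQ_surjective _))

/-- Any two nonzero submodules have a nonzero intersection. -/
theorem _root_.inf_ne_bot_of_length_socle_eq_one (hk : maximalIdeal A ^ k ≤ Q)
    (hQ : Q ≤ Module.annihilator A E)
    (hsoc : Module.length A (ResidueField A →ₗ[A] E) = 1)
    {N₁ N₂ : Submodule A E} (h₁ : N₁ ≠ ⊥) (h₂ : N₂ ≠ ⊥) : N₁ ⊓ N₂ ≠ ⊥ := by
  have key : ∀ N : Submodule A E, N ≠ ⊥ → ∃ f : ResidueField A →ₗ[A] E,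
      Function.Injective f ∧ ∀ x, f x ∈ N := by
    intro N hN
    have : Nontrivial N := (Submodule.nontrivial_iff_ne_bot).mpr hN
    have hass := maximalIdeal_mem_associatedPrimes (A := A) (N := N) (k := k)
      ((hk.trans hQ).trans (LinearMap.annihilator_le_of_injective _ N.injective_subtype))
    obtain ⟨-, f, hf⟩ := (isAssociatedPrime_iff_exists_injective_linearMap _ _).mp hass
    exact ⟨N.subtype ∘ₗ f, N.injective_subtype.comp hf, fun x => (f x).2⟩
  obtain ⟨f₁, hf₁, h₁'⟩ := key N₁ h₁
  obtain ⟨f₂, hf₂, h₂'⟩ := key N₂ h₂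
  have hs : IsSimpleModule A (ResidueField A →ₗ[A] E) := Module.length_eq_one_iff.mp hsoc
  have hf₁0 : f₁ ≠ 0 := by
    rintro rfl
    exact one_ne_zero (hf₁ (by simp : (0 : ResidueField A →ₗ[A] E) 1 = (0 : ResidueField A →ₗ[A] E) 0))
  -- Each submodule contains an embedded residue field. As Hom(k, E) is simple, one embedding is a
  -- multiple of the other, so its image lies in both submodules.
  have hspan := IsSimpleModule.span_singleton_eq_top A hf₁0
  obtain ⟨c, hc⟩ := Submodule.mem_span_singleton.mp
    (hspan ▸ Submodule.mem_top : f₂ ∈ Submodule.span A {f₁})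
  rw [Submodule.ne_bot_iff]
  refine ⟨f₂ 1, ⟨?_, h₂' 1⟩, fun h => one_ne_zero (hf₂ (h.trans (map_zero f₂).symm))⟩
  rw [← hc]
  exact N₁.smul_mem c (h₁' 1)

end IsInjectiveModulo

theorem length_linearMap_residueField_quotient_ne_zero (hk : maximalIdeal A ^ k ≤ Q) (hQ : Q ≠ ⊤) :
    Module.length A (ResidueField A →ₗ[A] A ⧸ Q) ≠ 0 := by
  have : Nontrivial (A ⧸ Q) := Ideal.Quotient.nontrivial_iff.mpr hQ
  have hass := maximalIdeal_mem_associatedPrimes (A := A) (N := A ⧸ Q) (k := k)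
    (by rwa [Ideal.annihilator_quotient])
  obtain ⟨-, f, hf⟩ := (isAssociatedPrime_iff_exists_injective_linearMap _ _).mp hass
  rw [Ne, Module.length_eq_zero_iff]
  intro h
  have : Subsingleton (ResidueField A →ₗ[A] A ⧸ Q) := h
  have h0 : f = 0 := Subsingleton.elim (α := ResidueField A →ₗ[A] A ⧸ Q) f 0
  rw [h0] at hf
  exact one_ne_zero (α := ResidueField A) (hf rfl)

theorem length_linearMap_residueField_quotient_ne_top (hk : maximalIdeal A ^ k ≤ Q) :
    Module.length A (ResidueField A →ₗ[A] A ⧸ Q) ≠ ⊤ := by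
  refine ne_top_of_le_ne_top (Module.length_ne_top_iff.mpr (isFiniteLength_quotient_of_pow_le hk))
    (Module.length_le_of_injective (LinearMap.applyₗ (R := A) (M₂ := A ⧸ Q) (1 : ResidueField A)) ?_)
  rw [injective_iff_map_eq_zero]
  intro f hf
  ext x
  obtain ⟨a, rfl⟩ := IsLocalRing.residue_surjective x
  have : residue A a = a • (1 : ResidueField A) := by
    rw [Algebra.smul_def, mul_one]; rfl
  rw [this, map_smul]
  have hf' : f 1 = 0 := hf
  simp [hf']

/-- A/Q is its own endomorphism module, so its length equals itself times the socle length; cancel.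
-/
theorem IsInjectiveModulo.length_socle_self_eq_one (hE : IsInjectiveModulo Q (A ⧸ Q))
    (hk : maximalIdeal A ^ k ≤ Q) (hQ : Q ≠ ⊤) :
    Module.length A (ResidueField A →ₗ[A] A ⧸ Q) = 1 := by
  have hann : Q ≤ Module.annihilator A (A ⧸ Q) := by rw [Ideal.annihilator_quotient]
  have h1 := hE.length_linearMap (isFiniteLength_quotient_of_pow_le hk) hann
  rw [(LinearEquiv.ofBijective _
    (LinearMap.bijective_apply_one_of_le_annihilator hann)).length_eq] at h1
  have : Nontrivial (A ⧸ Q) := Ideal.Quotient.nontrivial_iff.mpr hQ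
  have h2 := Module.length_ne_top_iff.mpr (isFiniteLength_quotient_of_pow_le hk)
  have h3 : Module.length A (A ⧸ Q) ≠ 0 := Module.length_pos.ne'
  have h4 := length_linearMap_residueField_quotient_ne_top hk
  lift Module.length A (A ⧸ Q) to ℕ using h2 with l
  lift Module.length A (ResidueField A →ₗ[A] A ⧸ Q) to ℕ using h4 with r
  norm_cast at h1 h3 ⊢
  exact (Nat.mul_right_cancel (Nat.pos_of_ne_zero h3) (by linarith : r * l = 1 * l))

end ArtinianDuality

end

section

open IsLocalRing RingTheory.Sequence CategoryTheory Abelian Pointwise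

/-! ### Existence and regularity of systems of parameters -/

section SystemsOfParameters

universe u

variable {A : Type u} [CommRing A] [IsLocalRing A] {d : ℕ} {a : Fin d → A}

theorem IsSystemOfParameters.mem_maximalIdeal (ha : IsSystemOfParameters a) (i : Fin d) :
    a i ∈ maximalIdeal A := by
  rw [← ha.2]
  exact Ideal.le_radical (Ideal.subset_span ⟨i, rfl⟩)

theorem IsSystemOfParameters.span_le (ha : IsSystemOfParameters a) :
    Ideal.span (Set.range a) ≤ maximalIdeal A :=
  Ideal.le_radical.trans ha.2.le

theorem IsSystemOfParameters.exists_pow_le [IsNoetherianRing A] (ha : IsSystemOfParameters a) :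
    ∃ k, maximalIdeal A ^ k ≤ Ideal.span (Set.range a) := by
  rw [← ha.2]
  exact Ideal.exists_radical_pow_le_of_fg _ (IsNoetherian.noetherian _)

theorem IsSystemOfParameters.pow (ha : IsSystemOfParameters a) {n : ℕ} (hn : n ≠ 0) :
    IsSystemOfParameters fun i => a i ^ n := by
  refine ⟨ha.1, le_antisymm ?_ ?_⟩
  · rw [← (IsLocalRing.maximalIdeal.isMaximal A).isPrime.radical]
    refine Ideal.radical_mono (Ideal.span_le.mpr ?_)
    rintro _ ⟨i, rfl⟩
    exact Ideal.pow_mem_of_mem _ (ha.mem_maximalIdeal i) n (Nat.pos_of_ne_zero hn)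
  · rw [← ha.2]
    refine Ideal.radical_le_radical_iff.mpr (Ideal.span_le.mpr ?_)
    rintro _ ⟨i, rfl⟩
    exact ⟨n, Ideal.subset_span ⟨i, rfl⟩⟩

theorem exists_isSystemOfParameters [IsNoetherianRing A] (hdim : ringKrullDim A = d) :
    ∃ a : Fin d → A, IsSystemOfParameters a := by
  obtain ⟨s, hs, hcard⟩ := (maximalIdeal A).exists_finset_card_eq_height_of_isNoetherianRing
  have hd : s.card = d := by
    have h := maximalIdeal_height_eq_ringKrullDim (R := A)
    rw [hdim, ← hcard] at h
    exact_mod_cast h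
  let e : Fin d ≃ s := (finCongr hd.symm).trans s.equivFin.symm
  have hrange : Set.range (fun i => (e i : A)) = s := by
    ext x
    constructor
    · rintro ⟨i, rfl⟩
      exact (e i).2
    · intro hx
      exact ⟨e.symm ⟨x, hx⟩, by simp⟩
  refine ⟨fun i => e i, hdim, ?_⟩
  rw [hrange]
  refine le_antisymm ?_ ?_
  · rw [← (IsLocalRing.maximalIdeal.isMaximal A).isPrime.radical]
    exact Ideal.radical_mono hs.1.2
  · rw [Ideal.radical_eq_sInf]
    refine le_sInf fun p ⟨hp, hpp⟩ => ?_
    exact hs.2 ⟨hpp, hp⟩ (IsLocalRing.le_maximalIdeal hpp.ne_top)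

/-- Dividing by the regular element x lowers the dimension by exactly one; lift a system of
parameters of A/(x) and put x in front. -/
theorem exists_isSystemOfParameters_of_isSMulRegular [IsNoetherianRing A] (hd : 0 < d)
    (hdim : ringKrullDim A = d) {x : A} (hx : IsSMulRegular A x) (hxm : x ∈ maximalIdeal A) :
    ∃ a : Fin d → A, IsSystemOfParameters a ∧ a ⟨0, hd⟩ = x := by
  obtain ⟨n, rfl⟩ := Nat.exists_eq_succ_of_ne_zero hd.ne'
  have hnt : Nontrivial (A ⧸ Ideal.span {x}) := Ideal.Quotient.nontrivial_iff.mpr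
    (ne_top_of_le_ne_top (IsLocalRing.maximalIdeal.isMaximal A).ne_top
      ((Ideal.span_singleton_le_iff_mem _).mpr hxm))
  have hloc : IsLocalRing (A ⧸ Ideal.span {x}) :=
    IsLocalRing.of_surjective' (Ideal.Quotient.mk _) Ideal.Quotient.mk_surjective
  have h1 := ringKrullDim_quotient_span_singleton_succ_eq_ringKrullDim hx hxm
  have h2 : ringKrullDim (A ⧸ Ideal.span {x}) = n := by
    rw [hdim, Nat.succ_eq_add_one] at h1
    push_cast at h1
    exact ENat.WithBot.add_one_cancel.mp h1
  obtain ⟨b, hb⟩ := exists_isSystemOfParameters h2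
  choose c hc using fun i => Ideal.Quotient.mk_surjective (b i)
  have hxm' : ∀ y : A, Ideal.Quotient.mk (Ideal.span {x}) y ∈ maximalIdeal (A ⧸ Ideal.span {x}) ↔
      y ∈ maximalIdeal A := by
    intro y
    have h := IsLocalRing.eq_maximalIdeal (Ideal.comap_isMaximal_of_surjective
      (Ideal.Quotient.mk (Ideal.span {x})) Ideal.Quotient.mk_surjective
      (K := maximalIdeal (A ⧸ Ideal.span {x})))
    rw [← Ideal.mem_comap, h]
  have hrange : Ideal.span (Set.range (Fin.cons x c : Fin (n + 1) → A)) =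
      Ideal.span {x} ⊔ Ideal.span (Set.range c) := by
    rw [Fin.range_cons, Ideal.span_insert]
  refine ⟨Fin.cons x c, ⟨hdim, ?_⟩, rfl⟩
  rw [hrange]
  refine le_antisymm ?_ fun y hy => ?_
  · rw [← (IsLocalRing.maximalIdeal.isMaximal A).isPrime.radical]
    refine Ideal.radical_mono (sup_le ((Ideal.span_singleton_le_iff_mem _).mpr hxm)
      (Ideal.span_le.mpr ?_))
    rintro _ ⟨i, rfl⟩
    exact (hxm' _).mp (hc i ▸ hb.mem_maximalIdeal i)
  · have hy' := (hxm' y).mpr hy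
    rw [← hb.2] at hy'
    obtain ⟨m, hm⟩ := hy'
    refine ⟨m, ?_⟩
    have : Set.range b = Ideal.Quotient.mk (Ideal.span {x}) '' Set.range c := by
      rw [← Set.range_comp]
      exact congrArg Set.range (funext fun i => (hc i).symm)
    rw [this, ← Ideal.map_span, ← map_pow,
      Ideal.mem_map_iff_of_surjective _ Ideal.Quotient.mk_surjective] at hm
    obtain ⟨z, hz, hzy⟩ := hm
    rw [Ideal.Quotient.eq] at hzy
    have : y ^ m = z - (z - y ^ m) := by ring
    rw [this]
    exact Ideal.sub_mem _ (le_sup_right (a := Ideal.span {x}) hz) (le_sup_left (b := Ideal.span (Set.range c)) hzy)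

variable [IsNoetherianRing A] {M : Type u} [AddCommGroup M] [Module A M] [Module.Finite A M]

theorem IsMaximalCohenMacaulay.isRegular (hM : IsMaximalCohenMacaulay A M)
    (ha : IsSystemOfParameters a) {l : List (Fin d)} (hl : l.length = d) (hl' : ∀ i, i ∈ l) :
    IsRegular M (l.map a) := by
  obtain ⟨rs, hmem, hrs, hlen⟩ := hM
  refine isRegular_of_maximalIdeal_le_radical hrs hmem _ ?_ ?_ ?_
  · rw [List.length_map, hl]
    rw [ha.1] at hlen
    exact_mod_cast hlen.symm
  · intro x hx
    obtain ⟨i, -, rfl⟩ := List.mem_map.mp hx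
    exact ha.mem_maximalIdeal i
  · rw [← ha.2]
    refine Ideal.radical_mono (le_sup_of_le_right (Ideal.span_mono ?_))
    rintro _ ⟨i, rfl⟩
    exact List.mem_map_of_mem (hl' i)

/-- A system of parameters is M-regular in every order. Listing T first and i next gives regularity
of a_i modulo the members of T. -/
theorem IsMaximalCohenMacaulay.mem_smul_top_of_smul_mem (hM : IsMaximalCohenMacaulay A M)
    (ha : IsSystemOfParameters a) (T : Finset (Fin d)) {i : Fin d} (hi : i ∉ T) {y : M}
    (hy : a i • y ∈ (Ideal.span (a '' T) • ⊤ : Submodule A M)) :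
    y ∈ (Ideal.span (a '' T) • ⊤ : Submodule A M) := by
  have hlen : (T.toList ++ i :: ((insert i T)ᶜ).toList).length = d := by
    have h1 : (insert i T).card + ((insert i T)ᶜ).card = d := by
      rw [Finset.card_add_card_compl, Fintype.card_fin]
    rw [Finset.card_insert_of_notMem hi] at h1
    simp only [List.length_append, List.length_cons, Finset.length_toList]
    omega
  have hmem : ∀ j, j ∈ T.toList ++ i :: ((insert i T)ᶜ).toList := by
    intro j
    simp only [List.mem_append, Finset.mem_toList, List.mem_cons, Finset.mem_compl,
      Finset.mem_insert]
    tauto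
  have h := (hM.isRegular ha hlen hmem).toIsWeaklyRegular
  rw [List.map_append, isWeaklyRegular_append_iff, List.map_cons, isWeaklyRegular_cons_iff] at h
  have hspan : Ideal.ofList (T.toList.map a) = Ideal.span (a '' T) := by
    refine congrArg Ideal.span (Set.ext fun x => ?_)
    simp
  rw [hspan] at h
  have := h.2.1 (a₁ := Submodule.Quotient.mk y) (a₂ := 0) (by
    change a i • Submodule.Quotient.mk y = a i • 0
    rw [smul_zero, ← Submodule.Quotient.mk_smul]
    exact (Submodule.Quotient.mk_eq_zero _).mpr hy)
  exact (Submodule.Quotient.mk_eq_zero _).mp this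

theorem IsMaximalCohenMacaulay.isPermutablyRegular (hA : IsMaximalCohenMacaulay A A)
    (ha : IsSystemOfParameters a) : IsPermutablyRegular a := by
  intro T i hi y hy
  have := hA.mem_smul_top_of_smul_mem ha T hi (y := y)
  simp only [smul_eq_mul, Ideal.mul_top] at this
  exact this hy

theorem IsMaximalCohenMacaulay.mem_mul_of_mul_mem {I : Ideal A} (hI : IsMaximalCohenMacaulay A I)
    (ha : IsSystemOfParameters a) (T : Finset (Fin d)) {i : Fin d} (hi : i ∉ T) {y : A}
    (hyI : y ∈ I) (hy : a i * y ∈ Ideal.span (a '' T) * I) : y ∈ Ideal.span (a '' T) * I := by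
  have := hI.mem_smul_top_of_smul_mem ha T hi (y := ⟨y, hyI⟩)
  rw [Submodule.mem_smul_top_iff, Submodule.mem_smul_top_iff] at this
  exact this hy

end SystemsOfParameters

end

section

open IsLocalRing RingTheory.Sequence CategoryTheory Abelian Pointwise

/-! ### Canonical ideals and parameters: recognizing I = (a_1) -/

section CanonicalIdeals

universe u

variable {A : Type u} [CommRing A] [IsLocalRing A] [IsNoetherianRing A] {d : ℕ} {a : Fin d → A}

section Module

variable {M : Type u} [AddCommGroup M] [Module A M] [Module.Finite A M]

theorem le_annihilator_quotient_smul_top {A M : Type*} [CommRing A] [AddCommGroup M] [Module A M]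
    (Q : Ideal A) :
    Q ≤ Module.annihilator A (M ⧸ (Q • ⊤ : Submodule A M)) := by
  intro x hx
  rw [Module.mem_annihilator]
  intro e
  obtain ⟨e, rfl⟩ := Submodule.Quotient.mk_surjective _ e
  rw [← Submodule.Quotient.mk_smul, Submodule.Quotient.mk_eq_zero]
  exact Submodule.smul_mem_smul hx trivial

theorem ofList_map_finRange {A : Type*} [CommRing A] (a : Fin d → A) :
    Ideal.ofList ((List.finRange d).map a) = Ideal.span (Set.range a) := by
  refine congrArg Ideal.span (Set.ext fun x => ?_)
  simp

theorem IsMaximalCohenMacaulay.extLength_eq (hM : IsMaximalCohenMacaulay A M)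
    (ha : IsSystemOfParameters a) :
    extLength A M d = Module.length A
      (ResidueField A →ₗ[A] M ⧸ (Ideal.span (Set.range a) • ⊤ : Submodule A M)) := by
  have h := extLength_eq_length_linearMap
    (hM.isRegular ha (List.length_finRange (n := d)) List.mem_finRange) (by
      intro x hx
      obtain ⟨i, -, rfl⟩ := List.mem_map.mp hx
      exact ha.mem_maximalIdeal i)
  rwa [ofList_map_finRange, List.length_map, List.length_finRange] at h

theorem IsMaximalCohenMacaulay.isInjectiveModulo (hA : IsMaximalCohenMacaulay A A)
    (hM : IsMaximalCohenMacaulay A M) (ha : IsSystemOfParameters a) {n : ℕ}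
    (hn : HasInjectiveDimensionLE (ModuleCat.of A M) n) :
    IsInjectiveModulo (Ideal.span (Set.range a))
      (M ⧸ (Ideal.span (Set.range a) • ⊤ : Submodule A M)) := by
  intro N N' _ _ _ _ hN' hann i hi
  obtain ⟨k, hk⟩ := ha.exists_pow_le
  rw [← ofList_map_finRange] at hann hk ⊢
  exact exists_extension_of_hasInjectiveDimensionLE
    (hA.isRegular ha (List.length_finRange (n := d)) List.mem_finRange)
    (hM.isRegular ha (List.length_finRange (n := d)) List.mem_finRange) hk hn hN' hann i hi

end Module

theorem cmType_eq (hA : IsMaximalCohenMacaulay A A) (ha : IsSystemOfParameters a) :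
    (cmType A d : ℕ∞) = Module.length A (ResidueField A →ₗ[A] A ⧸ Ideal.span (Set.range a)) := by
  obtain ⟨k, hk⟩ := ha.exists_pow_le
  have h := hA.extLength_eq ha
  rw [smul_eq_mul, Ideal.mul_top] at h
  rw [← h, cmType, ENat.natCast_toNat]
  rw [h]
  exact length_linearMap_residueField_quotient_ne_top hk

theorem one_le_cmType (hA : IsMaximalCohenMacaulay A A) (ha : IsSystemOfParameters a) :
    1 ≤ cmType A d := by
  obtain ⟨k, hk⟩ := ha.exists_pow_le
  have h := length_linearMap_residueField_quotient_ne_zero hk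
    (ne_top_of_le_ne_top (IsLocalRing.maximalIdeal.isMaximal A).ne_top ha.span_le)
  rw [← cmType_eq hA ha] at h
  exact Nat.one_le_iff_ne_zero.mpr (by exact_mod_cast h)

variable {I : Ideal A}

/-- The type of `A` is the minimal number of generators of a canonical ideal. -/
theorem IsCanonicalIdeal.cmType_eq (hI : IsCanonicalIdeal d I) (hA : IsMaximalCohenMacaulay A A)
    (ha : IsSystemOfParameters a) :
    (cmType A d : ℕ∞) = Module.length A (I ⧸ (maximalIdeal A • ⊤ : Submodule A I)) := by
  obtain ⟨-, hfin, hM, hsoc, n, hn⟩ := hI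
  obtain ⟨k, hk⟩ := ha.exists_pow_le
  rw [hM.extLength_eq ha] at hsoc
  rw [_root_.cmType_eq hA ha, (hA.isInjectiveModulo hM ha hn).length_socle_eq hk
    (le_annihilator_quotient_smul_top _) hsoc]
  -- As Q ⊆ 𝔪, reducing I/QI modulo 𝔪 gives I/𝔪I.
  have hle : (Ideal.span (Set.range a) • ⊤ : Submodule A I) ≤ maximalIdeal A • ⊤ :=
    Submodule.smul_mono_left ha.span_le
  have h := (Submodule.quotientQuotientEquivQuotient _ _ hle).length_eq
  rwa [Submodule.map_smul'', Submodule.map_top, Submodule.range_mkQ] at h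

theorem IsMaximalCohenMacaulay.isSMulRegular (hA : IsMaximalCohenMacaulay A A)
    (ha : IsSystemOfParameters a) (i : Fin d) : IsSMulRegular A (a i) := by
  rw [isSMulRegular_iff_right_eq_zero_of_smul]
  intro y hy
  have := hA.isPermutablyRegular ha ∅ i (Finset.notMem_empty i) y (by
    rw [← smul_eq_mul, hy]; exact zero_mem _)
  simpa using this

section Parameter

variable {i₀ : Fin d}

/-- The ideal generated by all members but one of a family. -/
def spanErase {A : Type*} [CommRing A] (a : Fin d → A) (i₀ : Fin d) : Ideal A :=
  Ideal.span (a '' (Finset.univ.erase i₀ : Finset (Fin d)))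

theorem span_singleton_sup_spanErase {A : Type*} [CommRing A] (a : Fin d → A)
    (i₀ : Fin d) :
    Ideal.span {a i₀} ⊔ spanErase a i₀ = Ideal.span (Set.range a) := by
  rw [spanErase, ← Ideal.span_insert, ← Set.image_univ, ← Set.image_insert_eq, ← Finset.coe_insert,
    Finset.insert_erase (Finset.mem_univ _), Finset.coe_univ]

theorem spanErase_le {A : Type*} [CommRing A] (a : Fin d → A) (i₀ : Fin d) :
    spanErase a i₀ ≤ Ideal.span (Set.range a) :=
  Ideal.span_mono (Set.image_subset_range _ _)

theorem IsCanonicalIdeal.mem_spanErase_mul (hI : IsCanonicalIdeal d I)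
    (ha : IsSystemOfParameters a) {y : A} (hy : y ∈ I) (h : a i₀ * y ∈ spanErase a i₀ * I) :
    y ∈ spanErase a i₀ * I :=
  hI.2.2.1.mem_mul_of_mul_mem ha _ (Finset.notMem_erase i₀ _) hy h

/-- For x ∈ I ∩ Q' the product a_1 x lies in Q'I because a_1 ∈ I; now cancel a_1, which is regular
on I/Q'I. -/
theorem IsCanonicalIdeal.inf_spanErase_le (hI : IsCanonicalIdeal d I)
    (ha : IsSystemOfParameters a) (h₀ : a i₀ ∈ I) : I ⊓ spanErase a i₀ ≤ spanErase a i₀ * I := by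
  rintro x ⟨hxI, hx⟩
  refine hI.mem_spanErase_mul ha hxI ?_
  rw [mul_comm]
  exact Ideal.mul_mem_mul h₀ hx

theorem IsCanonicalIdeal.inf_span_le (hI : IsCanonicalIdeal d I)
    (ha : IsSystemOfParameters a) (h₀ : a i₀ ∈ I) :
    I ⊓ Ideal.span (Set.range a) ≤ Ideal.span {a i₀} ⊔ spanErase a i₀ * I := by
  rintro x ⟨hxI, hx⟩
  rw [SetLike.mem_coe, ← span_singleton_sup_spanErase a i₀] at hx
  obtain ⟨y, hy, w, hw, rfl⟩ := Submodule.mem_sup.mp hx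
  refine add_mem (Ideal.mem_sup_left hy) (Ideal.mem_sup_right (hI.inf_spanErase_le ha h₀ ⟨?_, hw⟩))
  exact (Ideal.add_mem_iff_right _ ((Ideal.span_singleton_le_iff_mem _).mpr h₀ hy)).mp hxI

/-- Write QJ = QI + a_1 Q + Q'Q. The first two summands lie in QI, and what is left lies in I ∩ Q' ⊆
Q'I. -/
theorem IsCanonicalIdeal.inf_mul_le (hI : IsCanonicalIdeal d I)
    (ha : IsSystemOfParameters a) (h₀ : a i₀ ∈ I) :
    I ⊓ Ideal.span (Set.range a) * (I ⊔ Ideal.span (Set.range a)) ≤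
      Ideal.span (Set.range a) * I := by
  rintro x ⟨hxI, hx⟩
  rw [SetLike.mem_coe, Ideal.mul_sup] at hx
  obtain ⟨u, hu, v, hv, rfl⟩ := Submodule.mem_sup.mp hx
  refine add_mem hu ?_
  have hvI : v ∈ I := (Ideal.add_mem_iff_right _ (Ideal.mul_le_right hu)).mp hxI
  nth_rw 1 [← span_singleton_sup_spanErase a i₀] at hv
  rw [Ideal.sup_mul] at hv
  obtain ⟨s, hs, w, hw, rfl⟩ := Submodule.mem_sup.mp hv
  have hs' : s ∈ Ideal.span (Set.range a) * I := by
    rw [mul_comm]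
    exact Ideal.mul_mono_left ((Ideal.span_singleton_le_iff_mem _).mpr h₀) hs
  have hwI : w ∈ I := (Ideal.add_mem_iff_right _ (Ideal.mul_le_right hs')).mp hvI
  exact add_mem hs' (Ideal.mul_mono_left (spanErase_le a i₀)
    (hI.inf_spanErase_le ha h₀ ⟨hwI, Ideal.mul_le_left hw⟩))

/-- If a_1 = a_1 y + w with y ∈ I and w ∈ Q', then a_1(1 - y) ∈ Q' with 1 - y a unit. Regularity of
a_1 modulo Q' would put this unit in Q'. -/
theorem IsCanonicalIdeal.notMem_span_mul (hI : IsCanonicalIdeal d I)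
    (hA : IsMaximalCohenMacaulay A A) (ha : IsSystemOfParameters a) :
    a i₀ ∉ Ideal.span (Set.range a) * I := by
  intro h
  rw [← span_singleton_sup_spanErase a i₀, Ideal.sup_mul] at h
  obtain ⟨s, hs, w, hw, hsw⟩ := Submodule.mem_sup.mp h
  obtain ⟨y, hy, rfl⟩ := Ideal.mem_span_singleton_mul.mp hs
  have hu : IsUnit (1 - y) := by
    by_contra hu
    have h1 : (1 - y) + y ∈ maximalIdeal A := add_mem ((IsLocalRing.mem_maximalIdeal _).mpr hu)
      (IsLocalRing.le_maximalIdeal hI.1 hy)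
    rw [sub_add_cancel] at h1
    exact (Ideal.ne_top_iff_one _).mp (IsLocalRing.maximalIdeal.isMaximal A).ne_top h1
  have h2 : a i₀ * (1 - y) ∈ spanErase a i₀ := by
    rw [mul_sub, mul_one, sub_eq_iff_eq_add'.mpr hsw.symm]
    exact Ideal.mul_le_left hw
  have h3 := hA.isPermutablyRegular ha _ _ (Finset.notMem_erase i₀ _) _ h2
  have h4 := Ideal.eq_top_of_isUnit_mem _ h3 hu
  exact ne_top_of_le_ne_top (IsLocalRing.maximalIdeal.isMaximal A).ne_top
    ((spanErase_le a i₀).trans ha.span_le) h4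

theorem eq_span_singleton_of_le_sup_span_mul
    (ha : IsSystemOfParameters a) (h₀ : a i₀ ∈ I)
    (h : I ≤ Ideal.span {a i₀} ⊔ Ideal.span (Set.range a) * I) : I = Ideal.span {a i₀} := by
  refine le_antisymm ?_ ((Ideal.span_singleton_le_iff_mem _).mpr h₀)
  refine Submodule.le_of_le_smul_of_le_jacobson_bot (IsNoetherian.noetherian _)
    (IsLocalRing.jacobson_eq_maximalIdeal (⊥ : Ideal A) bot_ne_top).ge (h.trans ?_)
  exact sup_le_sup_left (Ideal.mul_mono_left ha.span_le) _

theorem IsCanonicalIdeal.eq_span_singleton_of_sup_eq (hI : IsCanonicalIdeal d I)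
    (ha : IsSystemOfParameters a) (h₀ : a i₀ ∈ I)
    (h : I ⊔ Ideal.span (Set.range a) = Ideal.span (Set.range a)) : I = Ideal.span {a i₀} := by
  refine eq_span_singleton_of_le_sup_span_mul ha h₀ ?_
  exact (le_inf le_rfl (sup_eq_right.mp h)).trans ((hI.inf_span_le ha h₀).trans
    (sup_le_sup_left (Ideal.mul_mono_left (spanErase_le a i₀)) _))

/-- The fraction y/c is a well-defined endomorphism of V, since c is regular on V and yV ⊆ cV. It
descends to W, where every endomorphism is a scalar. -/
theorem exists_smul_eq_of_forall_endomorphism {A V W : Type*} [CommRing A] [AddCommGroup V] [Module A V]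
    [AddCommGroup W] [Module A W] {Q : Ideal A} (π : V →ₗ[A] W) (hπ : Function.Surjective π)
    (hker : LinearMap.ker π ≤ Q • ⊤) (hann : Q ≤ Module.annihilator A W)
    (hend : ∀ φ : W →ₗ[A] W, ∃ b : A, ∀ w, φ w = b • w) {c y : A} (hc : IsSMulRegular V c)
    (hrange : ∀ v : V, ∃ v' : V, c • v' = y • v) {v₀ v₁ : V} (h : c • v₁ = y • v₀) :
    ∃ b : A, π v₁ = b • π v₀ := by
  choose f hf using hrange
  let φ : V →ₗ[A] V :=
    { toFun := f
      map_add' := fun v w => hc (by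
        change c • _ = c • _
        rw [smul_add, hf, hf, hf, smul_add])
      map_smul' := fun r v => hc (by
        change c • _ = c • _
        rw [hf, RingHom.id_apply, smul_comm c r, hf, smul_comm]) }
  have hk : LinearMap.ker π ≤ LinearMap.ker (π ∘ₗ φ) := by
    refine hker.trans (Submodule.smul_le.mpr fun q hq z _ => ?_)
    rw [LinearMap.mem_ker, map_smul]
    exact Module.mem_annihilator.mp (hann hq) _
  obtain ⟨b, hb⟩ := hend (((LinearMap.ker π).liftQ _ hk) ∘ₗ
    (π.quotKerEquivOfSurjective hπ).symm.toLinearMap)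
  refine ⟨b, ?_⟩
  rw [← hb]
  have h1 : (π.quotKerEquivOfSurjective hπ).symm (π v₀) = Submodule.Quotient.mk v₀ := by
    rw [LinearEquiv.symm_apply_eq]
    rfl
  rw [LinearMap.comp_apply, LinearEquiv.coe_coe, h1, Submodule.liftQ_apply]
  have h2 : f v₀ = v₁ := hc ((hf v₀).trans h.symm)
  exact congrArg π h2.symm

/-- The fraction lemma is applied to V = I/Q'I, W = I/QI and c = a_1. It evaluates y/a_1 at the
class of a_1, giving y ≡ b a_1 modulo QI for every y ∈ I. -/
theorem IsCanonicalIdeal.eq_span_singleton_of_sq_le (hI : IsCanonicalIdeal d I)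
    (hA : IsMaximalCohenMacaulay A A) (ha : IsSystemOfParameters a) (h₀ : a i₀ ∈ I)
    (h : (I ⊔ Ideal.span (Set.range a)) ^ 2 ≤
      Ideal.span (Set.range a) * (I ⊔ Ideal.span (Set.range a))) : I = Ideal.span {a i₀} := by
  obtain ⟨-, hfin, hM, hsoc, n, hn⟩ := id hI
  obtain ⟨k, hk⟩ := ha.exists_pow_le
  rw [hM.extLength_eq ha] at hsoc
  set Q := Ideal.span (Set.range a) with hQ
  -- From I² ⊆ QJ the intersection formula gives I² ⊆ QI. Modulo Q'I this says that yV ⊆ a_1 V for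
  -- every y ∈ I.
  have hsq : I * I ≤ Ideal.span {a i₀} * I ⊔ spanErase a i₀ * I := by
    rw [← Ideal.sup_mul, span_singleton_sup_spanErase]
    refine le_trans (le_inf Ideal.mul_le_right ?_) (hI.inf_mul_le ha h₀)
    rw [← sq]
    exact (Ideal.pow_right_mono le_sup_left 2).trans h
  refine eq_span_singleton_of_le_sup_span_mul ha h₀ fun y hy => ?_
  have hle : (spanErase a i₀ • ⊤ : Submodule A I) ≤ Q • ⊤ :=
    Submodule.smul_mono_left (spanErase_le a i₀)
  have hinj : IsSMulRegular (I ⧸ (spanErase a i₀ • ⊤ : Submodule A I)) (a i₀) := by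
    rw [isSMulRegular_iff_right_eq_zero_of_smul]
    intro v hv
    obtain ⟨v, rfl⟩ := Submodule.Quotient.mk_surjective _ v
    rw [← Submodule.Quotient.mk_smul, Submodule.Quotient.mk_eq_zero,
      Submodule.mem_smul_top_iff] at hv
    rw [Submodule.Quotient.mk_eq_zero, Submodule.mem_smul_top_iff]
    exact hI.mem_spanErase_mul ha v.2 hv
  obtain ⟨b, hb⟩ := exists_smul_eq_of_forall_endomorphism (Submodule.factor hle)
    (Submodule.factor_surjective hle) (Q := Q) (c := a i₀) (y := y)
    (v₀ := Submodule.Quotient.mk ⟨a i₀, h₀⟩) (v₁ := Submodule.Quotient.mk ⟨y, hy⟩)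
    (fun v hv => by
      obtain ⟨v, rfl⟩ := Submodule.Quotient.mk_surjective _ v
      have hv' : v ∈ (Q • ⊤ : Submodule A I) := (Submodule.Quotient.mk_eq_zero _).mp hv
      have := Submodule.mem_map_of_mem (f := Submodule.mkQ (spanErase a i₀ • ⊤)) hv'
      rwa [Submodule.map_smul'', Submodule.map_top, Submodule.range_mkQ] at this)
    (le_annihilator_quotient_smul_top _)
    ((hA.isInjectiveModulo hM ha hn).exists_smul_eq hk (le_annihilator_quotient_smul_top _) hsoc)
    hinj (fun v => by
      obtain ⟨z, rfl⟩ := Submodule.Quotient.mk_surjective _ v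
      obtain ⟨s, hs, w, hw, hsw⟩ := Submodule.mem_sup.mp (hsq (Ideal.mul_mem_mul hy z.2))
      obtain ⟨z', hz', rfl⟩ := Ideal.mem_span_singleton_mul.mp hs
      refine ⟨Submodule.Quotient.mk ⟨z', hz'⟩, ?_⟩
      rw [← Submodule.Quotient.mk_smul, ← Submodule.Quotient.mk_smul, eq_comm,
        Submodule.Quotient.eq, Submodule.mem_smul_top_iff]
      change y * z - a i₀ * z' ∈ _
      rwa [← hsw, add_sub_cancel_left])
    (by
      rw [← Submodule.Quotient.mk_smul, ← Submodule.Quotient.mk_smul]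
      exact congrArg _ (Subtype.ext (mul_comm _ _)))
  have h2 : (Submodule.Quotient.mk ⟨y, hy⟩ : I ⧸ (Q • ⊤ : Submodule A I)) =
      Submodule.Quotient.mk (b • ⟨a i₀, h₀⟩) := hb
  rw [Submodule.Quotient.eq, Submodule.mem_smul_top_iff] at h2
  have h3 : y - b * a i₀ ∈ Q * I := h2
  rw [← sub_add_cancel y (b * a i₀)]
  exact add_mem (Ideal.mem_sup_right h3)
    (Ideal.mem_sup_left (Ideal.mul_mem_left _ _ (Ideal.mem_span_singleton_self _)))

/-- `ℓ(A/J) + r(A) ≤ ℓ(A/Q) + 1`. -/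
theorem IsCanonicalIdeal.length_quotient_add_cmType_le (hI : IsCanonicalIdeal d I)
    (hA : IsMaximalCohenMacaulay A A) (ha : IsSystemOfParameters a) (h₀ : a i₀ ∈ I) :
    Module.length A (A ⧸ (I ⊔ Ideal.span (Set.range a))) + cmType A d ≤
      Module.length A (A ⧸ Ideal.span (Set.range a)) + 1 := by
  set Q := Ideal.span (Set.range a) with hQ
  let x₀ : I := ⟨a i₀, h₀⟩
  let N : Submodule A I := Submodule.span A {x₀} ⊔ maximalIdeal A • ⊤
  -- ℓ(A/Q) - ℓ(A/J) is the length of I/(I ∩ Q). This quotient maps onto I/((a_1) + 𝔪I), whose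
  -- length is at least r(A) - 1 because r(A) = ℓ(I/𝔪I).
  have h1 := Module.length_quotient_eq_add_of_comap_eq (Submodule.subtype I) (N := Q) rfl
  rw [Submodule.range_subtype] at h1
  have h2 : Module.length A (I ⧸ N) ≤ Module.length A (I ⧸ Submodule.comap I.subtype Q) := by
    refine Module.length_quotient_mono fun z hz => ?_
    obtain ⟨s, hs, w, hw, hsw⟩ := Submodule.mem_sup.mp (hI.inf_span_le ha h₀ ⟨z.2, hz⟩)
    obtain ⟨c, rfl⟩ := Ideal.mem_span_singleton'.mp hs
    have hwI : w ∈ I := Ideal.mul_le_right hw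
    have hz' : z = c • x₀ + ⟨w, hwI⟩ := Subtype.ext hsw.symm
    rw [hz']
    refine add_mem (Submodule.mem_sup_left (Submodule.smul_mem _ _
      (Submodule.mem_span_singleton_self _))) (Submodule.mem_sup_right ?_)
    rw [Submodule.mem_smul_top_iff]
    exact Ideal.mul_mono_left ((spanErase_le a i₀).trans ha.span_le) hw
  have h3 := Module.length_quotient_eq_add_of_comap_eq (LinearMap.toSpanSingleton A I x₀)
    (N := maximalIdeal A • ⊤) rfl
  have h4 : Module.length A (A ⧸ Submodule.comap (LinearMap.toSpanSingleton A I x₀)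
      (maximalIdeal A • ⊤)) ≤ 1 := by
    have h5 : Module.length A (A ⧸ maximalIdeal A) = 1 := by
      rw [Module.length_eq_one_iff, isSimpleModule_iff_isCoatom]
      exact (IsLocalRing.maximalIdeal.isMaximal A).out
    rw [← h5]
    exact Module.length_quotient_mono fun c hc => Submodule.smul_mem_smul hc trivial
  rw [← LinearMap.span_singleton_eq_range, ← hI.cmType_eq hA ha] at h3
  rw [h1, h3]
  calc _ ≤ _ + (1 + Module.length A (I ⧸ Submodule.comap I.subtype Q)) := by gcongr
    _ = _ := by ring

theorem hasInjectiveDimensionLE_of_linearEquiv {A M N : Type u} [CommRing A] [AddCommGroup M] [Module A M]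
    [AddCommGroup N] [Module A N] (e : M ≃ₗ[A] N) {n : ℕ}
    (h : HasInjectiveDimensionLE (ModuleCat.of A M) n) :
    HasInjectiveDimensionLE (ModuleCat.of A N) n :=
  hasInjectiveDimensionLT_of_iso e.toModuleIso (n + 1)

theorem IsSMulRegular.nonempty_linearEquiv_span_singleton {A : Type*} [CommRing A] {x : A}
    (hx : IsSMulRegular A x) :
    Nonempty (A ≃ₗ[A] Ideal.span {x}) := by
  refine ⟨(LinearEquiv.ofInjective (LinearMap.toSpanSingleton A A x) fun y z hyz => ?_).trans
    (LinearEquiv.ofEq _ _ (LinearMap.span_singleton_eq_range A A x).symm)⟩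
  exact hx (by simpa [mul_comm] using hyz)

theorem IsCanonicalIdeal.isGorensteinLocalRing (hI : IsCanonicalIdeal d I)
    (hA : IsMaximalCohenMacaulay A A) (ha : IsSystemOfParameters a)
    (h : I = Ideal.span {a i₀}) : IsGorensteinLocalRing A := by
  obtain ⟨-, -, -, -, n, hn⟩ := hI
  subst h
  obtain ⟨e⟩ := (hA.isSMulRegular ha i₀).nonempty_linearEquiv_span_singleton
  exact ⟨inferInstance, n, hasInjectiveDimensionLE_of_linearEquiv e.symm hn⟩

/-- Finite injective dimension makes A/Q injective over itself, so r(A) = 1, I/𝔪I is simple, and I =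
(x) by Nakayama. Regularity of x amounts to faithfulness of I. -/
theorem IsCanonicalIdeal.exists_eq_span_singleton (hI : IsCanonicalIdeal d I)
    (hA : IsMaximalCohenMacaulay A A) (hdim : ringKrullDim A = d) (hG : IsGorensteinLocalRing A) :
    ∃ x, IsSMulRegular A x ∧ I = Ideal.span {x} := by
  obtain ⟨-, m, hm⟩ := hG
  obtain ⟨a, ha⟩ := exists_isSystemOfParameters hdim
  have hr : cmType A d = 1 := by
    obtain ⟨k, hk⟩ := ha.exists_pow_le
    have hE := hA.isInjectiveModulo hA ha hm
    rw [smul_eq_mul, Ideal.mul_top] at hE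
    have h := hE.length_socle_self_eq_one hk
      (ne_top_of_le_ne_top (IsLocalRing.maximalIdeal.isMaximal A).ne_top ha.span_le)
    rw [← _root_.cmType_eq hA ha] at h
    exact_mod_cast h
  have hsimple := hI.cmType_eq hA ha
  rw [hr, Nat.cast_one, eq_comm, Module.length_eq_one_iff] at hsimple
  have := hsimple.nontrivial
  obtain ⟨v, hv⟩ := exists_ne (0 : I ⧸ (maximalIdeal A • ⊤ : Submodule A I))
  have hspan := IsSimpleModule.span_singleton_eq_top A hv
  obtain ⟨⟨x, hxI⟩, rfl⟩ := Submodule.Quotient.mk_surjective _ v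
  have hIx : I = Ideal.span {x} := by
    refine le_antisymm ?_ ((Ideal.span_singleton_le_iff_mem _).mpr hxI)
    refine Submodule.le_of_le_smul_of_le_jacobson_bot (IsNoetherian.noetherian _)
      (IsLocalRing.jacobson_eq_maximalIdeal (⊥ : Ideal A) bot_ne_top).ge fun y hy => ?_
    obtain ⟨c, hc⟩ := Submodule.mem_span_singleton.mp (hspan ▸ Submodule.mem_top :
      (Submodule.Quotient.mk ⟨y, hy⟩ : I ⧸ (maximalIdeal A • ⊤ : Submodule A I)) ∈ _)
    rw [← Submodule.Quotient.mk_smul, eq_comm, Submodule.Quotient.eq,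
      Submodule.mem_smul_top_iff] at hc
    have hc' : y - c * x ∈ maximalIdeal A • I := hc
    rw [← sub_add_cancel y (c * x)]
    exact add_mem (Submodule.mem_sup_right hc')
      (Submodule.mem_sup_left (Ideal.mul_mem_left _ _ (Ideal.mem_span_singleton_self _)))
  refine ⟨x, ?_, hIx⟩
  rw [isSMulRegular_iff_right_eq_zero_of_smul]
  intro y hy
  have hyI : ∀ z ∈ I, y * z = 0 := by
    intro z hz
    rw [hIx, Ideal.mem_span_singleton'] at hz
    obtain ⟨c, rfl⟩ := hz
    rw [mul_left_comm, mul_comm y x, ← smul_eq_mul x y, hy, mul_zero]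
  obtain ⟨-, hfin, hM, hsoc, n, hn⟩ := hI
  -- An element killing I also kills I/Q_i I for the parameter ideal Q_i of (i+1)-st powers, and the
  -- annihilator of that module is Q_i ⊆ 𝔪^i. Krull's intersection theorem then gives y = 0.
  have hmem : y ∈ ⨅ i, maximalIdeal A ^ i := by
    refine Ideal.mem_iInf.mpr fun i => ?_
    have hb := ha.pow (Nat.succ_ne_zero i)
    obtain ⟨k, hk⟩ := hb.exists_pow_le
    have hs := hsoc
    rw [hM.extLength_eq hb] at hs
    have hann := (hA.isInjectiveModulo hM hb hn).annihilator_eq hk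
      (le_annihilator_quotient_smul_top _) hs
    have hy' : y ∈ Ideal.span (Set.range fun j => a j ^ (i + 1)) := by
      rw [← hann, Module.mem_annihilator]
      intro e
      obtain ⟨z, rfl⟩ := Submodule.Quotient.mk_surjective _ e
      rw [← Submodule.Quotient.mk_smul]
      have : y • z = 0 := Subtype.ext (hyI z z.2)
      rw [this, Submodule.Quotient.mk_zero]
    refine Ideal.span_le.mpr ?_ hy'
    rintro _ ⟨j, rfl⟩
    exact Ideal.pow_le_pow_right (Nat.le_succ i) (Ideal.pow_mem_pow (ha.mem_maximalIdeal j) _)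
  rwa [Ideal.iInf_pow_eq_bot_of_isLocalRing _ (IsLocalRing.maximalIdeal.isMaximal A).ne_top,
    Ideal.mem_bot] at hmem

theorem IsCanonicalIdeal.cmType_eq_one (hI : IsCanonicalIdeal d I)
    (hA : IsMaximalCohenMacaulay A A) (ha : IsSystemOfParameters a) (h₀ : a i₀ ∈ I)
    (h : I = Ideal.span {a i₀}) : cmType A d = 1 := by
  refine le_antisymm ?_ (one_le_cmType hA ha)
  have h1 := hI.length_quotient_add_cmType_le hA ha h₀
  obtain ⟨k, hk⟩ := ha.exists_pow_le
  have h2 := Module.length_ne_top_iff.mpr (isFiniteLength_quotient_of_pow_le hk)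
  have h3 : I ⊔ Ideal.span (Set.range a) = Ideal.span (Set.range a) := by
    rw [sup_eq_right, h, Ideal.span_singleton_le_iff_mem]
    exact Ideal.subset_span ⟨i₀, rfl⟩
  rw [h3] at h1
  have := (ENat.add_le_add_iff_left h2).mp h1
  exact_mod_cast this

end Parameter

end CanonicalIdeals

end

section

open IsLocalRing

/-! ### The Rees algebra as an image of a polynomial ring -/

section ReesEval

open MvPolynomial

variable {A : Type*} [CommRing A] {d : ℕ}

/-- The homomorphism `A[X_1, …, X_d] → A[Jt]` with `X_i ↦ a_i t`. -/
noncomputable def reesEval (a : Fin d → A) {J : Ideal A} (h : ∀ i, a i ∈ J) :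
    MvPolynomial (Fin d) A →ₐ[A] reesAlgebra J :=
  aeval fun i => ⟨Polynomial.monomial 1 (a i),
    reesAlgebra.monomial_mem.mpr (by rw [pow_one]; exact h i)⟩

theorem coeff_reesEval (a : Fin d → A) {J : Ideal A} (h : ∀ i, a i ∈ J)
    (F : MvPolynomial (Fin d) A) (n : ℕ) :
    (reesEval a h F : Polynomial A).coeff n = eval a (homogeneousComponent n F) := by
  have h1 : (reesEval a h F : Polynomial A) = aeval (fun i => Polynomial.monomial 1 (a i)) F := by
    rw [reesEval, ← Subalgebra.coe_val, ← AlgHom.comp_apply, comp_aeval]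
    rfl
  have h2 : ∀ m : Fin d →₀ ℕ, ∏ i ∈ m.support, (Polynomial.monomial 1 (a i)) ^ m i =
      Polynomial.monomial m.degree (∏ i ∈ m.support, a i ^ m i) := by
    intro m
    simp_rw [Polynomial.monomial_pow, one_mul, ← Polynomial.C_mul_X_pow_eq_monomial]
    rw [Finset.prod_mul_distrib, Finset.prod_pow_eq_pow_sum, map_prod, Finsupp.degree_apply]
  rw [h1, aeval_def, eval₂_eq, Polynomial.finsetSum_coeff, homogeneousComponent_apply, map_sum,
    Finset.sum_filter]
  refine Finset.sum_congr rfl fun m _ => ?_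
  rw [h2, Polynomial.algebraMap_apply, Algebra.algebraMap_self_apply, Polynomial.coeff_C_mul,
    Polynomial.coeff_monomial]
  split_ifs
  · rw [eval_monomial]
    rfl
  · rw [mul_zero]

theorem IsFormOver.coe_reesEval (a : Fin d → A) {J : Ideal A} (h : ∀ i, a i ∈ J)
    {F : MvPolynomial (Fin d) A} {n : ℕ} (hF : IsFormOver ⊤ Finset.univ n F) :
    (reesEval a h F : Polynomial A) = Polynomial.monomial n (eval a F) := by
  ext k
  rw [coeff_reesEval, homogeneousComponent_of_mem ((mem_homogeneousSubmodule _ _).mpr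
    hF.isHomogeneous), Polynomial.coeff_monomial]
  simp only [eq_comm]
  split_ifs <;> simp

theorem reesEval_surjective (a : Fin d → A) (h : ∀ i, a i ∈ Ideal.span (Set.range a)) :
    Function.Surjective (reesEval a h) := by
  rintro ⟨f, hf⟩
  have hex : ∀ n, ∃ F : MvPolynomial (Fin d) A, IsFormOver ⊤ Finset.univ n F ∧
      eval a F = f.coeff n := fun n =>
    exists_isFormOver_univ a (L := ⊤) (by simpa using hf n)
  choose F hF he using hex
  refine ⟨∑ n ∈ f.support, F n, Subtype.ext ?_⟩
  rw [map_sum, AddSubmonoidClass.coe_finsetSum]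
  refine Eq.trans ?_ f.as_sum_support.symm
  exact Finset.sum_congr rfl fun n _ => by rw [(hF n).coe_reesEval, he]

theorem isFormOver_homogeneousComponent (F : MvPolynomial (Fin d) A) (n : ℕ) :
    IsFormOver ⊤ Finset.univ n (homogeneousComponent n F) :=
  .of_isHomogeneous (homogeneousComponent_isHomogeneous n F) fun _ => trivial

/-- Quasi-regularity applied to each homogeneous component of F. -/
theorem IsPermutablyRegular.mem_map_C_of_reesEval {a : Fin d → A} (ha : IsPermutablyRegular a)
    {L : Ideal A} (hL : Ideal.span (Set.range a) ≤ L) {J : Ideal A} (h : ∀ i, a i ∈ J)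
    {F : MvPolynomial (Fin d) A}
    (hF : ∀ n, (reesEval a h F : Polynomial A).coeff n ∈ L * Ideal.span (Set.range a) ^ n) :
    F ∈ L.map (C : A →+* MvPolynomial (Fin d) A) := by
  rw [mem_map_C_iff]
  intro m
  have := hF m.degree
  rw [coeff_reesEval] at this
  have := (ha.isFormOver_of_eval_mem hL (isFormOver_homogeneousComponent F _) this m).1
  rwa [coeff_homogeneousComponent, if_pos rfl] at this

theorem mem_map_algebraMap_reesAlgebra_iff {J L : Ideal A} {f : reesAlgebra J} :
    f ∈ L.map (algebraMap A (reesAlgebra J)) ↔ ∀ n, (f : Polynomial A).coeff n ∈ L * J ^ n := by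
  constructor
  · have h : L.map (algebraMap A (reesAlgebra J)) ≤
        (sallyDenominator L J).comap (Algebra.linearMap (reesAlgebra J) (Polynomial A)) := by
      rw [Ideal.map_le_iff_le_comap]
      intro r hr n
      change (Polynomial.C r).coeff n ∈ _
      rw [Polynomial.coeff_C]
      split_ifs with h
      · simpa [h] using hr
      · exact zero_mem _
    exact fun hf => h hf
  · intro hf
    have hmon : ∀ n, L * J ^ n ≤ Submodule.comap (Polynomial.monomial n : A →ₗ[A] Polynomial A)
        (((L.map (algebraMap A (reesAlgebra J))).restrictScalars A).map
          (reesAlgebra J).val.toLinearMap) := by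
      refine fun n => Ideal.mul_le.mpr fun r hr s hs => ?_
      refine ⟨algebraMap A _ r * ⟨Polynomial.monomial n s, reesAlgebra.monomial_mem.mpr hs⟩,
        Ideal.mul_mem_right _ _ (Ideal.mem_map_of_mem _ hr), ?_⟩
      exact Polynomial.C_mul_monomial
    have hsum : (f : Polynomial A) ∈ ((L.map (algebraMap A (reesAlgebra J))).restrictScalars A).map
        (reesAlgebra J).val.toLinearMap := by
      rw [(f : Polynomial A).as_sum_support]
      exact sum_mem fun n _ => hmon n (hf n)
    obtain ⟨g, hg, hgf⟩ := hsum
    rwa [← Subtype.ext hgf]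

theorem IsPermutablyRegular.ker_reesEval_le {a : Fin d → A} (ha : IsPermutablyRegular a)
    {J : Ideal A} (h : ∀ i, a i ∈ J) :
    RingHom.ker (reesEval a h) ≤
      (Ideal.span (Set.range a)).map (C : A →+* MvPolynomial (Fin d) A) := by
  intro F hF
  refine ha.mem_map_C_of_reesEval le_rfl h fun n => ?_
  rw [(RingHom.mem_ker).mp hF]
  simp

theorem MvPolynomial.isPrime_map_C (p : Ideal A) [p.IsPrime] :
    (p.map (C : A →+* MvPolynomial (Fin d) A)).IsPrime := by
  have h : p.map (C : A →+* MvPolynomial (Fin d) A) =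
      RingHom.ker (MvPolynomial.map (σ := Fin d) (Ideal.Quotient.mk p)) := by
    rw [ker_map, Ideal.mk_ker]
  rw [h]
  exact RingHom.ker_isPrime _

theorem map_C_map_reesEval (a : Fin d → A) {J : Ideal A} (h : ∀ i, a i ∈ J) (L : Ideal A) :
    (L.map (C : A →+* MvPolynomial (Fin d) A)).map (reesEval a h) =
      L.map (algebraMap A (reesAlgebra J)) := by
  rw [← Ideal.map_coe (reesEval a h), Ideal.map_map]
  congr 1
  exact (reesEval a h).comp_algebraMap

/-- The kernel of A[X] → A[Qt] lies in QA[X] ⊆ pA[X], so the prime pA[X] has prime image. For p = 𝔪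
this makes the rank of the Sally module meaningful. -/
theorem IsPermutablyRegular.isPrime_map {a : Fin d → A} (ha : IsPermutablyRegular a)
    (p : Ideal A) [p.IsPrime] (hp : Ideal.span (Set.range a) ≤ p) :
    (p.map (algebraMap A (reesAlgebra (Ideal.span (Set.range a))))).IsPrime := by
  have h : ∀ i, a i ∈ Ideal.span (Set.range a) := fun i => Ideal.subset_span ⟨i, rfl⟩
  have := MvPolynomial.isPrime_map_C (d := d) p
  rw [← map_C_map_reesEval a h]
  exact Ideal.map_isPrime_of_surjective (reesEval_surjective a h)
    ((ha.ker_reesEval_le h).trans (Ideal.map_mono hp))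

end ReesEval

/-! ### Vanishing and rank of the Sally module -/

section Sally

variable {A : Type*} [CommRing A] {J Q : Ideal A}

theorem SubmoduleQuotient.smul_mk_eq_zero_iff {B M : Type*} [Ring B] [AddCommGroup M] [Module B M]
    {N₁ N₂ : Submodule B M} (c : B) (f : N₁) :
    c • SubmoduleQuotient.mk N₁ N₂ f = 0 ↔ c • (f : M) ∈ N₂ := by
  rw [← map_smul]
  exact Submodule.Quotient.mk_eq_zero (N₂.submoduleOf N₁)

theorem subsingleton_sallyModule_iff (h : Q ≤ J) :
    Subsingleton (SallyModule h) ↔ ∀ i, J ^ (i + 1) ≤ J * Q ^ i := by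
  have h1 : Subsingleton (SallyModule h) ↔
      (sallyDenominator J Q).submoduleOf (sallyNumerator h) = ⊤ :=
    Submodule.Quotient.subsingleton_iff
  rw [h1, Submodule.submoduleOf_eq_top]
  constructor
  · intro hle i x hx
    have hmem : Polynomial.monomial i x ∈ sallyNumerator h := by
      intro k
      rw [Polynomial.coeff_monomial]
      split_ifs with hk
      · rwa [← hk]
      · exact zero_mem _
    have := hle hmem i
    rwa [Polynomial.coeff_monomial, if_pos rfl] at this
  · exact fun hle f hf i => hle i (hf i)

theorem subsingleton_sallyModule_of_sq_le (h : Q ≤ J) (hJ : J ^ 2 ≤ Q * J) :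
    Subsingleton (SallyModule h) := by
  rw [subsingleton_sallyModule_iff]
  intro i
  induction i with
  | zero => simp
  | succ i ih =>
    calc J ^ (i + 1 + 1) = J ^ (i + 1) * J := pow_succ _ _
      _ ≤ J * Q ^ i * J := Ideal.mul_mono_left ih
      _ = J ^ 2 * Q ^ i := by ring
      _ ≤ Q * J * Q ^ i := Ideal.mul_mono_left hJ
      _ = J * Q ^ (i + 1) := by ring

theorem sq_le_of_subsingleton_sallyModule (h : Q ≤ J) [Subsingleton (SallyModule h)] :
    J ^ 2 ≤ Q * J := by
  have := (subsingleton_sallyModule_iff h).mp inferInstance 1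
  rwa [pow_one, mul_comm J] at this

theorem sallyGeneratedInDegreeOne_of_subsingleton (h : Q ≤ J) [Subsingleton (SallyModule h)] :
    SallyGeneratedInDegreeOne h :=
  Subsingleton.elim _ _

variable [IsLocalRing A]

theorem sallyRank_eq_zero_of_subsingleton (h : Q ≤ J) [Subsingleton (SallyModule h)]
    (hp : ((maximalIdeal A).map (algebraMap A (reesAlgebra Q))).IsPrime) :
    sallyRank h = 0 := by
  rw [sallyRank, iInf_pos hp, Module.length_eq_zero_iff]
  infer_instance

/-- Rank zero means that every class is killed by some F outside 𝔪T. Some coefficient of F lies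
outside 𝔪Q^n, so it is the value of a form with a unit coefficient, and such forms act injectively
on homogeneous classes. -/
theorem subsingleton_sallyModule_of_sallyRank_eq_zero {d : ℕ} {a : Fin d → A}
    (ha : IsPermutablyRegular a) {N : ℕ} (hN : maximalIdeal A ^ N ≤ Ideal.span (Set.range a))
    (h : Ideal.span (Set.range a) ≤ J) (h0 : sallyRank h = 0) : Subsingleton (SallyModule h) := by
  have hp : ((maximalIdeal A).map (algebraMap A (reesAlgebra (Ideal.span (Set.range a))))).IsPrime := by
    by_contra hp
    rw [sallyRank, iInf_neg hp] at h0
    exact ENat.top_ne_zero h0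
  rw [sallyRank, iInf_pos hp, Module.length_eq_zero_iff] at h0
  rw [subsingleton_sallyModule_iff]
  intro i x hx
  have hmem : Polynomial.monomial i x ∈ sallyNumerator h := by
    intro k
    rw [Polynomial.coeff_monomial]
    split_ifs with hk
    · rwa [← hk]
    · exact zero_mem _
  obtain ⟨F, hF, hFx⟩ := (LocalizedModule.subsingleton_iff.mp h0)
    (SubmoduleQuotient.mk _ (sallyDenominator J _) ⟨_, hmem⟩)
  obtain ⟨n, hn⟩ : ∃ n, (F : Polynomial A).coeff n ∉
      maximalIdeal A * Ideal.span (Set.range a) ^ n := by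
    by_contra! hall
    exact hF (mem_map_algebraMap_reesAlgebra_iff.mpr hall)
  have hden : F • Polynomial.monomial i x ∈ sallyDenominator J (Ideal.span (Set.range a)) :=
    (SubmoduleQuotient.smul_mk_eq_zero_iff F ⟨_, hmem⟩).mp hFx
  have hcoeff : (F : Polynomial A).coeff n * x ∈ J * Ideal.span (Set.range a) ^ (n + i) := by
    have := hden (n + i)
    rwa [Subalgebra.smul_def, smul_eq_mul, Polynomial.coeff_mul_monomial] at this
  obtain ⟨G, hG, hGn⟩ := exists_isFormOver_univ a (L := ⊤) (n := n)
    (y := (F : Polynomial A).coeff n) (by simpa using F.2 n)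
  refine ha.mem_mul_pow_of_eval_mul_mem hN h hG ?_ (hGn ▸ hcoeff)
  by_contra! hall
  exact hn (hGn ▸ IsFormOver.eval_mem_univ a fun m => ⟨hall m, (hG m).2⟩)

end Sally

end

section

open IsLocalRing Filter Topology

/-! ### Comparison of Hilbert polynomials by their leading terms -/

section Binomial

theorem tendsto_choose_add_div_pow (c k : ℕ) :
    Tendsto (fun n : ℕ => ((n + c).choose k : ℝ) / (n : ℝ) ^ k) atTop (𝓝 (1 / k.factorial)) := by
  have h1 : Tendsto (fun n : ℕ => ((n : ℝ) + c) / n) atTop (𝓝 1) := by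
    have h := (tendsto_natCast_div_add_atTop (c : ℝ)).inv₀ one_ne_zero
    simpa using h
  have h2 := (isEquivalent_choose k).comp_tendsto (tendsto_add_atTop_nat c)
  have h3 : Tendsto (fun n : ℕ => ((n : ℝ) + c) ^ k / k.factorial / (n : ℝ) ^ k) atTop
      (𝓝 (1 / k.factorial)) := by
    have h := (h1.pow k).div_const (k.factorial : ℝ)
    rw [one_pow] at h
    refine h.congr fun n => ?_
    rw [div_pow, div_right_comm]
  refine Asymptotics.IsEquivalent.tendsto_nhds ?_ h3
  refine Asymptotics.IsEquivalent.div (Asymptotics.IsEquivalent.symm ?_) .refl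
  refine h2.congr_right ?_
  filter_upwards with n
  simp

theorem tendsto_choose_add_div_pow_of_lt (c : ℕ) {k D : ℕ} (hk : k < D) :
    Tendsto (fun n : ℕ => ((n + c).choose k : ℝ) / (n : ℝ) ^ D) atTop (𝓝 0) := by
  have h1 := tendsto_choose_add_div_pow c k
  have h2 : Tendsto (fun n : ℕ => ((n : ℝ) ^ (D - k))⁻¹) atTop (𝓝 0) :=
    ((tendsto_pow_atTop (by omega)).comp tendsto_natCast_atTop_atTop).inv_tendsto_atTop
  have h3 := h1.mul h2
  rw [mul_zero] at h3
  refine h3.congr fun n => ?_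
  rw [← div_eq_mul_inv, div_div, ← pow_add, Nat.add_sub_cancel' hk.le]

/-- Here the dimension is D + 1. Dividing the two bounds by n^(D+1) forces e_0 = q. The top terms
then cancel by Pascal's rule, and dividing the upper bound by n^D leaves q - e_1 + 1 ≤ j. -/
theorem add_one_le_add_of_hilbert_bounds {D : ℕ} {e : ℕ → ℤ} {H : ℕ → ℤ} {q j : ℤ} {r s : ℕ}
    (hH : ∀ᶠ n : ℕ in atTop, H n = ∑ i ∈ Finset.range (D + 1 + 1),
      (-1) ^ i * e i * ((n + (D + 1) - i).choose (D + 1 - i) : ℤ))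
    (hlow : ∀ᶠ n : ℕ in atTop, q * (n + (D + 1)).choose (D + 1) ≤ H (n + r))
    (hup : ∀ᶠ n : ℕ in atTop, H (n + s) + (n + D).choose D ≤
      j * (n + s + D).choose D + q * (n + s + D).choose (D + 1)) :
    q + 1 ≤ e 1 + j := by
  have hsum : ∀ c : ℕ, Tendsto (fun n => (H (n + c) : ℝ) / (n : ℝ) ^ (D + 1)) atTop
      (𝓝 (e 0 / (D + 1).factorial)) := by
    intro c
    have h1 : Tendsto (fun n : ℕ => ∑ i ∈ Finset.range (D + 1 + 1),
        ((-1) ^ i * e i : ℝ) * (((n + (c + (D + 1) - i)).choose (D + 1 - i) : ℝ) /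
          (n : ℝ) ^ (D + 1))) atTop (𝓝 (∑ i ∈ Finset.range (D + 1 + 1),
        ((-1) ^ i * e i : ℝ) * if i = 0 then 1 / ((D + 1).factorial : ℝ) else 0)) := by
      refine tendsto_finsetSum _ fun i hi => Tendsto.const_mul _ ?_
      split_ifs with h
      · subst h
        exact tendsto_choose_add_div_pow _ _
      · exact tendsto_choose_add_div_pow_of_lt _ (by omega)
    simp only [mul_ite, mul_zero, Finset.sum_ite_eq', Finset.mem_range, Nat.succ_pos, if_true,
      pow_zero, one_mul, mul_one_div] at h1
    refine h1.congr' ?_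
    filter_upwards [(tendsto_add_atTop_nat c).eventually hH] with n hn
    rw [hn]
    push_cast
    rw [Finset.sum_div]
    refine Finset.sum_congr rfl fun i hi => ?_
    rw [Finset.mem_range] at hi
    rw [mul_div_assoc, show n + (c + (D + 1) - i) = n + c + (D + 1) - i by omega]
  have hpos : (0 : ℝ) < (D + 1).factorial := by exact_mod_cast Nat.factorial_pos _
  have hpos' : (0 : ℝ) < D.factorial := by exact_mod_cast Nat.factorial_pos _
  have he : e 0 = q := by
    refine le_antisymm ?_ ?_
    · have h1 := ((tendsto_choose_add_div_pow_of_lt (s + D) (Nat.lt_succ_self D)).const_mul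
        (j : ℝ)).add ((tendsto_choose_add_div_pow (s + D) (D + 1)).const_mul (q : ℝ))
      have h2 := le_of_tendsto_of_tendsto (hsum s) h1 (by
        filter_upwards [hup] with n hn
        rw [← mul_div_assoc, ← mul_div_assoc, ← add_div]
        refine div_le_div_of_nonneg_right ?_ (by positivity)
        have : H (n + s) ≤ j * (n + s + D).choose D + q * (n + s + D).choose (D + 1) := by
          have : (0 : ℤ) ≤ (n + D).choose D := by positivity
          linarith
        rw [← add_assoc]
        exact_mod_cast this)
      rw [mul_zero, zero_add, mul_one_div, div_le_div_iff_of_pos_right hpos] at h2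
      exact_mod_cast h2
    · have h1 := (tendsto_choose_add_div_pow (D + 1) (D + 1)).const_mul (q : ℝ)
      have h2 := le_of_tendsto_of_tendsto h1 (hsum r) (by
        filter_upwards [hlow] with n hn
        rw [← mul_div_assoc]
        refine div_le_div_of_nonneg_right ?_ (by positivity)
        exact_mod_cast hn)
      rw [mul_one_div, div_le_div_iff_of_pos_right hpos] at h2
      exact_mod_cast h2
  have h0 : Tendsto (fun n : ℕ => ∑ i ∈ Finset.range D,
      ((-1) ^ (i + 2) * e (i + 2) : ℝ) * (((n + (s + D - (i + 1))).choose (D - (i + 1)) : ℝ) /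
        (n : ℝ) ^ D)) atTop (𝓝 0) := by
    have : Tendsto _ atTop (𝓝 (∑ i ∈ Finset.range D,
      ((-1) ^ (i + 2) * e (i + 2) : ℝ) * 0)) := tendsto_finsetSum (Finset.range D) fun i hi =>
        (tendsto_choose_add_div_pow_of_lt (s + D - (i + 1)) (k := D - (i + 1)) (D := D)
        (by rw [Finset.mem_range] at hi; omega)).const_mul ((-1) ^ (i + 2) * e (i + 2) : ℝ)
    simpa using this
  have h1 := (((tendsto_choose_add_div_pow (s + D) D).const_mul ((q : ℝ) - e 1)).add h0).add
    (tendsto_choose_add_div_pow D D)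
  have h2 := (tendsto_choose_add_div_pow (s + D) D).const_mul (j : ℝ)
  have h3 := le_of_tendsto_of_tendsto h1 h2 (by
    filter_upwards [hup, (tendsto_add_atTop_nat s).eventually hH] with n hn hHn
    simp_rw [← mul_div_assoc]
    rw [← Finset.sum_div, ← add_div, ← add_div]
    refine div_le_div_of_nonneg_right ?_ (by positivity)
    rw [hHn, Finset.sum_range_succ', Finset.sum_range_succ', he] at hn
    have hp : ((n + s + (D + 1) - 0).choose (D + 1 - 0) : ℤ) =
        (n + s + D).choose D + (n + s + D).choose (D + 1) := by
      rw [Nat.sub_zero, Nat.sub_zero, ← add_assoc, Nat.choose_succ_succ]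
      push_cast
      rfl
    have hq : ∑ i ∈ Finset.range D, ((-1) ^ (i + 1 + 1) * e (i + 1 + 1) *
        ((n + s + (D + 1) - (i + 1 + 1)).choose (D + 1 - (i + 1 + 1)) : ℤ)) =
        ∑ i ∈ Finset.range D, ((-1) ^ (i + 2) * e (i + 2) *
          ((n + (s + D - (i + 1))).choose (D - (i + 1)) : ℤ)) := by
      refine Finset.sum_congr rfl fun i hi => ?_
      rw [Finset.mem_range] at hi
      rw [show n + s + (D + 1) - (i + 1 + 1) = n + (s + D - (i + 1)) by omega,
        show D + 1 - (i + 1 + 1) = D - (i + 1) by omega]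
    rw [hp, hq] at hn
    have hr : ((n + s + (D + 1) - (0 + 1)).choose (D + 1 - (0 + 1)) : ℤ) =
        (n + s + D).choose D := by
      rw [show n + s + (D + 1) - (0 + 1) = n + s + D by omega]
      rfl
    rw [hr] at hn
    have : (q - e 1) * (n + s + D).choose D + (∑ i ∈ Finset.range D, ((-1) ^ (i + 2) * e (i + 2) *
          ((n + (s + D - (i + 1))).choose (D - (i + 1)) : ℤ))) + (n + D).choose D ≤
        j * (n + s + D).choose D := by
      simp only [zero_add, pow_zero, pow_one, one_mul] at hn
      linarith
    rw [← add_assoc]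
    exact_mod_cast this)
  rw [mul_one_div, mul_one_div, add_zero, ← add_div, div_le_div_iff_of_pos_right hpos'] at h3
  have h4 : q - e 1 + 1 ≤ j := by exact_mod_cast h3
  linarith

end Binomial

/-! ### Bounding e_1 when the Sally module is nonzero -/

section Hilbert

theorem IsReduction.pow_add_le {A : Type*} [CommRing A] {Q J : Ideal A} {r : ℕ} (h : J ^ (r + 1) = Q * J ^ r) (n : ℕ) :
    J ^ (n + r) ≤ Q ^ n := by
  have : J ^ (n + r) = Q ^ n * J ^ r := by
    induction n with
    | zero => simp
    | succ n ih =>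
      rw [show n + 1 + r = n + r + 1 by ring, pow_succ, ih, mul_assoc, ← pow_succ, h, pow_succ,
        mul_assoc]
  rw [this]
  exact Ideal.mul_le_left

variable {A : Type*} [CommRing A] [IsLocalRing A] [IsNoetherianRing A] {d : ℕ} {a : Fin d → A}

theorem IsPermutablyRegular.isHilbertCoefficients (ha : IsPermutablyRegular a) (hd : 0 < d)
    {k : ℕ} (hk : maximalIdeal A ^ k ≤ Ideal.span (Set.range a)) :
    ∃ e : ℕ → ℤ, IsHilbertCoefficients (Ideal.span (Set.range a)) d e ∧ e 1 = 0 := by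
  have h1 := Module.length_ne_top_iff.mpr (isFiniteLength_quotient_of_pow_le hk)
  obtain ⟨l, hl⟩ := ENat.ne_top_iff_exists.mp h1
  refine ⟨fun i => if i = 0 then l else 0, Eventually.of_forall fun n => ?_, rfl⟩
  refine ⟨(n + d).choose d * l, ?_, ?_⟩
  · rw [ha.length_quotient_pow hd, ← hl]
    push_cast
    rfl
  · simp [mul_comm]

/-- Take x in the last 𝔪^n M not contained in L. -/
theorem exists_socle_element {A : Type*} [CommRing A] [IsLocalRing A] {L M : Ideal A} {k : ℕ}
    (hk : maximalIdeal A ^ k ≤ L) (h : ¬ M ≤ L) :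
    ∃ x ∈ M, x ∉ L ∧ ∀ t ∈ maximalIdeal A, t * x ∈ L := by
  classical
  have hex : ∃ n, maximalIdeal A ^ n * M ≤ L := ⟨k, Ideal.mul_le_left.trans hk⟩
  have hspec := Nat.find_spec hex
  have h0 : Nat.find hex ≠ 0 := by
    intro h0
    rw [h0, pow_zero, Ideal.one_eq_top, Ideal.top_mul] at hspec
    exact h hspec
  obtain ⟨n, hn⟩ := Nat.exists_eq_succ_of_ne_zero h0
  have hmin := Nat.find_min hex (m := n) (by omega)
  rw [hn, pow_succ', mul_assoc] at hspec
  obtain ⟨x, hx, hxL⟩ := SetLike.not_le_iff_exists.mp hmin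
  exact ⟨x, Ideal.mul_le_right hx, hxL, fun t ht => hspec (Ideal.mul_mem_mul ht hx)⟩

/-- If `Q` is a reduction of `J` and `J ^ 2 ≠ Q J`, then `e₁(J) > e₀(J) - ℓ(A/J)`. -/
theorem IsPermutablyRegular.length_add_one_le (ha : IsPermutablyRegular a) (hd : 0 < d)
    {k : ℕ} (hk : maximalIdeal A ^ k ≤ Ideal.span (Set.range a)) {J : Ideal A}
    (hred : IsReduction (Ideal.span (Set.range a)) J)
    (hS : ¬ ∀ i, J ^ (i + 1) ≤ J * Ideal.span (Set.range a) ^ i) {e : ℕ → ℤ}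
    (he : IsHilbertCoefficients J d e) {q j : ℕ}
    (hq : Module.length A (A ⧸ Ideal.span (Set.range a)) = q)
    (hj : Module.length A (A ⧸ J) = j) : (q : ℤ) + 1 ≤ e 1 + j := by
  obtain ⟨D, rfl⟩ : ∃ D, d = D + 1 := ⟨d - 1, by omega⟩
  obtain ⟨hQJ, r, hr⟩ := hred
  push Not at hS
  obtain ⟨s, hs⟩ := hS
  have hks : maximalIdeal A ^ (k * (s + 1)) ≤ J * Ideal.span (Set.range a) ^ s := by
    rw [pow_mul]
    refine (Ideal.pow_right_mono hk (s + 1)).trans ?_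
    exact (pow_succ' (Ideal.span (Set.range a)) s).trans_le (Ideal.mul_mono_left hQJ)
  obtain ⟨x, hxJ, hx, hmx⟩ := exists_socle_element hks hs
  have hfin : ∀ n, Module.length A (A ⧸ J ^ (n + 1)) =
      (Module.length A (A ⧸ J ^ (n + 1))).toNat := by
    intro n
    refine (ENat.natCast_toNat (Module.length_ne_top_iff.mpr
      (isFiniteLength_quotient_of_pow_le (N := k * (n + 1)) ?_))).symm
    rw [pow_mul]
    exact Ideal.pow_right_mono (hk.trans hQJ) (n + 1)
  refine add_one_le_add_of_hilbert_bounds (D := D) (e := e) (r := r) (s := s)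
    (H := fun n => (Module.length A (A ⧸ J ^ (n + 1))).toNat) ?_ ?_ ?_
  · filter_upwards [he] with n ⟨l, hl, hl'⟩
    rw [hl, ENat.toNat_natCast, hl']
  -- Lower bound: the reduction equation gives J^(n+1+r) ⊆ Q^(n+1).
  · filter_upwards with n
    have h1 := Module.length_quotient_mono (IsReduction.pow_add_le hr (n + 1))
    rw [ha.length_quotient_pow hd, hq, show n + 1 + r = n + r + 1 by ring, hfin] at h1
    have h2 : (n + (D + 1)).choose (D + 1) * q ≤
        (Module.length A (A ⧸ J ^ (n + r + 1))).toNat := by exact_mod_cast h1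
    rw [mul_comm]
    exact_mod_cast h2
  -- Upper bound: the socle element adds one full polynomial ring to J^(n+s+1)/JQ^(n+s). Taking n ≥
  -- 1 makes the exponent n + s a successor, as the formula for ℓ(A/Q^(m+1)) requires.
  · filter_upwards [eventually_ge_atTop 1] with n hn
    have h1 := ha.choose_add_length_le hk hQJ hxJ hx hmx n
    obtain ⟨m, hm⟩ : ∃ m, n + s = m + 1 := ⟨n + s - 1, by omega⟩
    rw [ha.length_quotient_mul_pow hQJ, hm, ha.length_quotient_pow hd, hq, hj, ← hm, hfin] at h1
    have h2 : (D + 1 + n - 1).choose n + (Module.length A (A ⧸ J ^ (n + s + 1))).toNat ≤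
        (D + 1 + (n + s) - 1).choose (n + s) * j + (m + (D + 1)).choose (D + 1) * q := by
      exact_mod_cast h1
    rw [show D + 1 + n - 1 = n + D by omega, show D + 1 + (n + s) - 1 = n + s + D by omega,
      show m + (D + 1) = n + s + D by omega, Nat.choose_symm_add, Nat.choose_symm_add] at h2
    have h3 : (Module.length A (A ⧸ J ^ (n + s + 1))).toNat + (n + D).choose D ≤
        j * (n + s + D).choose D + q * (n + s + D).choose (D + 1) := by
      linarith
    exact_mod_cast h3

end Hilbert

end

section

open IsLocalRing RingTheory.Sequence

/-! ### Systems of parameters in a localization of a Cohen–Macaulay ring -/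

section CohenMacaulay

variable {G : Type*} [CommRing G]

/-- Height at least d makes the d elements y a system of parameters of the Cohen–Macaulay ring G_p.
They form a regular sequence in any order; with y_i placed first, y_i is regular and z dies in G_p.
-/
theorem IsCohenMacaulayRing.exists_mul_eq_zero (hG : IsCohenMacaulayRing G) (p : Ideal G)
    [p.IsPrime] {d : ℕ} {y : Fin d → G} (hy : ∀ i, y i ∈ p)
    (hrad : p ≤ (Ideal.span (Set.range y)).radical) (hht : d ≤ p.height) (i : Fin d) {z : G}
    (hz : y i * z = 0) : ∃ s ∉ p, s * z = 0 := by
  obtain ⟨hnoeth, rs, hmem, hrs, hlen⟩ := hG.2 p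
  have hmap := Localization.AtPrime.map_eq_maximalIdeal (I := p)
  let l : List (Fin d) := i :: (Finset.univ.erase i).toList
  let as : List (Localization.AtPrime p) := l.map fun j => algebraMap G _ (y j)
  have hl : as.length = d := by
    have := i.pos
    simp only [as, l, List.length_map, List.length_cons, Finset.length_toList,
      Finset.card_erase_of_mem (Finset.mem_univ _), Finset.card_univ, Fintype.card_fin]
    omega
  have hasm : ∀ x ∈ as, x ∈ maximalIdeal (Localization.AtPrime p) := by
    intro x hx
    obtain ⟨j, -, rfl⟩ := List.mem_map.mp hx
    rw [← hmap]
    exact Ideal.mem_map_of_mem _ (hy j)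
  have has : maximalIdeal (Localization.AtPrime p) ≤ (Ideal.ofList as).radical := by
    rw [← hmap]
    refine (Ideal.map_mono hrad).trans ((Ideal.map_radical_le _).trans (Ideal.radical_mono ?_))
    rw [Ideal.map_span]
    refine Ideal.span_mono ?_
    rintro _ ⟨_, ⟨j, rfl⟩, rfl⟩
    refine List.mem_map_of_mem (f := fun j => algebraMap G (Localization.AtPrime p) (y j)) ?_
    simp only [l, List.mem_cons, Finset.mem_toList, Finset.mem_erase, Finset.mem_univ, and_true]
    exact eq_or_ne j i
  have hdim : ringKrullDim (Localization.AtPrime p) = d := by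
    refine le_antisymm (hl ▸ ringKrullDim_le_length_of_maximalIdeal_le_radical as hasm has) ?_
    rw [IsLocalization.AtPrime.ringKrullDim_eq_height p (Localization.AtPrime p)]
    exact_mod_cast hht
  have hlen' : as.length = rs.length := by
    rw [hdim] at hlen
    rw [hl]
    exact_mod_cast hlen.symm
  have hreg := isRegular_of_maximalIdeal_le_radical hrs hmem as hlen' hasm
    (has.trans (Ideal.radical_mono le_sup_right))
  have h1 := (isRegular_cons_iff _ _ _).mp hreg |>.1
  have h2 : algebraMap G (Localization.AtPrime p) z = 0 := by
    rw [isSMulRegular_iff_right_eq_zero_of_smul] at h1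
    exact h1 _ (by rw [smul_eq_mul, ← map_mul, hz, map_zero])
  obtain ⟨s, hs⟩ := (IsLocalization.map_eq_zero_iff p.primeCompl _ z).mp h2
  exact ⟨s, s.2, hs⟩

end CohenMacaulay

/-! ### Heights by going up from a polynomial ring -/

section Height

open MvPolynomial

variable {A : Type*} [CommRing A] [IsLocalRing A] {d : ℕ}

/-- Reduction modulo the maximal ideal and the first `j` variables. -/
noncomputable def truncateVars (A : Type*) [CommRing A] [IsLocalRing A] (d j : ℕ) :
    MvPolynomial (Fin d) A →+* MvPolynomial (Fin d) (ResidueField A) :=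
  eval₂Hom (C.comp (residue A)) fun i => if (i : ℕ) < j then 0 else X i

theorem ker_truncateVars_mono (j : ℕ) :
    RingHom.ker (truncateVars A d j) ≤ RingHom.ker (truncateVars A d (j + 1)) := by
  have h : truncateVars A d (j + 1) = (aeval fun i : Fin d =>
      if (i : ℕ) < j + 1 then (0 : MvPolynomial (Fin d) (ResidueField A)) else X i).toRingHom.comp
        (truncateVars A d j) := by
    refine MvPolynomial.ringHom_ext (fun r => ?_) fun i => ?_
    · simp [truncateVars]
    · by_cases h1 : (i : ℕ) < j
      · simp [truncateVars, h1, h1.le]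
      · simp [truncateVars, h1]
  intro F hF
  rw [RingHom.mem_ker] at hF ⊢
  rw [h, RingHom.comp_apply, hF, map_zero]

theorem X_mem_ker_truncateVars {j : ℕ} {i : Fin d} :
    X i ∈ RingHom.ker (truncateVars A d j) ↔ (i : ℕ) < j := by
  rw [RingHom.mem_ker]
  by_cases h : (i : ℕ) < j
  · simp [truncateVars, h]
  · simp [truncateVars, h, X_ne_zero]

/-- The chain of primes (𝔪, X_1, …, X_j) of A[X] lifts step by step through the integral map φ. Each
lift is strict because the next variable is new, so the height grows by at least one each time. The
condition on the kernel starts the chain at 𝔪A[X]. -/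
theorem exists_isPrime_comap_eq_ker_truncateVars {G : Type*} [CommRing G] [IsNoetherianRing G]
    (φ : MvPolynomial (Fin d) A →+* G) (hφ : φ.IsIntegral)
    (hker : RingHom.ker φ ≤ (maximalIdeal A).map C) {j : ℕ} (hj : j ≤ d) :
    ∃ q : Ideal G, q.IsPrime ∧ q.comap φ = RingHom.ker (truncateVars A d j) ∧ j ≤ q.height := by
  let _ := φ.toAlgebra
  have : Algebra.IsIntegral (MvPolynomial (Fin d) A) G := ⟨hφ⟩
  induction j with
  | zero =>
    have hp : (RingHom.ker (truncateVars A d 0)).IsPrime := RingHom.ker_isPrime _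
    obtain ⟨q, -, hq, hqc⟩ := Ideal.exists_ideal_over_prime_of_isIntegral
      (RingHom.ker (truncateVars A d 0)) (⊥ : Ideal G) (by
        refine hker.trans (Ideal.map_le_iff_le_comap.mpr fun r hr => ?_)
        rw [Ideal.mem_comap, RingHom.mem_ker]
        simpa [truncateVars] using hr)
    exact ⟨q, hq, hqc, by simp⟩
  | succ j ih =>
    obtain ⟨q, hq, hqc, hqh⟩ := ih (by omega)
    have hp : (RingHom.ker (truncateVars A d (j + 1))).IsPrime := RingHom.ker_isPrime _
    obtain ⟨q', hqq', hq', hqc'⟩ := Ideal.exists_ideal_over_prime_of_isIntegral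
      (RingHom.ker (truncateVars A d (j + 1))) q (hqc.trans_le (ker_truncateVars_mono j))
    refine ⟨q', hq', hqc', ?_⟩
    have hlt : q < q' := by
      refine lt_of_le_of_ne hqq' ?_
      rintro rfl
      have h1 : X (⟨j, by omega⟩ : Fin d) ∈ RingHom.ker (truncateVars A d (j + 1)) :=
        X_mem_ker_truncateVars.mpr (Nat.lt_succ_self j)
      rw [← hqc', RingHom.algebraMap_toAlgebra φ, hqc] at h1
      exact absurd (X_mem_ker_truncateVars.mp h1) (lt_irrefl _)
    push_cast
    exact (add_le_add_left hqh 1).trans (Ideal.height_add_one_le_of_lt_of_isPrime hlt)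

end Height

/-! ### Finiteness of A[Jt] and regularity of initial forms -/

section Rees

open MvPolynomial

variable {A : Type*} [CommRing A] {d : ℕ} {a : Fin d → A} {J : Ideal A} {h : ∀ i, a i ∈ J}

theorem Ideal.span_range_mul_le {K W : Ideal A} (hW : ∀ i, ∀ s ∈ K, a i * s ∈ W) :
    Ideal.span (Set.range a) * K ≤ W := by
  refine Ideal.mul_le.mpr fun r hr s hs => ?_
  induction hr using Submodule.span_induction with
  | mem r hr =>
    obtain ⟨i, rfl⟩ := hr
    exact hW i s hs
  | zero => simp
  | add r r' _ _ hr hr' => rw [add_mul]; exact add_mem hr hr'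
  | smul c r _ hr => rw [smul_eq_mul, mul_assoc]; exact W.mul_mem_left c hr

theorem reesAlgebra.eq_sum_monomial (f : reesAlgebra J) :
    f = ∑ n ∈ (f : Polynomial A).support, ⟨Polynomial.monomial n ((f : Polynomial A).coeff n),
      reesAlgebra.monomial_mem.mpr (f.2 n)⟩ := by
  refine Subtype.ext ?_
  rw [AddSubmonoidClass.coe_finsetSum]
  exact (f : Polynomial A).as_sum_support

theorem coe_reesEval_X (i : Fin d) :
    (reesEval a h (X i) : Polynomial A) = Polynomial.monomial 1 (a i) := by
  simp [reesEval]

theorem monomial_mem_span_range_reesEval_X {n : ℕ} {x : A}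
    (hx : x ∈ Ideal.span (Set.range a) * J ^ n) (hxJ : x ∈ J ^ (n + 1)) :
    (⟨Polynomial.monomial (n + 1) x, reesAlgebra.monomial_mem.mpr hxJ⟩ : reesAlgebra J) ∈
      Ideal.span (Set.range fun i => reesEval a h (X i)) := by
  let W : Submodule A (Polynomial A) :=
    ((Ideal.span (Set.range fun i => reesEval a h (X i))).restrictScalars A).map
      (reesAlgebra J).val.toLinearMap
  have hW : Ideal.span (Set.range a) * J ^ n ≤ W.comap (Polynomial.monomial (n + 1)) := by
    refine Ideal.span_range_mul_le fun i s hs => ?_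
    refine ⟨reesEval a h (X i) * ⟨Polynomial.monomial n s, reesAlgebra.monomial_mem.mpr hs⟩,
      Ideal.mul_mem_right _ _ (Ideal.subset_span ⟨i, rfl⟩), ?_⟩
    change (reesEval a h (X i) : Polynomial A) * Polynomial.monomial n s = _
    rw [coe_reesEval_X, Polynomial.monomial_mul_monomial, add_comm]
  obtain ⟨g, hg, hgx⟩ := hW hx
  rwa [← Subtype.ext (a1 := g) (a2 := ⟨_, reesAlgebra.monomial_mem.mpr hxJ⟩) hgx]

/-- Since J^(n+1) = QJ^n for n ≥ r, module generators of J^n for n ≤ r, placed in degree n, generate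
A[Jt] over A[X]. -/
theorem reesEval_finite [IsNoetherianRing A] {r : ℕ}
    (hr : J ^ (r + 1) = Ideal.span (Set.range a) * J ^ r) :
    (reesEval a h : MvPolynomial (Fin d) A →+* reesAlgebra J).Finite := by
  classical
  let _ := (reesEval a h : MvPolynomial (Fin d) A →+* reesAlgebra J).toAlgebra
  choose S hS using fun n : ℕ => IsNoetherian.noetherian (J ^ n)
  have hSJ : ∀ n, ∀ s ∈ S n, s ∈ J ^ n := fun n s hs => hS n ▸ Submodule.subset_span hs
  let T : Finset (reesAlgebra J) := (Finset.range (r + 1)).biUnion fun n =>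
    (S n).attach.image fun s : S n => (⟨Polynomial.monomial n s.1,
      reesAlgebra.monomial_mem.mpr (hSJ n s.1 s.2)⟩ : reesAlgebra J)
  refine ⟨⟨T, ?_⟩⟩
  let N : Submodule (MvPolynomial (Fin d) A) (reesAlgebra J) := Submodule.span _ T
  let W : Submodule A (Polynomial A) :=
    { carrier := {f | ∃ g ∈ N, (g : Polynomial A) = f}
      add_mem' := by
        rintro _ _ ⟨f, hf, rfl⟩ ⟨g, hg, rfl⟩
        exact ⟨f + g, add_mem hf hg, rfl⟩
      zero_mem' := ⟨0, zero_mem _, rfl⟩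
      smul_mem' := by
        rintro c _ ⟨f, hf, rfl⟩
        refine ⟨(C c : MvPolynomial (Fin d) A) • f, N.smul_mem _ hf, ?_⟩
        change ((reesEval a h (C c) * f : reesAlgebra J) : Polynomial A) = _
        rw [← algebraMap_eq, AlgHom.commutes, ← Algebra.smul_def]
        rfl }
  have hle : ∀ n ≤ r, J ^ n ≤ W.comap (Polynomial.monomial n) := by
    intro n hn
    rw [← hS n]
    refine Submodule.span_le.mpr fun s hs => ⟨⟨Polynomial.monomial n s,
      reesAlgebra.monomial_mem.mpr (hSJ n s hs)⟩, Submodule.subset_span ?_, rfl⟩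
    exact Finset.mem_biUnion.mpr ⟨n, Finset.mem_range.mpr (by omega),
      Finset.mem_image.mpr ⟨⟨s, hs⟩, Finset.mem_attach _ _, rfl⟩⟩
  have hW : ∀ n, J ^ n ≤ W.comap (Polynomial.monomial n) := by
    intro n
    induction n with
    | zero => exact hle 0 (Nat.zero_le r)
    | succ n ih =>
      obtain hn | hn := Nat.lt_or_ge n r
      · exact hle _ hn
      · have hJ : J ^ (n + 1) = Ideal.span (Set.range a) * J ^ n := by
          obtain ⟨k, rfl⟩ := Nat.exists_eq_add_of_le hn
          rw [add_right_comm, pow_add, hr, mul_assoc, ← pow_add]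
        rw [hJ]
        refine Ideal.span_range_mul_le fun i s hs => ?_
        obtain ⟨g, hg, hgs⟩ := ih hs
        refine ⟨(X i : MvPolynomial (Fin d) A) • g, N.smul_mem _ hg, ?_⟩
        change (reesEval a h (X i) : Polynomial A) * g = _
        rw [coe_reesEval_X, hgs, Polynomial.monomial_mul_monomial, add_comm]
  rw [eq_top_iff]
  rintro f -
  rw [reesAlgebra.eq_sum_monomial f]
  refine sum_mem fun n _ => ?_
  obtain ⟨g, hg, hgf⟩ := hW n (f.2 n)
  rwa [← Subtype.ext (a1 := g) (a2 := ⟨_, reesAlgebra.monomial_mem.mpr (f.2 n)⟩) hgf]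

theorem monomial_mem_radical {r : ℕ} (hr : J ^ (r + 1) = Ideal.span (Set.range a) * J ^ r)
    {n : ℕ} {x : A} (hx : x ∈ J ^ (n + 1)) :
    (⟨Polynomial.monomial (n + 1) x, reesAlgebra.monomial_mem.mpr hx⟩ : reesAlgebra J) ∈
      (Ideal.span (Set.range fun i => reesEval a h (X i))).radical := by
  have hpow : x ^ (r + 1) ∈ J ^ (n * (r + 1) + r + 1) := by
    have := Ideal.pow_mem_pow hx (r + 1)
    rwa [← pow_mul, show (n + 1) * (r + 1) = n * (r + 1) + r + 1 by ring] at this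
  refine ⟨r + 1, ?_⟩
  have h1 := monomial_mem_span_range_reesEval_X (h := h) (n := n * (r + 1) + r)
    (x := x ^ (r + 1)) (by
      rw [add_assoc, pow_add, hr] at hpow
      rwa [pow_add, mul_left_comm]) hpow
  convert h1 using 1
  refine Subtype.ext ?_
  rw [SubmonoidClass.coe_pow]
  change Polynomial.monomial (n + 1) x ^ (r + 1) = Polynomial.monomial (n * (r + 1) + r + 1) _
  rw [Polynomial.monomial_pow, show (n + 1) * (r + 1) = n * (r + 1) + r + 1 by ring]

variable {G : Type*} [CommRing G] {π : reesAlgebra J →+* G}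

/-- The kernel of `π` is that of the projection `A[Jt] → gr_J(A)`. -/
def IsInitialFormMap (π : reesAlgebra J →+* G) : Prop :=
  ∀ f, π f = 0 ↔ ∀ n, (f : Polynomial A).coeff n ∈ J ^ (n + 1)

theorem isInitialFormMap_quotientMk :
    IsInitialFormMap (J := J) (G := AssociatedGradedRing J) (Ideal.Quotient.mk _) := by
  intro f
  rw [Ideal.Quotient.eq_zero_iff_mem, mem_map_algebraMap_reesAlgebra_iff]
  simp_rw [pow_succ']

variable [IsLocalRing A]

theorem IsInitialFormMap.mem_radical_of_coeff_zero_mem (hπ : IsInitialFormMap π) {r k : ℕ} (hk : maximalIdeal A ^ k ≤ J)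
    (hr : J ^ (r + 1) = Ideal.span (Set.range a) * J ^ r) {f : reesAlgebra J}
    (hf : (f : Polynomial A).coeff 0 ∈ maximalIdeal A) :
    π f ∈ (Ideal.span (Set.range fun i => π (reesEval a h (X i)))).radical := by
  rw [reesAlgebra.eq_sum_monomial f, map_sum]
  refine sum_mem fun n _ => ?_
  cases n with
  | zero =>
    refine ⟨k, ?_⟩
    rw [← map_pow, (hπ _).mpr]
    · exact zero_mem _
    · intro n
      rw [SubmonoidClass.coe_pow]
      change (Polynomial.monomial 0 _ ^ k).coeff n ∈ _
      rw [Polynomial.monomial_pow, zero_mul, Polynomial.coeff_monomial]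
      split_ifs with hn
      · rw [← hn, zero_add, pow_one]
        exact hk (Ideal.pow_mem_pow hf k)
      · exact zero_mem _
  | succ n =>
    have h1 := Ideal.mem_map_of_mem (π)
      (monomial_mem_radical (h := h) hr (f.2 (n + 1)))
    have h2 := Ideal.map_radical_le _ h1
    rwa [Ideal.map_span, ← Set.range_comp] at h2

/-- Analytic independence. If G has degree n and G(a) ∈ J^(n+1), then G(a)^(r+1) lies in
Q^(n(r+1)+1) by the reduction equation. Quasi-regularity puts the coefficients of G^(r+1) in Q ⊆ 𝔪,
and 𝔪A[X] is prime. -/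
theorem IsPermutablyRegular.ker_comp_reesEval_le (hπ : IsInitialFormMap π)
    (ha : IsPermutablyRegular a)
    (hQ : Ideal.span (Set.range a) ≤ maximalIdeal A) {r : ℕ}
    (hr : J ^ (r + 1) = Ideal.span (Set.range a) * J ^ r) :
    RingHom.ker ((π).comp (reesEval a h : MvPolynomial (Fin d) A →+* reesAlgebra J)) ≤
      (maximalIdeal A).map (C : A →+* MvPolynomial (Fin d) A) := by
  intro F hF
  rw [RingHom.mem_ker, RingHom.comp_apply, hπ] at hF
  rw [mem_map_C_iff]
  intro m
  have h1 := hF m.degree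
  change (reesEval a h F : Polynomial A).coeff m.degree ∈ _ at h1
  rw [coeff_reesEval] at h1
  have hG := isFormOver_homogeneousComponent F m.degree
  set n := m.degree with hn
  set G := homogeneousComponent n F with hGdef
  have h2 : eval a (G ^ (r + 1)) ∈ Ideal.span (Set.range a) *
      Ideal.span (Set.range a) ^ (n * (r + 1)) := by
    have := Ideal.pow_mem_pow h1 (r + 1)
    rw [← pow_mul, show (n + 1) * (r + 1) = n * (r + 1) + 1 + r by ring] at this
    rw [map_pow, ← pow_succ']
    exact IsReduction.pow_add_le hr _ this
  have h3 : IsFormOver ⊤ Finset.univ (n * (r + 1)) (G ^ (r + 1)) :=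
    .of_isHomogeneous (hG.isHomogeneous.pow _) fun _ => trivial
  have h4 : G ^ (r + 1) ∈ (maximalIdeal A).map (C : A →+* MvPolynomial (Fin d) A) :=
    mem_map_C_iff.mpr fun m => hQ (ha.isFormOver_of_eval_mem le_rfl h3 h2 m).1
  have h5 := mem_map_C_iff.mp ((MvPolynomial.isPrime_map_C (maximalIdeal A)).mem_of_pow_mem _ h4) m
  rwa [coeff_homogeneousComponent, if_pos hn.symm] at h5

/-- If the associated graded ring is Cohen-Macaulay, the initial forms of the generators of a
reduction are nonzerodivisors on elements of degree zero. -/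
theorem IsPermutablyRegular.mem_of_mul_mem_sq [IsNoetherianRing A] (hπ : IsInitialFormMap π)
    (hsurj : Function.Surjective π) (ha : IsPermutablyRegular a)
    (hQ : Ideal.span (Set.range a) ≤ maximalIdeal A) {k : ℕ}
    (hk : maximalIdeal A ^ k ≤ Ideal.span (Set.range a))
    (hred : IsReduction (Ideal.span (Set.range a)) J)
    (hgr : IsCohenMacaulayRing G) (i : Fin d) {z : A}
    (hz : a i * z ∈ J ^ 2) : z ∈ J := by
  obtain ⟨hQJ, r, hr⟩ := hred
  have h : ∀ i, a i ∈ J := fun i => hQJ (Ideal.subset_span ⟨i, rfl⟩)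
  have := hgr.1
  let φ := (π).comp (reesEval a h : MvPolynomial (Fin d) A →+* reesAlgebra J)
  have hφ : φ.IsIntegral := RingHom.IsIntegral.trans _ _ (reesEval_finite hr).to_isIntegral
    (RingHom.isIntegral_of_surjective _ (hsurj))
  obtain ⟨q, hq, hqc, hqh⟩ := exists_isPrime_comap_eq_ker_truncateVars φ hφ
    (ha.ker_comp_reesEval_le hπ hQ hr) le_rfl
  have hy : ∀ i, φ (X i) ∈ q := fun i => by
    rw [← Ideal.mem_comap, hqc]
    exact X_mem_ker_truncateVars.mpr i.2
  have hrad : ∀ f : reesAlgebra J, (f : Polynomial A).coeff 0 ∈ maximalIdeal A →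
      π f ∈ (Ideal.span (Set.range fun i => φ (X i))).radical := fun f hf =>
    hπ.mem_radical_of_coeff_zero_mem (h := h) (hk.trans hQJ) hr hf
  have hradq : (Ideal.span (Set.range fun i => φ (X i))).radical ≤ q := by
    rw [hq.isRadical.radical_le_iff, Ideal.span_le]
    rintro _ ⟨i, rfl⟩
    exact hy i
  -- The prime q over (𝔪, X_1, …, X_d) is the radical of the ideal of initial forms: an element
  -- whose degree-zero part is a unit would otherwise put a unit constant in the contraction of q.
  have hqrad : q ≤ (Ideal.span (Set.range fun i => φ (X i))).radical := by
    intro g hg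
    obtain ⟨f, rfl⟩ := hsurj g
    refine hrad f ?_
    by_contra hf
    set c := (f : Polynomial A).coeff 0 with hc
    have h1 : π (f - algebraMap A (reesAlgebra J) c) ∈ q := by
      refine hradq (hrad _ ?_)
      change ((f : Polynomial A) - Polynomial.C c).coeff 0 ∈ _
      simp [hc]
    rw [map_sub] at h1
    have h2 := sub_mem hg h1
    rw [sub_sub_cancel] at h2
    have h3 : (C c : MvPolynomial (Fin d) A) ∈ q.comap φ := by
      rw [Ideal.mem_comap]
      convert h2 using 1
      change π (reesEval a h (C c)) = _
      rw [← algebraMap_eq, AlgHom.commutes]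
    rw [hqc, RingHom.mem_ker] at h3
    have h4 : residue A c = 0 := by simpa [truncateVars] using h3
    exact hf ((residue_eq_zero_iff c).mp h4)
  obtain ⟨s, hsq, hs⟩ := hgr.exists_mul_eq_zero q hy hqrad hqh i
    (z := π (algebraMap A (reesAlgebra J) z)) (by
      rw [RingHom.comp_apply, ← map_mul, hπ]
      intro n
      have h1 : ((reesEval a h (X i) * algebraMap A (reesAlgebra J) z : reesAlgebra J) :
          Polynomial A) = Polynomial.monomial 1 (a i * z) := by
        change (reesEval a h (X i) : Polynomial A) * Polynomial.C z = _
        rw [coe_reesEval_X, Polynomial.monomial_mul_C]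
      refine Eq.subst (motive := fun f : Polynomial A => f.coeff n ∈ J ^ (n + 1)) h1.symm ?_
      rw [Polynomial.coeff_monomial]
      split_ifs with hn
      · rwa [← hn]
      · exact zero_mem _)
  -- As s lies outside q, its degree-zero part is a unit; reading s z = 0 in degree zero gives z ∈
  -- J.
  obtain ⟨f, rfl⟩ := hsurj s
  rw [← map_mul, hπ] at hs
  have h1 := hs 0
  change ((f : Polynomial A) * Polynomial.C z).coeff 0 ∈ _ at h1
  rw [Polynomial.coeff_mul_C, zero_add, pow_one] at h1
  have hu : IsUnit ((f : Polynomial A).coeff 0) := by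
    rw [← notMem_maximalIdeal]
    exact fun hf => hsq (hradq (hrad f hf))
  exact (Ideal.unit_mul_mem_iff_mem _ hu).mp h1

theorem IsPermutablyRegular.mem_of_mul_mem_sq_of_isCohenMacaulayRing [IsNoetherianRing A]
    (ha : IsPermutablyRegular a) (hQ : Ideal.span (Set.range a) ≤ maximalIdeal A) {k : ℕ}
    (hk : maximalIdeal A ^ k ≤ Ideal.span (Set.range a))
    (hred : IsReduction (Ideal.span (Set.range a)) J)
    (hgr : IsCohenMacaulayRing (AssociatedGradedRing J)) (i : Fin d) {z : A}
    (hz : a i * z ∈ J ^ 2) : z ∈ J := by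
  have h := ha.mem_of_mul_mem_sq (isInitialFormMap_quotientMk (J := J))
  exact h Ideal.Quotient.mk_surjective hQ hk hred hgr i hz

end Rees

/-! ### Cohen–Macaulay associated graded ring forces J² ⊆ QJ -/

section CanonicalIdeal

universe u

variable {A : Type u} [CommRing A] [IsLocalRing A] [IsNoetherianRing A] {d : ℕ} {a : Fin d → A}
  {I : Ideal A}

/-- If I² were not in QJ, the images of I² and of (a_1) in I/QI would be nonzero and so would meet
nontrivially, the socle being simple. A common element gives z a_1 ≡ y modulo QI with y ∈ I². Then
a_1 z ∈ J², so z ∈ J and y ∈ I ∩ QJ ⊆ QI, a contradiction. -/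
theorem IsCanonicalIdeal.sq_le_of_forall_mem (hI : IsCanonicalIdeal d I)
    (hA : IsMaximalCohenMacaulay A A) (ha : IsSystemOfParameters a) {i₀ : Fin d} (h₀ : a i₀ ∈ I)
    (hreg : ∀ z : A, a i₀ * z ∈ (I ⊔ Ideal.span (Set.range a)) ^ 2 →
      z ∈ I ⊔ Ideal.span (Set.range a)) :
    (I ⊔ Ideal.span (Set.range a)) ^ 2 ≤
      Ideal.span (Set.range a) * (I ⊔ Ideal.span (Set.range a)) := by
  obtain ⟨k, hk⟩ := ha.exists_pow_le
  obtain ⟨-, hfin, hM, hsoc, -⟩ := id hI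
  rw [hM.extLength_eq ha] at hsoc
  set Q := Ideal.span (Set.range a) with hQ
  have hsup : (I ⊔ Q) ^ 2 = I * I ⊔ Q * (I ⊔ Q) := by
    rw [sq, Ideal.sup_mul, Ideal.mul_sup, sup_assoc]
    refine le_antisymm (sup_le_sup_left (sup_le ?_ le_rfl) _) (sup_le_sup_left le_sup_right _)
    rw [mul_comm]
    exact Ideal.mul_mono_right le_sup_left
  rw [hsup]
  refine sup_le ?_ le_rfl
  by_contra hII
  let π := (Q • ⊤ : Submodule A I).mkQ
  let x₀ : I := ⟨a i₀, h₀⟩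
  have hN₁ : Submodule.map π (I • ⊤) ≠ ⊥ := by
    intro hbot
    refine hII (Ideal.mul_le.mpr fun r hr s hs => ?_)
    have h1 : π (r • ⟨s, hs⟩) ∈ Submodule.map π (I • ⊤) :=
      Submodule.mem_map_of_mem (Submodule.smul_mem_smul hr trivial)
    rw [hbot, Submodule.mem_bot, Submodule.mkQ_apply, Submodule.Quotient.mk_eq_zero,
      Submodule.mem_smul_top_iff] at h1
    exact Ideal.mul_mono_right le_sup_left h1
  have hN₂ : Submodule.span A {π x₀} ≠ ⊥ := by
    rw [Ne, Submodule.span_singleton_eq_bot, Submodule.mkQ_apply, Submodule.Quotient.mk_eq_zero,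
      Submodule.mem_smul_top_iff]
    exact hI.notMem_span_mul hA ha
  obtain ⟨v, ⟨hv₁, hv₂⟩, hv⟩ := (Submodule.ne_bot_iff _).mp (inf_ne_bot_of_length_socle_eq_one hk
    (le_annihilator_quotient_smul_top _) hsoc hN₁ hN₂)
  obtain ⟨y, hy, rfl⟩ := hv₁
  obtain ⟨z, hz⟩ := Submodule.mem_span_singleton.mp hv₂
  have hyI : (y : A) ∈ I * I := (Submodule.mem_smul_top_iff _ _ _).mp hy
  rw [← map_smul, Submodule.mkQ_apply, Submodule.mkQ_apply, Submodule.Quotient.eq,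
    Submodule.mem_smul_top_iff] at hz
  have hw : z * a i₀ - y ∈ Q * I := hz
  have hzJ : z ∈ I ⊔ Q := by
    refine hreg z ?_
    rw [hsup, show a i₀ * z = z * a i₀ - y + y by ring]
    exact add_mem (Ideal.mem_sup_right (Ideal.mul_mono_right le_sup_left hw))
      (Ideal.mem_sup_left hyI)
  refine hv ?_
  rw [Submodule.mkQ_apply, Submodule.Quotient.mk_eq_zero, Submodule.mem_smul_top_iff]
  refine hI.inf_mul_le ha h₀ ⟨y.2, ?_⟩
  have hz' : a i₀ * z ∈ Q * (I ⊔ Q) := Ideal.mul_mem_mul (Ideal.subset_span ⟨i₀, rfl⟩) hzJ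
  have hw' : z * a i₀ - y ∈ Q * (I ⊔ Q) := Ideal.mul_mono_right le_sup_left hw
  have hy' := sub_mem hz' hw'
  rwa [show a i₀ * z - (z * a i₀ - y) = y by ring] at hy'

theorem IsCanonicalIdeal.sq_le_of_isCohenMacaulayRing (hI : IsCanonicalIdeal d I)
    (hA : IsMaximalCohenMacaulay A A) (ha : IsSystemOfParameters a) {i₀ : Fin d} (h₀ : a i₀ ∈ I)
    (hred : IsReduction (Ideal.span (Set.range a)) (I ⊔ Ideal.span (Set.range a)))
    (hgr : IsCohenMacaulayRing (AssociatedGradedRing (I ⊔ Ideal.span (Set.range a)))) :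
    (I ⊔ Ideal.span (Set.range a)) ^ 2 ≤
      Ideal.span (Set.range a) * (I ⊔ Ideal.span (Set.range a)) := by
  obtain ⟨k, hk⟩ := ha.exists_pow_le
  exact hI.sq_le_of_forall_mem hA ha h₀ fun z hz =>
    (hA.isPermutablyRegular ha).mem_of_mul_mem_sq_of_isCohenMacaulayRing ha.span_le hk hred hgr
      i₀ hz

end CanonicalIdeal

end

section

open IsLocalRing RingTheory.Sequence

/-! ### Polynomial rings over Cohen–Macaulay rings -/

section CohenMacaulayRings

universe u v

open Polynomial

theorem IsCohenMacaulayLocalRing.of_isWeaklyRegular {S : Type u} [CommRing S] [IsLocalRing S]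
    [IsNoetherianRing S] {rs : List S} (hmem : ∀ r ∈ rs, r ∈ maximalIdeal S)
    (hrs : IsWeaklyRegular S rs) (hrad : maximalIdeal S ≤ (Ideal.ofList rs).radical) :
    IsCohenMacaulayLocalRing S := by
  have hreg : IsRegular S rs :=
    (IsLocalRing.isRegular_iff_isWeaklyRegular_of_subset_maximalIdeal hmem).mpr hrs
  refine ⟨inferInstance, rs, hmem, hreg, le_antisymm ?_
    (ringKrullDim_le_length_of_maximalIdeal_le_radical rs hmem hrad)⟩
  rw [← ringKrullDim_add_length_eq_ringKrullDim_of_isRegular rs hreg]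
  have : Nontrivial (S ⧸ Ideal.ofList rs) := Ideal.Quotient.nontrivial_iff.mpr
    (ne_top_of_le_ne_top (IsLocalRing.maximalIdeal.isMaximal S).ne_top (Ideal.span_le.mpr hmem))
  exact le_add_of_nonneg_left ringKrullDim_nonneg_of_nontrivial

theorem isCohenMacaulayLocalRing_localization_atPrime {T : Type u} [CommRing T]
    [IsNoetherianRing T] (p : Ideal T) [p.IsPrime] {rs : List T} (hmem : ∀ r ∈ rs, r ∈ p)
    (hrs : IsWeaklyRegular T rs) (hrad : p ≤ (Ideal.ofList rs).radical) :
    IsCohenMacaulayLocalRing (Localization.AtPrime p) := by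
  have hmap := Localization.AtPrime.map_eq_maximalIdeal (I := p)
  refine .of_isWeaklyRegular (rs := rs.map (algebraMap T _)) ?_
    (hrs.of_isLocalization _ p.primeCompl) ?_
  · intro x hx
    obtain ⟨r, hr, rfl⟩ := List.mem_map.mp hx
    rw [← hmap]
    exact Ideal.mem_map_of_mem _ (hmem r hr)
  · rw [← hmap, ← Ideal.map_ofList]
    exact (Ideal.map_mono hrad).trans (Ideal.map_radical_le _)

theorem IsCohenMacaulayLocalRing.of_ringEquiv {R : Type u} {S : Type v} [CommRing R]
    [IsLocalRing R] [CommRing S] [IsLocalRing S] (e : R ≃+* S) (h : IsCohenMacaulayLocalRing R) :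
    IsCohenMacaulayLocalRing S := by
  obtain ⟨hN, rs, hmem, hrs, hlen⟩ := h
  refine ⟨isNoetherianRing_of_ringEquiv R e, rs.map e, ?_, ?_, ?_⟩
  · intro x hx
    obtain ⟨r, hr, rfl⟩ := List.mem_map.mp hx
    rw [IsLocalRing.mem_maximalIdeal, mem_nonunits_iff, MulEquiv.isUnit_map]
    exact (IsLocalRing.mem_maximalIdeal r).mp (hmem r hr)
  · refine (AddEquiv.isRegular_congr (e := e.toAddEquiv) ?_).mp hrs
    rw [List.forall₂_map_right_iff]
    exact List.forall₂_same.mpr fun r _ x => map_mul e r x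
  · rw [List.length_map, hlen, ringKrullDim_eq_of_ringEquiv e]

theorem IsCohenMacaulayRing.of_ringEquiv {R : Type u} {S : Type v} [CommRing R] [CommRing S]
    (e : R ≃+* S) (h : IsCohenMacaulayRing R) : IsCohenMacaulayRing S :=
  have := h.1
  ⟨isNoetherianRing_of_ringEquiv R e, fun p _ => (h.2 (p.comap e)).of_ringEquiv <|
    IsLocalization.ringEquivOfRingEquiv (Localization.AtPrime (p.comap e))
      (Localization.AtPrime p) e (e.map_primeCompl_comap_eq p)⟩

theorem Polynomial.mem_map_C_of_monic_mul_mem {R : Type*} [CommRing R] {L : Ideal R} {f g : R[X]}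
    (hf : f.Monic) (h : f * g ∈ L.map C) : g ∈ L.map C := by
  have hker : L.map C = RingHom.ker (mapRingHom (Ideal.Quotient.mk L)) := by
    rw [ker_mapRingHom, Ideal.mk_ker]
  rw [hker, RingHom.mem_ker, coe_mapRingHom] at h ⊢
  rw [Polynomial.map_mul] at h
  exact ((hf.map _).mul_right_eq_zero_iff).mp h

/-- A system of parameters of R stays weakly regular on R[X] by flatness. Either p = 𝔪R[X], or p =
𝔪R[X] + (f) with f monic; in the second case f is appended, being regular modulo any ideal extended
from R. -/
theorem Polynomial.isCohenMacaulayLocalRing_localization_atPrime_of_comap_eq_maximalIdeal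
    {R : Type u} [CommRing R] [IsLocalRing R] (hR : IsCohenMacaulayLocalRing R) (p : Ideal R[X])
    [p.IsPrime] (hp : p.comap C = maximalIdeal R) :
    IsCohenMacaulayLocalRing (Localization.AtPrime p) := by
  obtain ⟨hN, hM⟩ := hR
  obtain ⟨d, hd⟩ : ∃ d : ℕ, ringKrullDim R = d := by
    obtain ⟨rs, -, -, hlen⟩ := hM
    exact ⟨_, hlen.symm⟩
  obtain ⟨a, ha⟩ := exists_isSystemOfParameters hd
  let rs := (List.finRange d).map a
  have hspan : Ideal.ofList rs = Ideal.span (Set.range a) := ofList_map_finRange a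
  have hrs : IsWeaklyRegular R[X] (rs.map C) :=
    (hM.isRegular ha (List.length_finRange (n := d)) List.mem_finRange).toIsWeaklyRegular.of_flat
      (S := R[X])
  have hofList : Ideal.ofList (rs.map C) = (Ideal.span (Set.range a)).map C := by
    rw [← Ideal.map_ofList, hspan]
  have hrad : (maximalIdeal R).map C ≤ (Ideal.ofList (rs.map C)).radical := by
    rw [hofList, ← ha.2]
    exact Ideal.map_radical_le _
  have hle : (maximalIdeal R).map C ≤ p := by
    rw [← hp]
    exact Ideal.map_comap_le
  have hmem : ∀ r ∈ rs.map C, r ∈ p := by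
    intro r hr
    obtain ⟨s, hs, rfl⟩ := List.mem_map.mp hr
    obtain ⟨i, -, rfl⟩ := List.mem_map.mp hs
    exact hle (Ideal.mem_map_of_mem _ (ha.mem_maximalIdeal i))
  by_cases heq : p = (maximalIdeal R).map C
  · exact isCohenMacaulayLocalRing_localization_atPrime p hmem hrs (heq.trans_le hrad)
  · obtain ⟨f, hf, hpf⟩ := Polynomial.exists_monic_span_sup_map_eq R p
      (by rw [hp]; exact maximalIdeal.isMaximal R) (by rwa [hp])
    rw [hp] at hpf
    have hfp : f ∈ p := hpf ▸ Ideal.mem_sup_right (Ideal.mem_span_singleton_self f)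
    refine isCohenMacaulayLocalRing_localization_atPrime p (rs := rs.map C ++ [f]) ?_ ?_ ?_
    · intro r hr
      rw [List.mem_append, List.mem_singleton] at hr
      obtain hr | rfl := hr
      · exact hmem r hr
      · exact hfp
    · refine (isWeaklyRegular_append_iff _ _ _).mpr ⟨hrs, ?_⟩
      rw [isWeaklyRegular_singleton_iff, isSMulRegular_iff_right_eq_zero_of_smul]
      intro x hx
      obtain ⟨g, rfl⟩ := Submodule.Quotient.mk_surjective _ x
      rw [← Submodule.Quotient.mk_smul, Submodule.Quotient.mk_eq_zero, hofList, smul_eq_mul,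
        smul_eq_mul, Ideal.mul_top] at hx
      rw [Submodule.Quotient.mk_eq_zero, hofList, smul_eq_mul, Ideal.mul_top]
      exact Polynomial.mem_map_C_of_monic_mul_mem hf hx
    · rw [hpf, Ideal.ofList_append, Ideal.ofList_singleton]
      exact sup_le (hrad.trans (Ideal.radical_mono le_sup_left))
        (le_sup_right.trans Ideal.le_radical)

attribute [local instance] Polynomial.algebra Polynomial.isLocalization in
theorem IsCohenMacaulayRing.polynomial {R : Type u} [CommRing R] (hR : IsCohenMacaulayRing R) :
    IsCohenMacaulayRing R[X] := by
  have := hR.1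
  refine ⟨inferInstance, fun p _ => ?_⟩
  let q := p.comap C
  let S := (Localization.AtPrime q)[X]
  let pc := Submonoid.map Polynomial.C.toMonoidHom q.primeCompl
  let : Algebra R[X] S := algebra R (Localization.AtPrime q)
  have : IsLocalization pc S := Polynomial.isLocalization _ _
  let pS := p.map (algebraMap R[X] S)
  have disj : Disjoint (pc : Set R[X]) (p : Set R[X]) := by
    simpa [pc, q] using! Set.disjoint_image_left.mpr
      (Set.disjoint_compl_left_iff_subset.mpr (fun _ a ↦ a))
  have : pS.IsPrime := IsLocalization.isPrime_of_isPrime_disjoint pc _ _ ‹_› disj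
  -- Localizing R[X] at p passes through R_q[X] with q = p ∩ R, which reduces to a prime lying over
  -- the maximal ideal of a local coefficient ring.
  have : IsLocalization.AtPrime (Localization.AtPrime pS) p := by
    convert IsLocalization.isLocalization_isLocalization_atPrime_isLocalization pc
      (Localization.AtPrime pS) pS
    exact (IsLocalization.under_map_of_isPrime_disjoint pc _ ‹_› disj).symm
  have eq : pS.comap C = maximalIdeal (Localization.AtPrime q) := by
    rw [← IsLocalization.map_under q.primeCompl _ (pS.comap C),
      ← IsLocalization.map_under q.primeCompl _ (maximalIdeal (Localization.AtPrime q))]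
    simp only [Ideal.comap_comap, S, pS]
    rw [← Polynomial.algebraMap_eq (R := Localization.AtPrime q),
      ← IsScalarTower.algebraMap_eq R (Localization.AtPrime q) (Localization.AtPrime q)[X],
      IsScalarTower.algebraMap_eq R R[X] (Localization.AtPrime q)[X], ← Ideal.comap_comap,
      ← Ideal.under_def R[X], IsLocalization.under_map_of_isPrime_disjoint pc _ ‹_› disj]
    simp [q, IsLocalization.AtPrime.under_maximalIdeal (Localization.AtPrime q) q]
  exact (Polynomial.isCohenMacaulayLocalRing_localization_atPrime_of_comap_eq_maximalIdeal
    (hR.2 q) pS eq).of_ringEquiv (IsLocalization.algEquiv p.primeCompl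
    (Localization.AtPrime pS) (Localization.AtPrime p)).toRingEquiv

theorem IsCohenMacaulayRing.mvPolynomial {R : Type u} [CommRing R] (hR : IsCohenMacaulayRing R)
    (n : ℕ) : IsCohenMacaulayRing (MvPolynomial (Fin n) R) := by
  induction n with
  | zero => exact hR.of_ringEquiv (MvPolynomial.isEmptyRingEquiv R _).symm
  | succ n ih => exact ih.polynomial.of_ringEquiv (MvPolynomial.finSuccEquiv R n).symm.toRingEquiv

end CohenMacaulayRings

/-! ### The associated graded ring of a parameter ideal -/

section AssociatedGraded

universe u

variable {A : Type u} [CommRing A] [IsLocalRing A] [IsNoetherianRing A] {d : ℕ} {a : Fin d → A}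

theorem isCohenMacaulayRing_quotient_of_pow_le {Q : Ideal A} {k : ℕ}
    (hk : maximalIdeal A ^ k ≤ Q) : IsCohenMacaulayRing (A ⧸ Q) := by
  refine ⟨inferInstance, fun p hp => isCohenMacaulayLocalRing_localization_atPrime p (rs := [])
    (by simp) (IsWeaklyRegular.nil _ _) fun x hx => ?_⟩
  obtain ⟨x, rfl⟩ := Ideal.Quotient.mk_surjective x
  refine ⟨k, ?_⟩
  have hxm : x ∈ maximalIdeal A := by
    have h : p.comap (Ideal.Quotient.mk Q) ≠ ⊤ := Ideal.comap_ne_top _ hp.ne_top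
    exact IsLocalRing.le_maximalIdeal h hx
  rw [← map_pow, Ideal.Quotient.eq_zero_iff_mem.mpr (hk (Ideal.pow_mem_pow hxm k))]
  exact zero_mem _

/-- Quasi-regularity as an isomorphism: gr_Q(A) and (A/Q)[X_1, …, X_d] are quotients of A[X] by the
same kernel. -/
theorem IsPermutablyRegular.ker_comp_reesEval_eq {A : Type*} [CommRing A] {a : Fin d → A}
    (ha : IsPermutablyRegular a)
    (h : ∀ i, a i ∈ Ideal.span (Set.range a)) {G : Type*} [CommRing G]
    {π : reesAlgebra (Ideal.span (Set.range a)) →+* G} (hπ : IsInitialFormMap π) :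
    RingHom.ker (π.comp (reesEval a h : MvPolynomial (Fin d) A →+* _)) =
      RingHom.ker (MvPolynomial.map (σ := Fin d) (Ideal.Quotient.mk (Ideal.span (Set.range a)))) := by
  rw [MvPolynomial.ker_map, Ideal.mk_ker]
  refine le_antisymm (fun F hF => ?_) ?_
  · rw [RingHom.mem_ker, RingHom.comp_apply, hπ] at hF
    exact ha.mem_map_C_of_reesEval le_rfl h fun n => by
      rw [← pow_succ']
      exact hF n
  · rw [Ideal.map_le_iff_le_comap]
    intro r hr
    rw [Ideal.mem_comap, RingHom.mem_ker, RingHom.comp_apply, hπ]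
    intro n
    change (reesEval a h (MvPolynomial.C r) : Polynomial A).coeff n ∈ _
    rw [← MvPolynomial.algebraMap_eq, AlgHom.commutes]
    change (Polynomial.C r).coeff n ∈ _
    rw [Polynomial.coeff_C]
    split_ifs with hn
    · rwa [hn, zero_add, pow_one]
    · exact zero_mem _

theorem IsPermutablyRegular.isCohenMacaulayRing_of_isInitialFormMap (ha : IsPermutablyRegular a)
    {k : ℕ} (hk : maximalIdeal A ^ k ≤ Ideal.span (Set.range a)) {G : Type*} [CommRing G]
    {π : reesAlgebra (Ideal.span (Set.range a)) →+* G} (hπ : IsInitialFormMap π)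
    (hsurj : Function.Surjective π) : IsCohenMacaulayRing G := by
  have h : ∀ i, a i ∈ Ideal.span (Set.range a) := fun i => Ideal.subset_span ⟨i, rfl⟩
  have hφ : Function.Surjective (π.comp (reesEval a h : MvPolynomial (Fin d) A →+* _)) :=
    hsurj.comp (reesEval_surjective a h)
  have hmap := MvPolynomial.map_surjective (σ := Fin d)
    (Ideal.Quotient.mk (Ideal.span (Set.range a))) Ideal.Quotient.mk_surjective
  exact ((isCohenMacaulayRing_quotient_of_pow_le hk).mvPolynomial d).of_ringEquiv
    ((RingHom.quotientKerEquivOfSurjective hmap).symm.trans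
      ((Ideal.quotEquivOfEq (ha.ker_comp_reesEval_eq h hπ).symm).trans
        (RingHom.quotientKerEquivOfSurjective hφ)))

theorem IsPermutablyRegular.isCohenMacaulayRing_associatedGradedRing (ha : IsPermutablyRegular a)
    {k : ℕ} (hk : maximalIdeal A ^ k ≤ Ideal.span (Set.range a)) :
    IsCohenMacaulayRing (AssociatedGradedRing (Ideal.span (Set.range a))) := by
  have h := ha.isCohenMacaulayRing_of_isInitialFormMap hk isInitialFormMap_quotientMk
  exact h Ideal.Quotient.mk_surjective

end AssociatedGraded

end

section

open IsLocalRing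

/-! ### Each condition against I = (a_1) -/

section Equivalences

universe u

variable {A : Type u} [CommRing A] [IsLocalRing A] [IsNoetherianRing A] {d : ℕ} {I : Ideal A}
  {hd : 0 < d}

/-- The canonical ideal `I` is generated by the first member of a system of parameters. -/
def IsGeneratedByParameter {A : Type*} [CommRing A] [IsLocalRing A] (I : Ideal A) {d : ℕ} (hd : 0 < d) : Prop :=
  ∃ a : Fin d → A, IsSystemOfParameters a ∧ I = Ideal.span {a ⟨0, hd⟩}

namespace IsGeneratedByParameter

theorem existsParameterIdeal {A : Type*} [CommRing A] [IsLocalRing A] {I : Ideal A}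
    (h : IsGeneratedByParameter I hd)
    {P : ∀ Q J : Ideal A, Q ≤ J → Prop}
    (hP : ∀ a : Fin d → A, IsSystemOfParameters a → ∀ J (hJ : Ideal.span (Set.range a) ≤ J),
      J = Ideal.span (Set.range a) → P _ J hJ) : ExistsParameterIdeal I hd P := by
  obtain ⟨a, ha, rfl⟩ := h
  refine ⟨a, ha, Ideal.mem_span_singleton_self _, hP a ha _ _ ?_⟩
  rw [sup_eq_right, Ideal.span_singleton_le_iff_mem]
  exact Ideal.subset_span ⟨_, rfl⟩

theorem existsSumEqParameterIdeal (h : IsGeneratedByParameter I hd) :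
    ExistsSumEqParameterIdeal I hd :=
  h.existsParameterIdeal fun _ _ _ _ h => h

theorem existsSallyModuleZero (h : IsGeneratedByParameter I hd) : ExistsSallyModuleZero I hd :=
  h.existsParameterIdeal fun _ _ J hJ h => subsingleton_sallyModule_of_sq_le hJ (by rw [← h, sq])

theorem isGoto (h : IsGeneratedByParameter I hd) (hA : IsMaximalCohenMacaulay A A) :
    IsGoto 0 I hd :=
  h.existsParameterIdeal fun a ha J hJ h => by
    have := subsingleton_sallyModule_of_sq_le hJ (by rw [← h, sq])
    exact ⟨sallyRank_eq_zero_of_subsingleton hJ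
      ((hA.isPermutablyRegular ha).isPrime_map _ ha.span_le),
      sallyGeneratedInDegreeOne_of_subsingleton hJ⟩

theorem isReduction_of_eq {A : Type*} [CommRing A] {Q J : Ideal A} (h : J = Q) : IsReduction Q J :=
  ⟨h.ge, 0, by simp [h]⟩

theorem existsReductionWithE1 (h : IsGeneratedByParameter I hd) (hA : IsMaximalCohenMacaulay A A)
    {p : ℤ → Prop} (hp : p 0) : ExistsReductionWithE1 I hd p :=
  h.existsParameterIdeal fun a ha J hJ h => by
    obtain ⟨k, hk⟩ := ha.exists_pow_le
    obtain ⟨e, he, he1⟩ := (hA.isPermutablyRegular ha).isHilbertCoefficients hd hk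
    exact ⟨isReduction_of_eq h, e, h ▸ he, he1 ▸ hp⟩

theorem existsReductionGrCohenMacaulay (h : IsGeneratedByParameter I hd)
    (hA : IsMaximalCohenMacaulay A A) : ExistsReductionGrCohenMacaulay I hd :=
  h.existsParameterIdeal fun a ha J hJ h => by
    refine ⟨isReduction_of_eq h, ?_⟩
    rw [h]
    obtain ⟨k, hk⟩ := ha.exists_pow_le
    exact (hA.isPermutablyRegular ha).isCohenMacaulayRing_associatedGradedRing hk

theorem cmType_eq_one (h : IsGeneratedByParameter I hd) (hA : IsMaximalCohenMacaulay A A)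
    (hI : IsCanonicalIdeal d I) : cmType A d = 1 := by
  obtain ⟨a, ha, h⟩ := h
  exact hI.cmType_eq_one hA ha (h ▸ Ideal.mem_span_singleton_self _) h

theorem isGorensteinLocalRing (h : IsGeneratedByParameter I hd) (hA : IsMaximalCohenMacaulay A A)
    (hI : IsCanonicalIdeal d I) : IsGorensteinLocalRing A := by
  obtain ⟨a, ha, h⟩ := h
  exact hI.isGorensteinLocalRing hA ha h

theorem of_isGorensteinLocalRing (hA : IsMaximalCohenMacaulay A A) (hI : IsCanonicalIdeal d I)
    (hdim : ringKrullDim A = d) (hG : IsGorensteinLocalRing A) : IsGeneratedByParameter I hd := by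
  obtain ⟨x, hx, hIx⟩ := hI.exists_eq_span_singleton hA hdim hG
  have hxm : x ∈ maximalIdeal A :=
    IsLocalRing.le_maximalIdeal hI.1 (hIx ▸ Ideal.mem_span_singleton_self x)
  obtain ⟨a, ha, rfl⟩ := exists_isSystemOfParameters_of_isSMulRegular hd hdim hx hxm
  exact ⟨a, ha, hIx⟩

theorem of_existsSumEqParameterIdeal (hI : IsCanonicalIdeal d I)
    (h : ExistsSumEqParameterIdeal I hd) : IsGeneratedByParameter I hd := by
  obtain ⟨a, ha, h₀, h⟩ := h
  exact ⟨a, ha, hI.eq_span_singleton_of_sup_eq ha h₀ h⟩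

theorem of_existsSallyModuleZero (hA : IsMaximalCohenMacaulay A A) (hI : IsCanonicalIdeal d I)
    (h : ExistsSallyModuleZero I hd) : IsGeneratedByParameter I hd := by
  obtain ⟨a, ha, h₀, h⟩ := h
  exact ⟨a, ha, hI.eq_span_singleton_of_sq_le hA ha h₀ (sq_le_of_subsingleton_sallyModule _)⟩

theorem of_isGoto (hA : IsMaximalCohenMacaulay A A) (hI : IsCanonicalIdeal d I)
    (h : IsGoto 0 I hd) : IsGeneratedByParameter I hd := by
  obtain ⟨a, ha, h₀, h, -⟩ := h
  obtain ⟨k, hk⟩ := ha.exists_pow_le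
  exact of_existsSallyModuleZero hA hI ⟨a, ha, h₀, subsingleton_sallyModule_of_sallyRank_eq_zero
    (hA.isPermutablyRegular ha) hk _ (by simpa using h)⟩

theorem of_existsReductionWithE1 (hA : IsMaximalCohenMacaulay A A) (hI : IsCanonicalIdeal d I)
    (h : ExistsReductionWithE1 I hd fun e₁ => e₁ < (cmType A d : ℤ)) :
    IsGeneratedByParameter I hd := by
  obtain ⟨a, ha, h₀, hred, e, he, he1⟩ := h
  obtain ⟨k, hk⟩ := ha.exists_pow_le
  refine of_existsSallyModuleZero hA hI ⟨a, ha, h₀,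
    (subsingleton_sallyModule_iff _).mpr ?_⟩
  by_contra hS
  obtain ⟨q, hq⟩ := ENat.ne_top_iff_exists.mp
    (Module.length_ne_top_iff.mpr (isFiniteLength_quotient_of_pow_le hk))
  obtain ⟨j, hj⟩ := ENat.ne_top_iff_exists.mp
    (Module.length_ne_top_iff.mpr (isFiniteLength_quotient_of_pow_le (hk.trans hred.1)))
  -- The two length inequalities combine to e_1(J) ≥ ℓ(A/Q) - ℓ(A/J) + 1 ≥ r(A), contrary to e_1(J)
  -- < r(A).
  have h1 := (hA.isPermutablyRegular ha).length_add_one_le hd hk hred hS he hq.symm hj.symm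
  have h2 := hI.length_quotient_add_cmType_le hA ha h₀
  rw [← hq, ← hj] at h2
  have h3 : j + cmType A d ≤ q + 1 := by exact_mod_cast h2
  omega

theorem of_existsReductionGrCohenMacaulay (hA : IsMaximalCohenMacaulay A A)
    (hI : IsCanonicalIdeal d I) (h : ExistsReductionGrCohenMacaulay I hd) :
    IsGeneratedByParameter I hd := by
  obtain ⟨a, ha, h₀, hred, hgr⟩ := h
  exact ⟨a, ha, hI.eq_span_singleton_of_sq_le hA ha h₀
    (hI.sq_le_of_isCohenMacaulayRing hA ha h₀ hred hgr)⟩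

end IsGeneratedByParameter

end Equivalences

end

theorem theorem11p1 {A : Type*} [CommRing A] [IsLocalRing A]
    (hA : IsCohenMacaulayLocalRing A) (d : ℕ) (hd : 0 < d) (hdim : ringKrullDim A = d)
    (I : Ideal A) (hI : IsCanonicalIdeal d I) :
    [IsGoto 0 I hd,
      ExistsSallyModuleZero I hd,
      ExistsReductionWithE1 I hd (fun e₁ => e₁ < (cmType A d : ℤ)),
      ExistsReductionWithE1 I hd (fun e₁ => e₁ = (cmType A d : ℤ) - 1)].TFAE ∧
    (ExistsSumEqParameterIdeal I hd → IsGoto 0 I hd) ∧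
    (IsGoto 0 I hd → IsGorensteinLocalRing A) ∧
    (ExistsSumEqParameterIdeal I hd → ExistsReductionGrCohenMacaulay I hd) ∧
    (ExistsReductionGrCohenMacaulay I hd → IsGorensteinLocalRing A) ∧
    (ExistsReductionWithE1 I hd (fun e₁ => e₁ = 0) →
      ExistsReductionWithE1 I hd (fun e₁ => e₁ < (cmType A d : ℤ))) ∧
    -- if the residue field is infinite, all the conditions are equivalent
    (Infinite (IsLocalRing.ResidueField A) →
      [IsGoto 0 I hd,
        IsGorensteinLocalRing A,
        ExistsSumEqParameterIdeal I hd,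
        ExistsSallyModuleZero I hd,
        ExistsReductionWithE1 I hd (fun e₁ => e₁ < (cmType A d : ℤ)),
        ExistsReductionWithE1 I hd (fun e₁ => e₁ = (cmType A d : ℤ) - 1),
        ExistsReductionWithE1 I hd (fun e₁ => e₁ = 0),
        ExistsReductionGrCohenMacaulay I hd].TFAE) := by
  have : IsNoetherianRing A := hA.1
  have hM : IsMaximalCohenMacaulay A A := hA.2
  have hp (h : IsGeneratedByParameter I hd) := h.cmType_eq_one hM hI
  obtain ⟨a, ha⟩ := exists_isSystemOfParameters hdim
  have h1 : IsGoto 0 I hd ↔ IsGeneratedByParameter I hd :=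
    ⟨.of_isGoto hM hI, fun h => h.isGoto hM⟩
  have h2 : IsGorensteinLocalRing A ↔ IsGeneratedByParameter I hd :=
    ⟨.of_isGorensteinLocalRing hM hI hdim, fun h => h.isGorensteinLocalRing hM hI⟩
  have h3 : ExistsSumEqParameterIdeal I hd ↔ IsGeneratedByParameter I hd :=
    ⟨.of_existsSumEqParameterIdeal hI, fun h => h.existsSumEqParameterIdeal⟩
  have h4 : ExistsSallyModuleZero I hd ↔ IsGeneratedByParameter I hd :=
    ⟨.of_existsSallyModuleZero hM hI, fun h => h.existsSallyModuleZero⟩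
  have h5 : ExistsReductionWithE1 I hd (fun e₁ => e₁ < (cmType A d : ℤ)) ↔
      IsGeneratedByParameter I hd :=
    ⟨.of_existsReductionWithE1 hM hI, fun h => h.existsReductionWithE1 hM (by simp [hp h])⟩
  have h6 : ExistsReductionWithE1 I hd (fun e₁ => e₁ = (cmType A d : ℤ) - 1) ↔
      IsGeneratedByParameter I hd := by
    refine ⟨fun ⟨a, ha, h₀, hred, e, he, he1⟩ => h5.mp ⟨a, ha, h₀, hred, e, he, ?_⟩,
      fun h => h.existsReductionWithE1 hM (by simp [hp h])⟩
    dsimp only at he1 ⊢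
    omega
  have h7 : ExistsReductionWithE1 I hd (fun e₁ => e₁ = 0) ↔ IsGeneratedByParameter I hd := by
    refine ⟨fun ⟨a, ha, h₀, hred, e, he, he1⟩ => h5.mp ⟨a, ha, h₀, hred, e, he, ?_⟩,
      fun h => h.existsReductionWithE1 hM rfl⟩
    -- Positivity of the type turns e_1 = 0 into e_1 < r(A).
    have := one_le_cmType hM ha
    dsimp only at he1 ⊢
    omega
  have h8 : ExistsReductionGrCohenMacaulay I hd ↔ IsGeneratedByParameter I hd :=
    ⟨.of_existsReductionGrCohenMacaulay hM hI, fun h => h.existsReductionGrCohenMacaulay hM⟩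
  simp only [h1, h2, h3, h4, h5, h6, h7, h8, List.tfae_cons_cons, List.tfae_singleton, imp_self,
    iff_self, and_self, implies_true]
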